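/- Let $H$ be a complex Hilbert space and let $A$ be a diagonal parabolic operator on $H$: there is an orthonormal Hilbert basis $(e_n)_{n\ge1}$ of $H$ with $Ae_n=\lambda_ne_n$, $D(A)=\{x\in H: \sum_n|\lambda_nx_n|^2<\infty\}$ and $Ax=\sum_n\lambda_nx_ne_n$ (where $x_n=\langle x,e_n\rangle$), the sequence $(\mathrm{Re}\,\lambda_n)$ is non-increasing and tends to $-\infty$, and $|\mathrm{Re}\,\lambda_n|\ge C|\mathrm{Im}\,\lambda_n|$ for all $n$ and some $C>0$. Set $c_A=\max(0,\max_n\mathrm{Re}\,\lambda_n)$. For $r\in\mathbb R$ let $D_r(A)$ be the Hilbert space of all $x=\sum_nx_ne_n$ with $\|x\|_{D_r(A)}^2=\sum_n(1+|\lambda_n|^2)^r|x_n|^2<\infty$ (formal series, identified with coordinate sequences, if $r<0$), so $D_0(A)=H$, $D_1(A)=D(A)$ and $D_{-1}(A)=D(A)'$; $A$ extends to a bounded operator $H\to D(A)'$. Let $\lambda>0$. Let $L_\lambda$ be the span of the $e_n$ with $\mathrm{Re}\,\lambda_n\ge-\lambda$, $H_\lambda$ the closed span in $H$ of the other $e_n$,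 $P_L,P_H$ the orthogonal projections onto them, and $m(\lambda)$ the greatest multiplicity of an eigenvalue of $A$ in $L_\lambda$ ($0$ if there is none). A tuple $B=(B_1,\dots,B_m)\in(D(A)')^m$, identified with $z\in\mathbb C^m\mapsto\sum_jz_jB_j$, is called $F_\lambda$-admissible if $m\ge m(\lambda)$ and there is a partition of $(e_n)$ into $m(\lambda)$ infinite families, such that in each family the eigenvalues $\lambda_n$ with $\mathrm{Re}\,\lambda_n\ge-\lambda$ are pairwise distinct and, for $1\le j\le m(\lambda)$, the coordinate of $B_j$ along $e_n$ vanishes for every $e_n$ outside the $j$-th family and is nonzero for every $e_n\in L_\lambda$ in the $j$-th family (no condition if $m(\lambda)=0$). For $\mu\in\mathbb R$ let $D_\mu=(A-\mu)P_L+AP_H$. Let $\mathcal{GL}_H(D(A)')$ be the set of bounded automorphisms of $D(A)'$ that restrict to bounded automorphisms of $H$. For $B'\in(D(A)')^{k}$, a parabolic $F$-equivalence between $(A,B')$ and $D_\mu$ is a pair $(T,K)$ with $T\in\mathcal{GL}_H(D(A)')$ and $K:H\to\mathbb C^{k}$ bounded linear vanishing on $H_\lambda$, such that $T(A+B'K)=D_\mu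 T$ in $\mathcal L(H,D(A)')$ and $TB'_j=B'_j$ for all $j$. Let $s\in[0,1]$, $\gamma=\min(1-s,\tfrac12)$ and $B\in(D_{-s}(A))^m$. Let $\mathcal F:D_\gamma(A)\to D_{-1/2}(A)$ be a map for which there exist $\eta,\kappa>0$ and a non-decreasing $\Phi:[0,\infty)\to[0,\infty)$, continuous at $0$ with $\Phi(0)=0$, such that for all $u,v\in D_\gamma(A)$ with $\|u\|_H,\|v\|_H\le\eta$ $$\|\mathcal F(u)\|_{D_{-1/2}(A)}\le\Phi(\|u\|_H)\|u\|_{D_\gamma(A)},$$ $$\|\mathcal F(u)-\mathcal F(v)\|_{D_{-1/2}(A)}\le \kappa(\|u\|_{D_\gamma(A)}+\|v\|_{D_\gamma(A)})\|u-v\|_H+\kappa\,\Phi(\|u\|_H+\|v\|_H)\|u-v\|_{D_\gamma(A)}.$$ **Theorem.** Suppose that $B$ is $F_\lambda$-admissible and put $B'=(B_1,\dots,B_{m(\lambda)})$ (the remaining controls are set to zero). (i) For almost every $\mu\ge\lambda+c_A$ there is a parabolic $F$-equivalence $(T,K)$ between $(A,B')$ and $D_\mu$. (ii) Let $\mu>\lambda+c_A$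 and let $(T,K)$ be any parabolic $F$-equivalence between $(A,B')$ and $D_\mu$. Then there exists $\delta>0$ such that for every $u_0\in H$ with $\|u_0\|_H\le\delta$ there is a unique solution $u\in C^0_b([0,\infty);H)\cap L^2((0,\infty);D_\gamma(A))$ of $$\partial_tu=(A+B'K)u+\mathcal F(u),\qquad u(0)=u_0,$$ where the equation is understood in $D(A)'$ in integrated form: the right-hand side is locally (Bochner) integrable with values in $D(A)'$ and $u(t)=u_0+\int_0^t\big((A+B'K)u+\mathcal F(u)\big)\,d\tau$ for all $t\ge0$. Moreover $$\|u(t)\|_H\le\|T\|_{\mathcal L(H)}\|T^{-1}\|_{\mathcal L(H)}\,e^{-\lambda t}\|u_0\|_H\qquad\text{for all }t\ge0.$$ -/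

import Mathlib

open MeasureTheory Set Filter Topology

noncomputable section

/-- A diagonal parabolic operator `A` on a complex Hilbert space `H`, together with its
diagonalisation: an orthonormal Hilbert basis `(e_n)` of eigenvectors with eigenvalues `(λ_n)`,
`D(A) = {x ∈ H | A x ∈ H}` and `A x = ∑ λ_n x_n e_n`, where `x_n = ⟨x, e_n⟩`.  The real parts of
the eigenvalues are non-increasing and tend to `-∞`, and `|Re λ_n| ≥ C |Im λ_n|` for some
`C > 0`. -/
structure DiagonalParabolic {H : Type*} [NormedAddCommGroup H] [InnerProductSpace ℂ H]
    (A : H →ₗ.[ℂ] H) where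
  /-- the orthonormal basis of eigenvectors; `basis.repr x n` is the coordinate `x_n` -/
  basis : HilbertBasis ℕ ℂ H
  /-- the eigenvalues -/
  eig : ℕ → ℂ
  mem_domain_iff : ∀ x : H, x ∈ A.domain ↔ Summable fun n => ‖eig n * basis.repr x n‖ ^ 2
  repr_apply : ∀ (x : A.domain) (n : ℕ), basis.repr (A x) n = eig n * basis.repr (x : H) n
  antitone_re : Antitone fun n => (eig n).re
  tendsto_re : Tendsto (fun n => (eig n).re) atTop atBot
  sectorial : ∃ C : ℝ, 0 < C ∧ ∀ n, C * |(eig n).im| ≤ |(eig n).re|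

namespace DiagonalParabolic

variable {H : Type*} [NormedAddCommGroup H] [InnerProductSpace ℂ H] {A : H →ₗ.[ℂ] H}

/-! ### The scale of spaces `D_r(A)` -/

/-- The weight `(1 + |λ_n|²) ^ r`. -/
def weight (P : DiagonalParabolic A) (r : ℝ) (n : ℕ) : ℝ := (1 + ‖P.eig n‖ ^ 2) ^ r

/-- `(∑ (1 + |λ_n|²) ^ r |x_n|²) ^ (1/2)`, the norm of `D_r(A)` in terms of the coordinates in the
basis `(e_n)`.  For `r = 0` it is the norm of `H`. -/
def seqNorm (P : DiagonalParabolic A) (r : ℝ) (x : ℕ → ℂ) : ℝ :=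
  Real.sqrt (∑' n, P.weight r n * ‖x n‖ ^ 2)

theorem weight_pos (P : DiagonalParabolic A) (r : ℝ) (n : ℕ) : 0 < P.weight r n := by
  unfold weight; positivity

theorem weight_mono (P : DiagonalParabolic A) {r r' : ℝ} (h : r' ≤ r) (n : ℕ) :
    P.weight r' n ≤ P.weight r n :=
  Real.rpow_le_rpow_of_exponent_le (by nlinarith [sq_nonneg ‖P.eig n‖]) h

theorem weight_zero (P : DiagonalParabolic A) (n : ℕ) : P.weight 0 n = 1 := by
  simp [weight]

theorem weight_neg_one (P : DiagonalParabolic A) (n : ℕ) :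
    P.weight (-1) n = (1 + ‖P.eig n‖ ^ 2)⁻¹ := by
  simp [weight, Real.rpow_neg_one]

theorem memlp_two_iff (x : ℕ → ℂ) : Memℓp x 2 ↔ Summable fun n => ‖x n‖ ^ 2 := by
  rw [memℓp_gen_iff (by norm_num)]
  simp

theorem norm_sqrt_weight_mul_sq (P : DiagonalParabolic A) (r : ℝ) (n : ℕ) (z : ℂ) :
    ‖(Real.sqrt (P.weight r n) : ℂ) * z‖ ^ 2 = P.weight r n * ‖z‖ ^ 2 := by
  rw [norm_mul, mul_pow, Complex.norm_real, Real.norm_eq_abs, sq_abs,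
    Real.sq_sqrt (P.weight_pos r n).le]

/-- The coordinate sequences of the elements of `D_r(A)`. -/
def scaleSubmodule (P : DiagonalParabolic A) (r : ℝ) : Submodule ℂ (ℕ → ℂ) where
  carrier := {x | Summable fun n => P.weight r n * ‖x n‖ ^ 2}
  zero_mem' := by simp
  add_mem' := by
    intro x y hx hy
    have key : ∀ z : ℕ → ℂ, (Summable fun n => P.weight r n * ‖z n‖ ^ 2) ↔
        Memℓp (fun n => (Real.sqrt (P.weight r n) : ℂ) * z n) 2 := by
      intro z
      rw [memlp_two_iff]
      simp only [norm_sqrt_weight_mul_sq]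
    simp only [Set.mem_ofPred_eq] at hx hy ⊢
    rw [key] at hx hy ⊢
    have := hx.add hy
    convert this using 1
    funext n
    simp [mul_add]
  smul_mem' := by
    intro c x hx
    simp only [Set.mem_ofPred_eq] at hx ⊢
    refine (hx.mul_left (‖c‖ ^ 2)).congr fun n => ?_
    simp only [Pi.smul_apply, smul_eq_mul, norm_mul]
    ring

/-- The Hilbert space `D_r(A)`, `r ∈ ℝ`, realised as the space of coordinate sequences `(x_n)` with
`∑ (1 + |λ_n|²) ^ r |x_n|² < ∞` and normed by the square root of that sum.  For `r ≥ 0` it is the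
domain of `(-A + δ) ^ r`, for `r < 0` the completion of `H`; `D_{-1}(A)` is the dual `D(A)'`. -/
def Scale (P : DiagonalParabolic A) (r : ℝ) : Type := P.scaleSubmodule r

instance (P : DiagonalParabolic A) (r : ℝ) : AddCommGroup (P.Scale r) :=
  inferInstanceAs (AddCommGroup (P.scaleSubmodule r))

instance (P : DiagonalParabolic A) (r : ℝ) : Module ℂ (P.Scale r) :=
  inferInstanceAs (Module ℂ (P.scaleSubmodule r))

/-- The coordinate sequence of an element of `D_r(A)`. -/
def coords (P : DiagonalParabolic A) {r : ℝ} : P.Scale r →ₗ[ℂ] (ℕ → ℂ) :=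
  (P.scaleSubmodule r).subtype

theorem coords_injective (P : DiagonalParabolic A) {r : ℝ} :
    Function.Injective (P.coords (r := r)) :=
  Subtype.val_injective

theorem summable_coords (P : DiagonalParabolic A) {r : ℝ} (x : P.Scale r) :
    Summable fun n => P.weight r n * ‖P.coords x n‖ ^ 2 := x.2

/-- The element of `D_r(A)` with a given coordinate sequence. -/
def ofCoords (P : DiagonalParabolic A) {r : ℝ} (x : ℕ → ℂ)
    (hx : Summable fun n => P.weight r n * ‖x n‖ ^ 2) : P.Scale r := ⟨x, hx⟩

@[simp] theorem coords_ofCoords (P : DiagonalParabolic A) {r : ℝ} (x : ℕ → ℂ)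
    (hx : Summable fun n => P.weight r n * ‖x n‖ ^ 2) : P.coords (P.ofCoords x hx) = x := rfl

/-- The identification of `D_r(A)` with `ℓ²` that sends `(x_n)` to `((1 + |λ_n|²) ^ (r/2) x_n)`. -/
def toEll (P : DiagonalParabolic A) (r : ℝ) : P.Scale r ≃ₗ[ℂ] lp (fun _ : ℕ => ℂ) 2 where
  toFun x := ⟨fun n => (Real.sqrt (P.weight r n) : ℂ) * P.coords x n, by
    have := P.summable_coords x
    exact (memlp_two_iff _).2 (by simpa only [norm_sqrt_weight_mul_sq] using this)⟩
  map_add' x y := by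
    ext n
    exact (congrArg (fun z => (Real.sqrt (P.weight r n) : ℂ) * z n) (map_add P.coords x y)).trans
      (mul_add _ _ _)
  map_smul' c x := by
    ext n
    simp [mul_left_comm]
  invFun y := P.ofCoords (fun n => (Real.sqrt (P.weight r n) : ℂ)⁻¹ * y n) (by
    have hy := (memlp_two_iff _).1 (lp.memℓp y)
    convert hy using 1
    funext n
    rw [← norm_sqrt_weight_mul_sq, mul_inv_cancel_left₀]
    exact_mod_cast (Real.sqrt_pos.2 (P.weight_pos r n)).ne')
  left_inv x := by
    apply P.coords_injective
    funext n
    simp only [coords_ofCoords]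
    rw [inv_mul_cancel_left₀]
    exact_mod_cast (Real.sqrt_pos.2 (P.weight_pos r n)).ne'
  right_inv y := by
    ext n
    simp only [coords_ofCoords]
    rw [mul_inv_cancel_left₀]
    exact_mod_cast (Real.sqrt_pos.2 (P.weight_pos r n)).ne'

instance (P : DiagonalParabolic A) (r : ℝ) : NormedAddCommGroup (P.Scale r) :=
  NormedAddCommGroup.induced (P.Scale r) (lp (fun _ : ℕ => ℂ) 2) (P.toEll r).toLinearMap
    (P.toEll r).injective

instance (P : DiagonalParabolic A) (r : ℝ) : NormedSpace ℂ (P.Scale r) :=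
  NormedSpace.induced ℂ (P.Scale r) (lp (fun _ : ℕ => ℂ) 2) (P.toEll r).toLinearMap

theorem norm_toEll (P : DiagonalParabolic A) (r : ℝ) (x : P.Scale r) : ‖P.toEll r x‖ = ‖x‖ := rfl

instance (P : DiagonalParabolic A) (r : ℝ) : CompleteSpace (P.Scale r) := by
  let f : P.Scale r ≃ₗᵢ[ℂ] lp (fun _ : ℕ => ℂ) 2 := ⟨P.toEll r, P.norm_toEll r⟩
  exact (completeSpace_congr f.toIsometryEquiv.isometry.isUniformEmbedding).2 inferInstance

theorem norm_eq_seqNorm (P : DiagonalParabolic A) {r : ℝ} (x : P.Scale r) :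
    ‖x‖ = P.seqNorm r (P.coords x) := by
  rw [← P.norm_toEll, lp.norm_eq_tsum_rpow (by norm_num), seqNorm, Real.sqrt_eq_rpow]
  congr 1
  · apply tsum_congr
    intro n
    rw [← norm_sqrt_weight_mul_sq]
    simp [toEll]

/-- The inclusion `D_r(A) ⊆ D_{r'}(A)` for `r' ≤ r`. -/
def incl (P : DiagonalParabolic A) {r r' : ℝ} (h : r' ≤ r) : P.Scale r →ₗ[ℂ] P.Scale r' where
  toFun x := P.ofCoords (P.coords x) (by
    refine Summable.of_nonneg_of_le (fun n => ?_) (fun n => ?_) (P.summable_coords x)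
    · have := P.weight_pos r' n
      positivity
    · exact mul_le_mul_of_nonneg_right (P.weight_mono h n) (by positivity))
  map_add' _ _ := rfl
  map_smul' _ _ := rfl

theorem summable_repr (P : DiagonalParabolic A) (x : H) :
    Summable fun n => ‖P.basis.repr x n‖ ^ 2 :=
  (memlp_two_iff _).1 (lp.memℓp (P.basis.repr x))

theorem seqNorm_repr (P : DiagonalParabolic A) (x : H) :
    P.seqNorm 0 (P.basis.repr x) = ‖x‖ := by
  rw [← P.basis.repr.norm_map x, lp.norm_eq_tsum_rpow (by norm_num), seqNorm, Real.sqrt_eq_rpow]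
  simp [weight_zero]

/-- Multiplication of the coordinates of `x ∈ H` by a sequence `d` with `|d_n|² ≤ c (1 + |λ_n|²)`,
as an operator from `H` to `D(A)'`. -/
def diag (P : DiagonalParabolic A) (d : ℕ → ℂ)
    (hd : ∃ c : ℝ, ∀ n, ‖d n‖ ^ 2 ≤ c * (1 + ‖P.eig n‖ ^ 2)) : H →ₗ[ℂ] P.Scale (-1) where
  toFun x := P.ofCoords (fun n => d n * P.basis.repr x n) (by
    obtain ⟨c, hc⟩ := hd
    refine Summable.of_nonneg_of_le (fun n => ?_) (fun n => ?_) ((P.summable_repr x).mul_left c)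
    · have := P.weight_pos (-1) n
      positivity
    · have h1 : (0 : ℝ) < 1 + ‖P.eig n‖ ^ 2 := by positivity
      rw [weight_neg_one, norm_mul, mul_pow, ← mul_assoc]
      refine mul_le_mul_of_nonneg_right ?_ (by positivity)
      rw [inv_mul_le_iff₀ h1, mul_comm]
      exact hc n)
  map_add' x y := by
    apply P.coords_injective
    funext n
    simp [mul_add]
  map_smul' c x := by
    apply P.coords_injective
    funext n
    simp [mul_left_comm]

/-- The inclusion `H ⊆ D(A)'`. -/
def embH (P : DiagonalParabolic A) : H →ₗ[ℂ] P.Scale (-1) :=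
  P.diag (fun _ => 1) ⟨1, fun n => by simp⟩

/-- The extension of `A` to an operator from `H` to `D(A)'`. -/
def ext (P : DiagonalParabolic A) : H →ₗ[ℂ] P.Scale (-1) :=
  P.diag P.eig ⟨1, fun n => by simp⟩

theorem ext_eq (P : DiagonalParabolic A) (x : A.domain) : P.ext (x : H) = P.embH (A x) := by
  apply P.coords_injective
  funext n
  simp [ext, embH, diag, P.repr_apply]

open Classical in
/-- An element `x ∈ H` seen as an element of `D_r(A)`, `r ≥ 0` (the value is `0` if `x ∉ D_r(A)`). -/
def toScale (P : DiagonalParabolic A) (r : ℝ) (x : H) : P.Scale r :=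
  if hx : Summable fun n => P.weight r n * ‖P.basis.repr x n‖ ^ 2 then
    P.ofCoords (P.basis.repr x) hx
  else 0

/-- Membership of `x ∈ H` in `D_r(A)`, `r ≥ 0`. -/
def MemScale (P : DiagonalParabolic A) (r : ℝ) (x : H) : Prop :=
  Summable fun n => P.weight r n * ‖P.basis.repr x n‖ ^ 2

/-! ### Frequency decomposition and control operators -/

/-- The indices of the low frequencies, `Re λ_n ≥ -lam`; `L_lam` is the span of the corresponding
`e_n` and `H_lam` the closed span of the others. -/
def low (P : DiagonalParabolic A) (lam : ℝ) : Set ℕ := {n | -lam ≤ (P.eig n).re}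

/-- `m(lam)`, the greatest multiplicity of an eigenvalue of `A` in `L_lam` (`0` if there is none). -/
def maxMult (P : DiagonalParabolic A) (lam : ℝ) : ℕ :=
  ⨆ n : P.low lam, {k | P.eig k = P.eig n}.ncard

/-- `c_A = max (0, max_n Re λ_n)`. -/
def cA (P : DiagonalParabolic A) : ℝ := max 0 (⨆ n, (P.eig n).re)

/-- `B = (B_1, …, B_m) ∈ (D(A)')^m` is `F_lam`-admissible: `m ≥ m(lam)` and there is a partition of
the basis into `m(lam)` infinite families, in each of which the eigenvalues in `L_lam` are simple,
such that for `1 ≤ j ≤ m(lam)` the functional `B_j` belongs to `D(A_j)'`, where `A_j` is the part of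
`A` in the closed span of the `j`-th family, and `⟨B_j, e_n⟩ ≠ 0` for every `e_n` of the `j`-th
family in `L_lam`.  If `m(lam) = 0`, there is no condition on `B`. -/
structure FAdmissible (P : DiagonalParabolic A) (lam : ℝ) {m : ℕ} (B : Fin m → P.Scale (-1)) :
    Prop where
  le : P.maxMult lam ≤ m
  exists_partition : ∃ S : Fin (P.maxMult lam) → Set ℕ,
    (∀ j, (S j).Infinite) ∧
    (∀ i j, i ≠ j → Disjoint (S i) (S j)) ∧
    (0 < P.maxMult lam → ⋃ j, S j = univ) ∧
    (∀ j, InjOn P.eig (S j ∩ P.low lam)) ∧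
    (∀ j, ∀ n ∉ S j, P.coords (B (Fin.castLE le j)) n = 0) ∧
    (∀ j, ∀ n ∈ S j ∩ P.low lam, P.coords (B (Fin.castLE le j)) n ≠ 0)

/-- `B ∈ E^m` as a map `ℂ^m → E`, here with `E = D(A)'`. -/
def control (P : DiagonalParabolic A) {m : ℕ} (B : Fin m → P.Scale (-1))
    (z : EuclideanSpace ℂ (Fin m)) : P.Scale (-1) :=
  ∑ j, z j • B j

/-! ### F-equivalence -/

open Classical in
/-- The eigenvalues of the target operator: `λ_n - μ` at low frequencies, `λ_n` at high ones. -/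
def targetEig (P : DiagonalParabolic A) (lam mu : ℝ) (n : ℕ) : ℂ :=
  if n ∈ P.low lam then P.eig n - mu else P.eig n

theorem targetEig_bound (P : DiagonalParabolic A) (lam mu : ℝ) :
    ∃ c : ℝ, ∀ n, ‖P.targetEig lam mu n‖ ^ 2 ≤ c * (1 + ‖P.eig n‖ ^ 2) := by
  refine ⟨2 + 2 * mu ^ 2, fun n => ?_⟩
  have h3 : ‖P.targetEig lam mu n‖ ≤ ‖P.eig n‖ + |mu| := by
    unfold targetEig
    split_ifs
    · refine (norm_sub_le _ _).trans ?_
      simp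
    · have := abs_nonneg mu
      linarith
  have h4 : ‖P.targetEig lam mu n‖ ^ 2 ≤ (‖P.eig n‖ + |mu|) ^ 2 :=
    pow_le_pow_left₀ (norm_nonneg _) h3 2
  nlinarith [sq_nonneg (‖P.eig n‖ - |mu|), sq_abs mu, sq_nonneg (‖P.eig n‖ * mu)]

/-- The target operator `D = (A_L - μ) P_L + A_H P_H`, from `H` to `D(A)'`. -/
def target (P : DiagonalParabolic A) (lam mu : ℝ) : H →ₗ[ℂ] P.Scale (-1) :=
  P.diag (P.targetEig lam mu) (P.targetEig_bound lam mu)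

/-- The group `GL_H(D(A)')`: automorphisms of `D(A)'` which restrict to automorphisms of `H`. -/
structure GLH (P : DiagonalParabolic A) where
  /-- the automorphism of `D(A)'` -/
  onDual : P.Scale (-1) ≃L[ℂ] P.Scale (-1)
  /-- its restriction to `H` -/
  onH : H ≃L[ℂ] H
  onDual_embH : ∀ x : H, onDual (P.embH x) = P.embH (onH x)

/-- `(T, K)` is a parabolic F-equivalence between `(A, B)` and the target `D` with parameter `μ`:
`T (A + B K) = D T` in `L(H, D(A)')`, `T B = B` in `D(A)'`, and `K` vanishes on `H_lam`. -/
structure IsParabolicFEquivalence (P : DiagonalParabolic A) (lam mu : ℝ) {m : ℕ}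
    (B : Fin m → P.Scale (-1)) (T : P.GLH) (K : H →L[ℂ] EuclideanSpace ℂ (Fin m)) : Prop where
  intertwine : ∀ x : H, T.onDual (P.ext x + P.control B (K x)) = P.target lam mu (T.onH x)
  fix : ∀ j, T.onDual (B j) = B j
  vanish : ∀ n ∉ P.low lam, K (P.basis n) = 0

/-! ### The nonlinear system -/

/-- The assumption on the nonlinearity `F : D_γ(A) → D_{-1/2}(A)`. -/
def NonlinearityAssumption (P : DiagonalParabolic A) (γ : ℝ)
    (F : P.Scale γ → P.Scale (-(1 / 2))) : Prop :=
  ∃ (η K : ℝ) (Φ : ℝ → ℝ), 0 < η ∧ 0 < K ∧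
    MonotoneOn Φ (Ici 0) ∧ ContinuousWithinAt Φ (Ici 0) 0 ∧ Φ 0 = 0 ∧
    ∀ u v : P.Scale γ, P.seqNorm 0 (P.coords u) ≤ η → P.seqNorm 0 (P.coords v) ≤ η →
      ‖F u‖ ≤ Φ (P.seqNorm 0 (P.coords u)) * ‖u‖ ∧
      ‖F u - F v‖ ≤ K * (‖u‖ + ‖v‖) * P.seqNorm 0 (P.coords (u - v)) +
        K * Φ (P.seqNorm 0 (P.coords u) + P.seqNorm 0 (P.coords v)) * ‖u - v‖

/-- The right-hand side `(A + B K) x + F(x)` as an element of `D(A)'`, for `x ∈ D_γ(A)`. -/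
def rhs (P : DiagonalParabolic A) {m : ℕ} (B : Fin m → P.Scale (-1))
    (K : H →L[ℂ] EuclideanSpace ℂ (Fin m)) {γ : ℝ} (F : P.Scale γ → P.Scale (-(1 / 2)))
    (x : H) : P.Scale (-1) :=
  P.ext x + P.control B (K x) + P.incl (by norm_num) (F (P.toScale γ x))

/-- `u ∈ C_b([0,∞); H) ∩ L²((0,∞); D_γ(A))` solves `∂_t u = (A + B K) u + F(u)`, `u(0) = u₀`: the
right-hand side is locally integrable with values in `D(A)'` and `u` is its primitive in `D(A)'`. -/
structure IsSolution (P : DiagonalParabolic A) {m : ℕ} (B : Fin m → P.Scale (-1))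
    (K : H →L[ℂ] EuclideanSpace ℂ (Fin m)) {γ : ℝ} (F : P.Scale γ → P.Scale (-(1 / 2)))
    (u₀ : H) (u : ℝ → H) : Prop where
  continuousOn : ContinuousOn u (Ici 0)
  bounded : ∃ M : ℝ, ∀ t, 0 ≤ t → ‖u t‖ ≤ M
  ae_mem : ∀ᵐ t ∂volume.restrict (Ioi (0 : ℝ)), P.MemScale γ (u t)
  memLp : MemLp (fun t => P.toScale γ (u t)) 2 (volume.restrict (Ioi (0 : ℝ)))
  initial : u 0 = u₀
  integrable : ∀ t, 0 ≤ t → IntervalIntegrable (fun τ => P.rhs B K F (u τ)) volume 0 t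
  equation : ∀ t, 0 ≤ t → P.embH (u t) = P.embH u₀ + ∫ τ in (0 : ℝ)..t, P.rhs B K F (u τ)

end DiagonalParabolic

end

/-!
Both parts rest on the fact that an F-equivalence `T` can be analysed coordinate by coordinate.

*Existence.*  On each of the `m(lam)` families the low eigenvalues are simple, and the ansatz
`(T x)_p = t_p x_p + ∑_n κ_n x_n B_{j(n), p} / (τ_p - λ_n)`, with the sum over the low frequencies
and `τ` the spectrum of the target, has `T B_j = B_j` built in for the right choice of `t`.
The intertwining relation then says that `t_p` vanishes at the low frequencies.  So on each family
`t_p` is the value at `z = τ_p` of the rational function `∏ (z - λ_n + μ) / (z - λ_n)`, and the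
`κ_n` come from its partial fractions (`exists_partial_fraction`).  `T` is invertible because Cauchy
matrices are (`eq_zero_of_cauchy`, `exists_equiv_diagAddColumns`).  All this works as soon as `μ` is
not a difference of two eigenvalues, which excludes countably many `μ`.

*Regularity.*  Let `(T, K)` be any F-equivalence.  As `K` vanishes on `H_lam`, the block of `T` from
the high frequencies to the high frequencies only couples equal eigenvalues, hence commutes with the
powers of `1 + |A|²`; the finitely many low columns solve `(A - λ_n) T e_n = B K e_n` at high
frequencies and so lie in `D_{1-s}(A)`.  Therefore `T` and `T⁻¹` preserve `D_γ(A)`, and `T`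
preserves `D_{-1/2}(A)` (`IsParabolicFEquivalence.memScale_onH`,
`IsParabolicFEquivalence.exists_clm_onDual`).

*Nonlinear stability.*  `v = T u` turns the closed-loop system into `v' = D v + G(v)` with `D`
diagonal, and `G = T F(T⁻¹ ·)` obeying the same kind of estimates as `F`.  Since `μ > lam + c_A`,
the spectrum `τ_n` of `D` satisfies `Re τ_n ≤ -lam - c (1 + |λ_n|²)^{1/2}`
(`exists_targetEig_re_le`), and summing scalar energy inequalities over `n`
(`IsLinearSolution.energy_le`) gives, in the weight `exp (2 lam t)`, control of `v` in
`L²(D_{1/2}(A))` by `G(v)` in `L²(D_{-1/2}(A))`.  For small `v` the latter is absorbed, which yields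
the decay of `v` with the constant `1` (`SolvesWith.norm_le_exp`); a continuation argument removes
the a priori smallness.  Applied to differences of solutions the same inequality and a Gronwall
argument give uniqueness (`SolvesWith.eqOn_of_small`), and existence follows from a contraction for
`g = G(v)` in `L²((0,∞); D_{-1/2}(A))` (`exists_solvesWith`).
-/

open scoped ENNReal NNReal

noncomputable section

/-! ### Partial fractions and Cauchy systems -/

/-- The rational function `∏ (z - v n + μ) / (z - v n)` has the value `1` at infinity and simple
poles; the coefficients of its partial fraction decomposition do not vanish if its zeros are not
among its poles. -/
theorem exists_partial_fraction (I : Finset ℕ) (v : ℕ → ℂ) (hv : Set.InjOn v I) (μ : ℂ) :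
    ∃ k : ℕ → ℂ, (∀ z : ℂ, (∀ n ∈ I, z ≠ v n) →
      1 - ∑ n ∈ I, k n / (z - v n) = ∏ n ∈ I, (z - v n + μ) / (z - v n)) ∧
      ∀ n ∈ I, (∀ i ∈ I, v n - v i + μ ≠ 0) → k n ≠ 0 := by
  classical
  set f : Polynomial ℂ := Lagrange.nodal I (fun i => v i - μ) - Lagrange.nodal I v with hf
  have hdeg : f.degree < I.card := by
    rcases I.eq_empty_or_nonempty with rfl | hI
    · simp [hf]
    · have h := Polynomial.degree_sub_lt_left (p := Lagrange.nodal I (fun i => v i - μ))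
        (q := Lagrange.nodal I v) (by rw [Lagrange.degree_nodal, Lagrange.degree_nodal])
        Lagrange.nodal_ne_zero
        (by rw [Lagrange.nodal_monic.leadingCoeff, Lagrange.nodal_monic.leadingCoeff])
      rwa [Lagrange.degree_nodal] at h
  have heval : ∀ n ∈ I, f.eval (v n) = ∏ i ∈ I, (v n - v i + μ) := by
    intro n hn
    simp only [hf, Polynomial.eval_sub, Lagrange.eval_nodal_at_node hn, Lagrange.eval_nodal,
      sub_zero]
    exact Finset.prod_congr rfl fun i _ => by ring
  refine ⟨fun n => -(Lagrange.nodalWeight I v n * f.eval (v n)), fun z hz => ?_, ?_⟩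
  · have h1 : f.eval z = (Lagrange.nodal I v).eval z *
        ∑ i ∈ I, Lagrange.nodalWeight I v i * (z - v i)⁻¹ * f.eval (v i) := by
      conv_lhs => rw [Lagrange.eq_interpolate hv hdeg]
      rw [Lagrange.eval_interpolate_not_at_node _ hz]
    have h2 : (Lagrange.nodal I v).eval z ≠ 0 := by
      rw [Lagrange.eval_nodal]
      exact Finset.prod_ne_zero_iff.2 fun n hn => sub_ne_zero.2 (hz n hn)
    have h3 : 1 - ∑ n ∈ I, -(Lagrange.nodalWeight I v n * f.eval (v n)) / (z - v n) =
        1 + ∑ i ∈ I, Lagrange.nodalWeight I v i * (z - v i)⁻¹ * f.eval (v i) := by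
      rw [sub_eq_add_neg, ← Finset.sum_neg_distrib]
      congr 1
      exact Finset.sum_congr rfl fun i _ => by ring
    rw [h3, Finset.prod_div_distrib, ← Lagrange.eval_nodal, eq_div_iff h2, add_mul, one_mul,
      mul_comm (∑ i ∈ I, _), ← h1, hf, Polynomial.eval_sub, add_sub_cancel, Lagrange.eval_nodal]
    exact Finset.prod_congr rfl fun i _ => by ring
  · intro n hn hne
    refine neg_ne_zero.2 (mul_ne_zero (Lagrange.nodalWeight_ne_zero hv hn) ?_)
    rw [heval n hn]
    exact Finset.prod_ne_zero_iff.2 hne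

/-- The Cauchy matrix `(1 / (x i - v n))` is injective. -/
theorem eq_zero_of_cauchy (I : Finset ℕ) (v x c : ℕ → ℂ) (hv : Set.InjOn v I)
    (hx : Set.InjOn x I) (hxv : ∀ i ∈ I, ∀ n ∈ I, x i ≠ v n)
    (h : ∀ i ∈ I, ∑ n ∈ I, c n / (x i - v n) = 0) : ∀ n ∈ I, c n = 0 := by
  classical
  set r : ℕ → ℂ := fun n => c n / Lagrange.nodalWeight I v n with hr
  have h0 : Lagrange.interpolate I v r = 0 := by
    refine Polynomial.eq_zero_of_degree_lt_of_eval_index_eq_zero (s := I) (v := x) hx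
      (Lagrange.degree_interpolate_lt _ hv) fun i hi => ?_
    rw [Lagrange.eval_interpolate_not_at_node _ (hxv i hi), ← mul_zero, ← h i hi]
    congr 1
    refine Finset.sum_congr rfl fun n hn => ?_
    have := Lagrange.nodalWeight_ne_zero hv hn
    simp only [hr]
    field_simp
  intro n hn
  have h1 := Lagrange.eval_interpolate_at_node r hv hn
  rw [h0, Polynomial.eval_zero] at h1
  have := Lagrange.nodalWeight_ne_zero hv hn
  simpa [hr, this] using h1.symm

/-! ### Scalar equations: the energy inequality and Duhamel's formula -/

theorem AbsolutelyContinuousOnInterval.congr_on {f g : ℝ → ℝ} {a b : ℝ}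
    (hf : AbsolutelyContinuousOnInterval f a b) (h : ∀ x ∈ uIcc a b, f x = g x) :
    AbsolutelyContinuousOnInterval g a b := by
  refine Tendsto.congr' ?_ hf
  filter_upwards [mem_inf_of_right (mem_principal_self _)] with E hE
  refine Finset.sum_congr rfl fun i hi => ?_
  have h1 := hE.1 i hi
  rw [h _ h1.1, h _ h1.2]

theorem absolutelyContinuousOnInterval_const_add_integral {f : ℝ → ℝ} {a b : ℝ}
    (hf : IntervalIntegrable f volume a b) (c : ℝ) :
    AbsolutelyContinuousOnInterval (fun x => c + ∫ v in a..x, f v) a b := by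
  have h1 : AbsolutelyContinuousOnInterval (fun _ : ℝ => c) a b :=
    contDiff_const.contDiffOn.absolutelyContinuousOnInterval
  exact h1.add (hf.absolutelyContinuousOnInterval_intervalIntegral (by simp))

theorem absolutelyContinuousOnInterval_re_add_integral {f : ℝ → ℂ} {a b : ℝ}
    (hf : IntervalIntegrable f volume a b) (c : ℂ) :
    AbsolutelyContinuousOnInterval (fun x => (c + ∫ v in a..x, f v).re) a b := by
  have h1 : IntervalIntegrable (fun s => (f s).re) volume a b := ⟨hf.1.re, hf.2.re⟩
  refine (absolutelyContinuousOnInterval_const_add_integral h1 c.re).congr_on fun s hs => ?_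
  have h2 := Complex.reCLM.intervalIntegral_comp_comm
    (hf.mono_set (uIcc_subset_uIcc left_mem_uIcc hs))
  simp only [Complex.reCLM_apply] at h2
  simp [h2]

theorem absolutelyContinuousOnInterval_im_add_integral {f : ℝ → ℂ} {a b : ℝ}
    (hf : IntervalIntegrable f volume a b) (c : ℂ) :
    AbsolutelyContinuousOnInterval (fun x => (c + ∫ v in a..x, f v).im) a b := by
  have h1 : IntervalIntegrable (fun s => (f s).im) volume a b := ⟨hf.1.im, hf.2.im⟩
  refine (absolutelyContinuousOnInterval_const_add_integral h1 c.im).congr_on fun s hs => ?_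
  have h2 := Complex.imCLM.intervalIntegral_comp_comm
    (hf.mono_set (uIcc_subset_uIcc left_mem_uIcc hs))
  simp only [Complex.imCLM_apply] at h2
  simp [h2]

/-- The energy inequality for `y' = τ y + g` when `g` is square integrable; it comes from
`2 Re ⟨y, g⟩ ≤ b |y|² + b⁻¹ |g|²`. -/
theorem integral_le_of_energy {lam b : ℝ} {τ : ℂ} (hb : 0 < b) (hτ : τ.re ≤ -lam - b) {t : ℝ}
    (ht : 0 ≤ t) {y g : ℝ → ℂ} (hyc : ContinuousOn y (Icc 0 t))
    (hg : IntervalIntegrable g volume 0 t)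
    (hg2 : IntervalIntegrable (fun s => Real.exp (2 * lam * s) * ‖g s‖ ^ 2) volume 0 t)
    (hy : ∀ s ∈ Icc 0 t, y s = y 0 + ∫ r in (0 : ℝ)..s, (τ * y r + g r)) :
    Real.exp (2 * lam * t) * ‖y t‖ ^ 2 + b * ∫ s in (0 : ℝ)..t, Real.exp (2 * lam * s) * ‖y s‖ ^ 2
      ≤ ‖y 0‖ ^ 2 + b⁻¹ * ∫ s in (0 : ℝ)..t, Real.exp (2 * lam * s) * ‖g s‖ ^ 2 := by
  have hIcc : uIcc 0 t = Icc 0 t := uIcc_of_le ht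
  set f : ℝ → ℂ := fun r => τ * y r + g r with hf
  have hyc' : ContinuousOn y (uIcc 0 t) := hIcc ▸ hyc
  have hfi : IntervalIntegrable f volume 0 t :=
    ((continuousOn_const.mul hyc').intervalIntegrable).add hg
  set Y : ℝ → ℂ := fun s => y 0 + ∫ r in (0 : ℝ)..s, f r with hY
  have hYy : ∀ s ∈ Icc 0 t, Y s = y s := fun s hs => (hy s hs).symm
  have hre := absolutelyContinuousOnInterval_re_add_integral hfi (y 0)
  have him := absolutelyContinuousOnInterval_im_add_integral hfi (y 0)
  set φ : ℝ → ℝ := fun s => Real.exp (2 * lam * s) * ‖Y s‖ ^ 2 with hφ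
  have hφac : AbsolutelyContinuousOnInterval φ 0 t := by
    have h1 : AbsolutelyContinuousOnInterval (fun s => Real.exp (2 * lam * s)) 0 t :=
      ContDiffOn.absolutelyContinuousOnInterval
        (Real.contDiff_exp.comp (contDiff_const.mul contDiff_id)).contDiffOn
    have h2 := h1.mul ((hre.mul hre).add (him.mul him))
    refine h2.congr_on fun s _ => ?_
    simp only [hφ, Pi.mul_apply, Pi.add_apply]
    rw [← Complex.normSq_eq_norm_sq, Complex.normSq_apply]
  have hderiv : ∀ᵐ s, s ∈ uIcc 0 t → HasDerivAt φ (Real.exp (2 * lam * s) *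
      (2 * lam * ‖Y s‖ ^ 2 + 2 * (inner ℝ (Y s) (f s)))) s := by
    filter_upwards [hfi.ae_hasDerivAt_integral] with s hs hs'
    have h1 : HasDerivAt Y (f s) s := (hs hs' 0 (by simp)).const_add _
    have h2 : HasDerivAt (fun s => Real.exp (2 * lam * s))
        (Real.exp (2 * lam * s) * (2 * lam)) s := by
      simpa using ((hasDerivAt_id s).const_mul (2 * lam)).exp
    have h3 := h2.mul h1.norm_sq
    refine h3.congr_deriv ?_
    ring
  have hbound : ∀ᵐ s, s ∈ Icc 0 t → deriv φ s ≤
      b⁻¹ * (Real.exp (2 * lam * s) * ‖g s‖ ^ 2) - b * (Real.exp (2 * lam * s) * ‖y s‖ ^ 2) := by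
    filter_upwards [hderiv] with s hs hs'
    rw [(hs (hIcc ▸ hs')).deriv, hYy s hs']
    have h1 : inner ℝ (y s) (f s) = τ.re * ‖y s‖ ^ 2 + inner ℝ (y s) (g s) := by
      simp only [hf, Complex.inner, ← Complex.normSq_eq_norm_sq, Complex.normSq_apply]
      simp
      ring
    have h2 := real_inner_le_norm (y s) (g s)
    have h3 : 2 * (‖y s‖ * ‖g s‖) ≤ b * ‖y s‖ ^ 2 + b⁻¹ * ‖g s‖ ^ 2 := by
      have h4 : 0 ≤ b * (‖y s‖ - b⁻¹ * ‖g s‖) ^ 2 := by positivity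
      have h5 : b * (‖y s‖ - b⁻¹ * ‖g s‖) ^ 2 =
          b * ‖y s‖ ^ 2 + b⁻¹ * ‖g s‖ ^ 2 - 2 * (‖y s‖ * ‖g s‖) := by
        field_simp
        ring
      linarith
    have h6 : τ.re * ‖y s‖ ^ 2 ≤ (-lam - b) * ‖y s‖ ^ 2 := by gcongr
    have h7 : 2 * lam * ‖y s‖ ^ 2 + 2 * inner ℝ (y s) (f s) ≤
        b⁻¹ * ‖g s‖ ^ 2 - b * ‖y s‖ ^ 2 := by
      rw [h1]; linarith
    calc _ ≤ Real.exp (2 * lam * s) * (b⁻¹ * ‖g s‖ ^ 2 - b * ‖y s‖ ^ 2) := by gcongr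
      _ = _ := by ring
  have hy2 : IntervalIntegrable (fun s => Real.exp (2 * lam * s) * ‖y s‖ ^ 2) volume 0 t := by
    apply ContinuousOn.intervalIntegrable
    exact (by fun_prop : Continuous fun s => Real.exp (2 * lam * s)).continuousOn.mul
      (hyc'.norm.pow 2)
  have hmono : ∫ s in (0 : ℝ)..t, deriv φ s ≤ ∫ s in (0 : ℝ)..t,
      (b⁻¹ * (Real.exp (2 * lam * s) * ‖g s‖ ^ 2) -
        b * (Real.exp (2 * lam * s) * ‖y s‖ ^ 2)) := by
    refine intervalIntegral.integral_mono_ae_restrict ht hφac.intervalIntegrable_deriv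
      ((hg2.const_mul _).sub (hy2.const_mul _)) ?_
    exact (ae_restrict_iff' measurableSet_Icc).2 hbound
  rw [hφac.integral_deriv_eq_sub, intervalIntegral.integral_sub (hg2.const_mul _)
    (hy2.const_mul _), intervalIntegral.integral_const_mul,
    intervalIntegral.integral_const_mul] at hmono
  simp only [hφ, hYy t ⟨ht, le_rfl⟩, hYy 0 ⟨le_rfl, ht⟩] at hmono
  simp only [mul_zero, Real.exp_zero, one_mul] at hmono
  linarith

/-- The energy inequality for `y' = τ y + g` in the weight `exp (2 lam s)`, where
`b = -Re τ - lam`; both sides may be infinite. -/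
theorem scalar_energy {lam b : ℝ} {τ : ℂ} (hb : 0 < b) (hτ : τ.re ≤ -lam - b) {t : ℝ}
    (ht : 0 ≤ t) {y g : ℝ → ℂ} (hyc : ContinuousOn y (Icc 0 t))
    (hg : IntervalIntegrable g volume 0 t)
    (hy : ∀ s ∈ Icc 0 t, y s = y 0 + ∫ r in (0 : ℝ)..s, (τ * y r + g r)) :
    ENNReal.ofReal (Real.exp (2 * lam * t)) * ‖y t‖ₑ ^ 2 +
      ENNReal.ofReal b *
        ∫⁻ s in Ioc 0 t, ENNReal.ofReal (Real.exp (2 * lam * s)) * ‖y s‖ₑ ^ 2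
      ≤ ‖y 0‖ₑ ^ 2 + ENNReal.ofReal b⁻¹ *
        ∫⁻ s in Ioc 0 t, ENNReal.ofReal (Real.exp (2 * lam * s)) * ‖g s‖ₑ ^ 2 := by
  have hconv : ∀ (h : ℝ → ℂ) (s : ℝ), ENNReal.ofReal (Real.exp (2 * lam * s)) * ‖h s‖ₑ ^ 2 =
      ENNReal.ofReal (Real.exp (2 * lam * s) * ‖h s‖ ^ 2) := fun h s => by
    rw [ENNReal.ofReal_mul (Real.exp_pos _).le, ENNReal.ofReal_pow (norm_nonneg _),
      ofReal_norm]
  by_cases hfin : ∫⁻ s in Ioc 0 t, ENNReal.ofReal (Real.exp (2 * lam * s)) * ‖g s‖ₑ ^ 2 = ∞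
  · rw [hfin, ENNReal.mul_top (by simpa using hb), add_top]
    exact le_top
  have hgm : AEStronglyMeasurable g (volume.restrict (Ioc 0 t)) :=
    ((intervalIntegrable_iff_integrableOn_Ioc_of_le ht).1 hg).aestronglyMeasurable
  have hg2 : IntegrableOn (fun s => Real.exp (2 * lam * s) * ‖g s‖ ^ 2) (Ioc 0 t) := by
    refine ⟨(by fun_prop : Continuous fun s => Real.exp (2 * lam * s)).aestronglyMeasurable.mul
      (hgm.norm.pow 2), ?_⟩
    rw [hasFiniteIntegral_iff_ofReal (.of_forall fun s => by positivity)]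
    simp only [← hconv]
    exact lt_top_iff_ne_top.2 hfin
  have hy2 : IntegrableOn (fun s => Real.exp (2 * lam * s) * ‖y s‖ ^ 2) (Ioc 0 t) := by
    refine (ContinuousOn.integrableOn_Icc ?_).mono_set Ioc_subset_Icc_self
    exact (by fun_prop : Continuous fun s => Real.exp (2 * lam * s)).continuousOn.mul
      (hyc.norm.pow 2)
  have key := integral_le_of_energy hb hτ ht hyc hg
    ((intervalIntegrable_iff_integrableOn_Ioc_of_le ht).2 hg2) hy
  rw [intervalIntegral.integral_of_le ht, intervalIntegral.integral_of_le ht] at key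
  simp only [hconv]
  rw [← ofReal_integral_eq_lintegral_ofReal hg2 (.of_forall fun s => by positivity),
    ← ofReal_integral_eq_lintegral_ofReal hy2 (.of_forall fun s => by positivity),
    ← ENNReal.ofReal_mul hb.le, ← ENNReal.ofReal_mul (inv_nonneg.2 hb.le),
    ← ofReal_norm, ← ENNReal.ofReal_pow (norm_nonneg _),
    ← ENNReal.ofReal_add (by positivity) (by positivity),
    ← ENNReal.ofReal_add (by positivity) (by positivity)]
  exact ENNReal.ofReal_le_ofReal key

/-- Duhamel's formula for a scalar equation with an integrable right-hand side. -/
theorem duhamel_eq (τ q : ℂ) {g : ℝ → ℂ} {t : ℝ} (hg : IntervalIntegrable g volume 0 t)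
    {y : ℝ → ℂ}
    (hy : ∀ s, y s = Complex.exp (τ * s) * (q + ∫ r in (0 : ℝ)..s, Complex.exp (-τ * r) * g r)) :
    ContinuousOn y (uIcc 0 t) ∧ y t = q + ∫ s in (0 : ℝ)..t, (τ * y s + g s) := by
  set f : ℝ → ℂ := fun r => Complex.exp (-τ * r) * g r with hf
  have hE : ∀ σ : ℂ, Continuous fun s : ℝ => Complex.exp (σ * s) := fun σ => by fun_prop
  have hfi : IntervalIntegrable f volume 0 t := hg.continuousOn_mul (hE _).continuousOn
  set Q : ℝ → ℂ := fun s => q + ∫ r in (0 : ℝ)..s, f r with hQ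
  have hyQ : y = fun s : ℝ => Complex.exp (τ * s) * Q s := funext hy
  have hQc : ContinuousOn Q (uIcc 0 t) :=
    continuousOn_const.add (intervalIntegral.continuousOn_primitive_interval' hfi left_mem_uIcc)
  have hyc : ContinuousOn y (uIcc 0 t) := hyQ ▸ (hE τ).continuousOn.mul hQc
  refine ⟨hyc, ?_⟩
  have hF : IntervalIntegrable (fun s => τ * y s + g s) volume 0 t :=
    (continuousOn_const.mul hyc).intervalIntegrable.add hg
  have hderiv : ∀ᵐ s, s ∈ uIcc 0 t → HasDerivAt y (τ * y s + g s) s := by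
    filter_upwards [hfi.ae_hasDerivAt_integral] with s hs hs'
    have h1 : HasDerivAt Q (f s) s := (hs hs' 0 (by simp)).const_add _
    have h2 : HasDerivAt (fun s : ℝ => Complex.exp (τ * s)) (Complex.exp (τ * s) * τ) s := by
      have h3 : HasDerivAt (fun s : ℝ => τ * (s : ℂ)) τ s := by
        simpa using (Complex.ofRealCLM.hasDerivAt (x := s)).const_mul τ
      exact h3.cexp
    rw [hyQ]
    refine (h2.mul h1).congr_deriv ?_
    have h4 : Complex.exp (τ * s) * Complex.exp (-τ * s) = 1 := by
      rw [← Complex.exp_add]; simp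
    simp only [hf]
    linear_combination (g s) * h4
  have hre := absolutelyContinuousOnInterval_re_add_integral hfi q
  have him := absolutelyContinuousOnInterval_im_add_integral hfi q
  have hC : ContDiff ℝ 1 fun s : ℝ => Complex.exp (τ * s) :=
    (contDiff_const.mul Complex.ofRealCLM.contDiff).cexp
  have hEre : AbsolutelyContinuousOnInterval (fun s : ℝ => (Complex.exp (τ * s)).re) 0 t :=
    (Complex.reCLM.contDiff.comp hC).contDiffOn.absolutelyContinuousOnInterval
  have hEim : AbsolutelyContinuousOnInterval (fun s : ℝ => (Complex.exp (τ * s)).im) 0 t :=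
    (Complex.imCLM.contDiff.comp hC).contDiffOn.absolutelyContinuousOnInterval
  have hyre : AbsolutelyContinuousOnInterval (fun s => (y s).re) 0 t :=
    ((hEre.mul hre).sub (hEim.mul him)).congr_on fun s _ => by
      rw [hyQ]
      simp [hQ, Complex.mul_re]
  have hyim : AbsolutelyContinuousOnInterval (fun s => (y s).im) 0 t :=
    ((hEre.mul him).add (hEim.mul hre)).congr_on fun s _ => by
      rw [hyQ]
      simp [hQ, Complex.mul_im]
  have hy0 : y 0 = q := by simp [hy 0]
  have h1 : (∫ s in (0 : ℝ)..t, (τ * y s + g s)).re = (y t).re - (y 0).re := by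
    rw [← hyre.integral_deriv_eq_sub]
    have h2 := Complex.reCLM.intervalIntegral_comp_comm hF
    rw [Complex.reCLM_apply] at h2
    rw [← h2]
    refine intervalIntegral.integral_congr_ae ?_
    filter_upwards [hderiv] with s hs hs'
    exact ((Complex.reCLM.hasFDerivAt.comp_hasDerivAt s (hs (uIoc_subset_uIcc hs'))).deriv).symm
  have h2 : (∫ s in (0 : ℝ)..t, (τ * y s + g s)).im = (y t).im - (y 0).im := by
    rw [← hyim.integral_deriv_eq_sub]
    have h2 := Complex.imCLM.intervalIntegral_comp_comm hF
    rw [Complex.imCLM_apply] at h2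
    rw [← h2]
    refine intervalIntegral.integral_congr_ae ?_
    filter_upwards [hderiv] with s hs hs'
    exact ((Complex.imCLM.hasFDerivAt.comp_hasDerivAt s (hs (uIoc_subset_uIcc hs'))).deriv).symm
  apply Complex.ext
  · rw [Complex.add_re, h1, hy0]; ring
  · rw [Complex.add_im, h2, hy0]; ring

/-! ### Gronwall, continuation and measure-theoretic preliminaries -/

/-- Gronwall's lemma with an integrable kernel and zero data. -/
theorem eq_zero_of_le_lintegral {φ h : ℝ → ℝ≥0∞} {T : ℝ} {C : ℝ≥0∞} (hC : C ≠ ∞)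
    (hφ : ∀ t ∈ Icc 0 T, φ t ≤ C) (hh : ∫⁻ s in Ioc 0 T, h s ≠ ∞)
    (hle : ∀ t ∈ Icc 0 T, φ t ≤ ∫⁻ s in Ioc 0 t, h s * φ s) : ∀ t ∈ Icc 0 T, φ t = 0 := by
  set Ψ : ℝ → ℝ≥0∞ := fun t => ∫⁻ s in Ioc 0 t, h s * φ s with hΨ
  have hmono : ∀ a b, a ≤ b → Ψ a ≤ Ψ b := fun a b hab =>
    lintegral_mono_set (Ioc_subset_Ioc_right hab)
  intro t ht
  suffices hT : Ψ T = 0 from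
    le_antisymm ((hle t ht).trans ((hmono _ _ ht.2).trans hT.le)) bot_le
  have h0T : 0 ≤ T := ht.1.trans ht.2
  set S : Set ℝ := {t | t ∈ Icc 0 T ∧ Ψ t = 0} with hS
  have h0S : (0 : ℝ) ∈ S := ⟨⟨le_rfl, h0T⟩, by simp [hΨ]⟩
  have hbdd : BddAbove S := ⟨T, fun t ht => ht.1.2⟩
  set t₀ := sSup S with ht₀
  have h0t₀ : 0 ≤ t₀ := le_csSup hbdd h0S
  have ht₀T : t₀ ≤ T := csSup_le ⟨0, h0S⟩ fun t ht => ht.1.2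
  have hzero : ∀ r ∈ Ico 0 t₀, φ r = 0 := by
    intro r hr
    obtain ⟨t, ht, hrt⟩ := exists_lt_of_lt_csSup ⟨0, h0S⟩ hr.2
    refine le_antisymm ((hle r ⟨hr.1, hr.2.le.trans ht₀T⟩).trans ?_) bot_le
    exact (hmono _ _ hrt.le).trans ht.2.le
  have hΨ₀ : Ψ t₀ = 0 := by
    rw [hΨ]
    simp only
    rw [setLIntegral_congr Ioo_ae_eq_Ioc.symm]
    refine (setLIntegral_congr_fun measurableSet_Ioo fun r hr => ?_).trans lintegral_zero
    simp [hzero r ⟨hr.1.le, hr.2⟩]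
  rcases ht₀T.eq_or_lt with h | hlt
  · rwa [← h]
  exfalso
  obtain ⟨δ, hδ, hsmall⟩ := exists_pos_setLIntegral_lt_of_measure_lt hh
    (ε := 1 / 2) (by simp)
  obtain ⟨t₁, ht₁, ht₁T, hvol⟩ : ∃ t₁, t₀ < t₁ ∧ t₁ ≤ T ∧ ENNReal.ofReal (t₁ - t₀) < δ := by
    have h1 : Tendsto (fun t => ENNReal.ofReal (t - t₀)) (𝓝[>] t₀) (𝓝 0) := by
      have : Continuous fun t : ℝ => ENNReal.ofReal (t - t₀) :=
        ENNReal.continuous_ofReal.comp (continuous_id.sub continuous_const)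
      simpa using (this.tendsto t₀).mono_left nhdsWithin_le_nhds
    obtain ⟨t, h2, h3⟩ := ((h1.eventually (gt_mem_nhds hδ)).and
      (Ioc_mem_nhdsGT hlt)).exists
    exact ⟨t, h3.1, h3.2, h2⟩
  have hker : ∫⁻ s in Ioc t₀ t₁, h s ≤ 1 / 2 := by
    have h1 := hsmall (Ioc t₀ t₁) (by
      refine (Measure.restrict_apply_le _ _).trans_lt ?_
      simpa using hvol)
    rw [Measure.restrict_restrict measurableSet_Ioc,
      inter_eq_left.2 (Ioc_subset_Ioc h0t₀ ht₁T)] at h1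
    exact h1.le
  set M : ℝ≥0∞ := ⨆ s ∈ Icc t₀ t₁, φ s with hM
  have hMC : M ≤ C := iSup₂_le fun s hs => hφ s ⟨h0t₀.trans hs.1, hs.2.trans ht₁T⟩
  have hΨ₁ : Ψ t₁ ≤ 1 / 2 * M := by
    have hsplit : Ψ t₁ = Ψ t₀ + ∫⁻ s in Ioc t₀ t₁, h s * φ s := by
      rw [hΨ]
      simp only
      rw [← Ioc_union_Ioc_eq_Ioc h0t₀ ht₁.le, lintegral_union measurableSet_Ioc]
      exact Set.disjoint_left.2 fun x hx hx' => absurd hx.2 (not_le.2 hx'.1)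
    rw [hsplit, hΨ₀, zero_add]
    calc ∫⁻ s in Ioc t₀ t₁, h s * φ s ≤ ∫⁻ s in Ioc t₀ t₁, h s * M := by
          refine setLIntegral_mono' measurableSet_Ioc fun s hs => ?_
          gcongr
          exact le_iSup₂ (f := fun s _ => φ s) s (Ioc_subset_Icc_self hs)
      _ = (∫⁻ s in Ioc t₀ t₁, h s) * M := lintegral_mul_const' _ _ (ne_top_of_le_ne_top hC hMC)
      _ ≤ _ := by gcongr
  have hM' : M ≤ 1 / 2 * M := iSup₂_le fun s hs =>
    (hle s ⟨h0t₀.trans hs.1, hs.2.trans ht₁T⟩).trans ((hmono _ _ hs.2).trans hΨ₁)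
  have hM0 : M = 0 := by
    by_contra hne
    have h1 : 1 / 2 * M < M := by
      have h2 := ENNReal.half_lt_self hne (ne_top_of_le_ne_top hC hMC)
      rwa [ENNReal.div_eq_inv_mul, ← one_div] at h2
    exact absurd hM' (not_le.2 h1)
  have ht₁S : t₁ ∈ S := ⟨⟨h0t₀.trans ht₁.le, ht₁T⟩, by
    rw [hM0, mul_zero] at hΨ₁
    exact le_antisymm hΨ₁ bot_le⟩
  exact absurd (le_csSup hbdd ht₁S) (not_le.2 ht₁)

/-- A continuous function that cannot enter the gap between `δ` and `ρ` stays below `δ`. -/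
theorem le_of_continuation {f : ℝ → ℝ} {δ ρ : ℝ} (hf : ContinuousOn f (Ici 0)) (hδρ : δ < ρ)
    (h0 : f 0 ≤ δ) (hstep : ∀ t, 0 ≤ t → (∀ s ∈ Icc 0 t, f s ≤ ρ) → f t ≤ δ) :
    ∀ t, 0 ≤ t → f t ≤ δ := by
  suffices h : ∀ t, 0 ≤ t → f t ≤ ρ from fun t ht => hstep t ht fun s hs => h s hs.1
  by_contra! hne
  obtain ⟨t₁, ht₁, hft₁⟩ := hne
  set S : Set ℝ := Icc 0 t₁ ∩ f ⁻¹' (Ici ρ) with hS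
  have hSc : IsClosed S :=
    (hf.mono Icc_subset_Ici_self).preimage_isClosed_of_isClosed isClosed_Icc isClosed_Ici
  have hSb : BddBelow S := ⟨0, fun t ht => ht.1.1⟩
  have hmem : sInf S ∈ S := hSc.csInf_mem ⟨t₁, ⟨ht₁, le_rfl⟩, hft₁.le⟩ hSb
  set t₀ := sInf S with ht₀
  have hlt : ∀ s ∈ Ico 0 t₀, f s < ρ := by
    intro s hs
    by_contra! h
    exact absurd (csInf_le hSb ⟨⟨hs.1, hs.2.le.trans hmem.1.2⟩, h⟩) (not_le.2 hs.2)
  have hpos : 0 < t₀ := by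
    rcases hmem.1.1.eq_or_lt with h | h
    · have h1 : ρ ≤ f t₀ := hmem.2
      rw [← h] at h1
      linarith
    · exact h
  have hle : f t₀ ≤ δ := by
    have h1 : Tendsto f (𝓝[<] t₀) (𝓝 (f t₀)) :=
      ((hf t₀ hpos.le).continuousAt (Ici_mem_nhds hpos)).tendsto.mono_left nhdsWithin_le_nhds
    refine le_of_tendsto h1 ?_
    filter_upwards [Ico_mem_nhdsLT hpos] with s hs
    exact hstep s hs.1 fun r hr => (hlt r ⟨hr.1, hr.2.trans_lt hs.2⟩).le
  have h2 : ρ ≤ f t₀ := hmem.2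
  linarith

theorem continuousOn_Ici_of_Icc {E : Type*} [TopologicalSpace E] {f : ℝ → E}
    (h : ∀ t, 0 ≤ t → ContinuousOn f (Icc 0 t)) : ContinuousOn f (Ici 0) := by
  intro t ht
  have ht' : (0 : ℝ) ≤ t := ht
  refine (h (t + 1) (by linarith) t ⟨ht', by linarith⟩).mono_of_mem_nhdsWithin ?_
  rw [← Ici_inter_Iic]
  exact inter_mem self_mem_nhdsWithin (mem_nhdsWithin_of_mem_nhds (Iic_mem_nhds (by linarith)))

theorem sq_eLpNorm_two {α E : Type*} [MeasurableSpace α] [NormedAddCommGroup E] (μ : Measure α)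
    (f : α → E) : eLpNorm f 2 μ ^ 2 = ∫⁻ x, ‖f x‖ₑ ^ 2 ∂μ := by
  have h := eLpNorm_nnreal_pow_eq_lintegral (μ := μ) (f := f) (p := 2) (by norm_num)
  simpa using h

namespace DiagonalParabolic

variable {H : Type*} [NormedAddCommGroup H] [InnerProductSpace ℂ H] {A : H →ₗ.[ℂ] H}

/-! ### Coordinates and the closed graph theorem on the scale -/

theorem weight_add (P : DiagonalParabolic A) (r r' : ℝ) (n : ℕ) :
    P.weight (r + r') n = P.weight r n * P.weight r' n :=
  Real.rpow_add (by positivity) _ _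

theorem weight_one (P : DiagonalParabolic A) (n : ℕ) : P.weight 1 n = 1 + ‖P.eig n‖ ^ 2 := by
  simp [weight]

theorem norm_sq_eq_tsum (P : DiagonalParabolic A) {r : ℝ} (x : P.Scale r) :
    ‖x‖ ^ 2 = ∑' n, P.weight r n * ‖P.coords x n‖ ^ 2 := by
  rw [P.norm_eq_seqNorm, seqNorm, Real.sq_sqrt]
  exact tsum_nonneg fun n => mul_nonneg (P.weight_pos r n).le (by positivity)

theorem weight_mul_norm_sq_le (P : DiagonalParabolic A) {r : ℝ} (x : P.Scale r) (n : ℕ) :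
    P.weight r n * ‖P.coords x n‖ ^ 2 ≤ ‖x‖ ^ 2 := by
  rw [norm_sq_eq_tsum]
  exact (P.summable_coords x).le_tsum n
    fun m _ => mul_nonneg (P.weight_pos r m).le (by positivity)

/-- The `n`-th coordinate as a continuous linear functional on `D_r(A)`. -/
def coordCLM (P : DiagonalParabolic A) (r : ℝ) (n : ℕ) : P.Scale r →L[ℂ] ℂ :=
  LinearMap.mkContinuous ((LinearMap.proj n).comp P.coords) (Real.sqrt (P.weight r n))⁻¹
    (fun x => by
      have hw := P.weight_pos r n
      rw [inv_mul_eq_div, le_div_iff₀ (Real.sqrt_pos.2 hw)]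
      refine (pow_le_pow_iff_left₀ (by positivity) (norm_nonneg x) two_ne_zero).1 ?_
      rw [mul_pow, Real.sq_sqrt hw.le, mul_comm]
      exact P.weight_mul_norm_sq_le x n)

@[simp] theorem coordCLM_apply (P : DiagonalParabolic A) (r : ℝ) (n : ℕ) (x : P.Scale r) :
    P.coordCLM r n x = P.coords x n := rfl

theorem continuous_coords (P : DiagonalParabolic A) (r : ℝ) (n : ℕ) :
    Continuous fun x : P.Scale r => P.coords x n := (P.coordCLM r n).continuous

/-- The `n`-th coordinate as a continuous linear functional on `H`. -/
def reprCLM (P : DiagonalParabolic A) (n : ℕ) : H →L[ℂ] ℂ := innerSL ℂ (P.basis n)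

@[simp] theorem reprCLM_apply (P : DiagonalParabolic A) (n : ℕ) (x : H) :
    P.reprCLM n x = P.basis.repr x n := by
  simp [reprCLM, HilbertBasis.repr_apply_apply]

theorem continuous_repr (P : DiagonalParabolic A) (n : ℕ) :
    Continuous fun x : H => P.basis.repr x n :=
  (P.reprCLM n).continuous.congr fun x => P.reprCLM_apply n x

theorem repr_basis (P : DiagonalParabolic A) (n m : ℕ) :
    P.basis.repr (P.basis n) m = if m = n then 1 else 0 := by
  classical
  rw [HilbertBasis.repr_self, lp.single_apply]
  simp [Pi.single_apply]

theorem repr_injective (P : DiagonalParabolic A) {x y : H}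
    (h : ∀ n, P.basis.repr x n = P.basis.repr y n) : x = y :=
  P.basis.repr.injective (lp.ext (funext h))

/-- Two continuous linear maps that agree on the basis are equal. -/
theorem clm_ext_basis (P : DiagonalParabolic A) {E : Type*} [NormedAddCommGroup E]
    [NormedSpace ℂ E] {f g : H →L[ℂ] E} (h : ∀ n, f (P.basis n) = g (P.basis n)) : f = g := by
  refine ContinuousLinearMap.ext_on
    ((Submodule.dense_iff_topologicalClosure_eq_top).2 P.basis.dense_span) ?_
  rintro _ ⟨n, rfl⟩
  exact h n

/-- Closed graph theorem for maps into `D_r(A)`: continuity may be checked coordinatewise. -/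
theorem continuous_of_coords (P : DiagonalParabolic A) {E : Type*} [NormedAddCommGroup E]
    [NormedSpace ℂ E] [CompleteSpace E] {r : ℝ} (f : E →ₗ[ℂ] P.Scale r)
    (h : ∀ n, Continuous fun x => P.coords (f x) n) : Continuous f := by
  refine f.continuous_of_seq_closed_graph fun u x y hu hy => ?_
  apply P.coords_injective
  funext n
  exact tendsto_nhds_unique (((P.continuous_coords r n).tendsto y).comp hy)
    (((h n).tendsto x).comp hu)

/-- `H` is `D_0(A)`. -/
def toScaleZero (P : DiagonalParabolic A) : H ≃ₗᵢ[ℂ] P.Scale 0 where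
  toFun x := P.ofCoords (P.basis.repr x) (by simpa [weight_zero] using P.summable_repr x)
  invFun x := P.basis.repr.symm ⟨P.coords x, (memlp_two_iff _).2 (by
    simpa [weight_zero] using P.summable_coords x)⟩
  map_add' x y := by
    apply P.coords_injective; funext n
    rw [map_add P.coords]
    exact congrFun (congrArg Subtype.val (map_add P.basis.repr x y)) n
  map_smul' c x := by
    apply P.coords_injective; funext n
    rw [map_smul P.coords]
    exact congrFun (congrArg Subtype.val (map_smul P.basis.repr c x)) n
  left_inv x := by simp
  right_inv x := by
    apply P.coords_injective; funext n; simp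
  norm_map' x := by
    change ‖P.ofCoords (r := 0) (P.basis.repr x) _‖ = ‖x‖
    rw [norm_eq_seqNorm, coords_ofCoords, seqNorm_repr]

@[simp] theorem coords_toScaleZero (P : DiagonalParabolic A) (x : H) :
    P.coords (P.toScaleZero x) = P.basis.repr x := rfl

@[simp] theorem repr_toScaleZero_symm (P : DiagonalParabolic A) (x : P.Scale 0) (n : ℕ) :
    P.basis.repr (P.toScaleZero.symm x) n = P.coords x n := by
  have h := congrArg P.coords (P.toScaleZero.apply_symm_apply x)
  exact (congrFun (P.coords_toScaleZero _) n).symm.trans (congrFun h n)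

@[simp] theorem coords_incl (P : DiagonalParabolic A) {r r' : ℝ} (h : r' ≤ r) (x : P.Scale r) :
    P.coords (P.incl h x) = P.coords x := by
  unfold incl
  exact P.coords_ofCoords _ _

@[simp] theorem coords_diag (P : DiagonalParabolic A) (d : ℕ → ℂ) (hd) (x : H) (n : ℕ) :
    P.coords (P.diag d hd x) n = d n * P.basis.repr x n := rfl

@[simp] theorem coords_embH (P : DiagonalParabolic A) (x : H) (n : ℕ) :
    P.coords (P.embH x) n = P.basis.repr x n := by simp [embH]

@[simp] theorem coords_ext (P : DiagonalParabolic A) (x : H) (n : ℕ) :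
    P.coords (P.ext x) n = P.eig n * P.basis.repr x n := rfl

@[simp] theorem coords_target (P : DiagonalParabolic A) (lam mu : ℝ) (x : H) (n : ℕ) :
    P.coords (P.target lam mu x) n = P.targetEig lam mu n * P.basis.repr x n := rfl

theorem coords_control (P : DiagonalParabolic A) {m : ℕ} (B : Fin m → P.Scale (-1))
    (z : EuclideanSpace ℂ (Fin m)) (n : ℕ) :
    P.coords (P.control B z) n = ∑ j, z j * P.coords (B j) n := by
  simp [control]

theorem continuous_incl (P : DiagonalParabolic A) {r r' : ℝ} (h : r' ≤ r) :
    Continuous (P.incl h) :=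
  P.continuous_of_coords _ fun n => by simpa using P.continuous_coords r n

theorem continuous_diag [CompleteSpace H] (P : DiagonalParabolic A) (d : ℕ → ℂ) (hd) :
    Continuous (P.diag d hd) :=
  P.continuous_of_coords _ fun n =>
    (continuous_const (y := d n)).mul (P.continuous_repr n)

theorem coords_toScale (P : DiagonalParabolic A) {r : ℝ} {x : H} (hx : P.MemScale r x) :
    P.coords (P.toScale r x) = P.basis.repr x := by
  have : P.toScale r x = P.ofCoords (P.basis.repr x) hx := dif_pos hx
  rw [this]
  rfl

/-- The norm of `D_0(A)` in terms of elements of `D_r(A)`, `r ≥ 0`. -/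
theorem seqNorm_zero_coords (P : DiagonalParabolic A) {r : ℝ} (hr : 0 ≤ r) (x : P.Scale r) :
    P.seqNorm 0 (P.coords x) = ‖P.incl hr x‖ := by
  rw [norm_eq_seqNorm, coords_incl]

/-! ### The spectrum -/

theorem tendsto_norm_eig (P : DiagonalParabolic A) : Tendsto (fun n => ‖P.eig n‖) atTop atTop := by
  refine tendsto_atTop_mono (fun n => ?_) (tendsto_neg_atBot_atTop.comp P.tendsto_re)
  exact (neg_le_abs _).trans (Complex.abs_re_le_norm _)

theorem finite_low (P : DiagonalParabolic A) (lam : ℝ) : (P.low lam).Finite := by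
  have h := P.tendsto_re.eventually (eventually_lt_atBot (-lam))
  rw [← Nat.cofinite_eq_atTop, eventually_cofinite] at h
  simpa [low] using h

theorem finite_eigenspace (P : DiagonalParabolic A) (z : ℂ) : {k | P.eig k = z}.Finite := by
  have h := P.tendsto_norm_eig.eventually (eventually_gt_atTop ‖z‖)
  rw [← Nat.cofinite_eq_atTop, eventually_cofinite] at h
  refine h.subset fun k hk => ?_
  simp only [Set.mem_ofPred_eq] at hk ⊢
  simp [hk]

theorem low_eq_empty_of_maxMult_eq_zero (P : DiagonalParabolic A) {lam : ℝ}
    (h : P.maxMult lam = 0) : P.low lam = ∅ := by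
  by_contra hne
  obtain ⟨n, hn⟩ := nonempty_iff_ne_empty.2 hne
  have hfin : Finite (P.low lam) := P.finite_low lam
  have h1 : {k | P.eig k = P.eig n}.ncard ≤ P.maxMult lam :=
    le_ciSup (f := fun n : P.low lam => {k | P.eig k = P.eig n}.ncard)
      (Set.finite_range _).bddAbove ⟨n, hn⟩
  have h2 : 0 < {k | P.eig k = P.eig n}.ncard :=
    (Set.ncard_pos (P.finite_eigenspace _)).2 ⟨n, rfl⟩
  omega

theorem eventually_weight_one_le (P : DiagonalParabolic A) (z : ℂ) :
    ∀ᶠ n in atTop, P.weight 1 n ≤ 8 * ‖P.eig n - z‖ ^ 2 := by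
  filter_upwards [P.tendsto_norm_eig.eventually (eventually_ge_atTop (2 * ‖z‖)),
    P.tendsto_norm_eig.eventually (eventually_ge_atTop 1)] with n h1 h2
  have h3 := norm_sub_norm_le (P.eig n) z
  rw [weight_one]
  have h4 : ‖P.eig n‖ / 2 ≤ ‖P.eig n - z‖ := by linarith
  nlinarith

/-- Dividing coordinatewise by `λ_n - z` raises the exponent in the scale by `1`; finitely many
coordinates do not matter. -/
theorem summable_div_sub (P : DiagonalParabolic A) {r : ℝ} (b : P.Scale r) (z : ℂ)
    (x : ℕ → ℂ) (hx : ∀ᶠ n in atTop, (P.eig n - z) * x n = P.coords b n) {r' : ℝ}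
    (hr : r' ≤ r + 1) : Summable fun n => P.weight r' n * ‖x n‖ ^ 2 := by
  have h := P.eventually_weight_one_le z
  refine summable_of_isBigO_nat' (P.summable_coords b) (Asymptotics.IsBigO.of_bound 8 ?_)
  filter_upwards [h, hx] with n hn hx
  have hw := P.weight_pos r n
  have hw' := P.weight_pos r' n
  rw [Real.norm_of_nonneg (by positivity), Real.norm_of_nonneg (by positivity), ← hx, norm_mul,
    mul_pow]
  calc P.weight r' n * ‖x n‖ ^ 2 ≤ P.weight (r + 1) n * ‖x n‖ ^ 2 := by
        gcongr; exact P.weight_mono hr n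
    _ = P.weight r n * (P.weight 1 n * ‖x n‖ ^ 2) := by rw [weight_add]; ring
    _ ≤ P.weight r n * (8 * ‖P.eig n - z‖ ^ 2 * ‖x n‖ ^ 2) := by gcongr
    _ = _ := by ring

theorem summable_of_eventually_eq_zero (x : ℕ → ℝ) (h : ∀ᶠ n in atTop, x n = 0) : Summable x :=
  summable_of_isBigO_nat' (g := fun _ => (0 : ℝ)) summable_zero
    (Asymptotics.IsBigO.of_bound 1 (by filter_upwards [h] with n hn; simp [hn]))

theorem eventually_notMem_low (P : DiagonalParabolic A) (lam : ℝ) :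
    ∀ᶠ n in atTop, n ∉ P.low lam := by
  rw [← Nat.cofinite_eq_atTop, eventually_cofinite]
  simpa using P.finite_low lam

theorem targetEig_of_mem (P : DiagonalParabolic A) {lam : ℝ} (mu : ℝ) {n : ℕ}
    (h : n ∈ P.low lam) : P.targetEig lam mu n = P.eig n - mu := if_pos h

theorem targetEig_of_notMem (P : DiagonalParabolic A) {lam : ℝ} (mu : ℝ) {n : ℕ}
    (h : n ∉ P.low lam) : P.targetEig lam mu n = P.eig n := if_neg h

theorem bddAbove_re (P : DiagonalParabolic A) : BddAbove (range fun n => (P.eig n).re) :=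
  ⟨(P.eig 0).re, by rintro _ ⟨n, rfl⟩; exact P.antitone_re (Nat.zero_le n)⟩

theorem re_le_cA (P : DiagonalParabolic A) (n : ℕ) : (P.eig n).re ≤ P.cA :=
  (le_ciSup P.bddAbove_re n).trans (le_max_right _ _)

/-! ### Construction of an F-equivalence -/

/-- A diagonal operator plus finitely many columns, `x ↦ (t_p x_p + ∑_{n ∈ L} x_n M_{n,p})_p`, on
coordinate sequences. -/
def diagAddColumns (L : Finset ℕ) (t : ℕ → ℂ) (M : ℕ → ℕ → ℂ) : (ℕ → ℂ) →ₗ[ℂ] (ℕ → ℂ) where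
  toFun x p := t p * x p + ∑ n ∈ L, x n * M n p
  map_add' x y := by
    funext p
    simp only [Pi.add_apply, add_mul, Finset.sum_add_distrib]
    ring
  map_smul' c x := by
    funext p
    simp only [Pi.smul_apply, smul_eq_mul, RingHom.id_apply, mul_add, Finset.mul_sum]
    congr 1
    · ring
    · exact Finset.sum_congr rfl fun n _ => by ring

theorem diagAddColumns_apply (L : Finset ℕ) (t : ℕ → ℂ) (M : ℕ → ℕ → ℂ) (x : ℕ → ℂ) (p : ℕ) :
    diagAddColumns L t M x p = t p * x p + ∑ n ∈ L, x n * M n p := rfl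

theorem mem_scaleSubmodule_iff (P : DiagonalParabolic A) {r : ℝ} {x : ℕ → ℂ} :
    x ∈ P.scaleSubmodule r ↔ Summable fun n => P.weight r n * ‖x n‖ ^ 2 := Iff.rfl

theorem mem_scaleSubmodule_mul (P : DiagonalParabolic A) {r : ℝ} {t : ℕ → ℂ} {C : ℝ}
    (ht : ∀ p, ‖t p‖ ≤ C) {x : ℕ → ℂ} (hx : x ∈ P.scaleSubmodule r) :
    (fun p => t p * x p) ∈ P.scaleSubmodule r := by
  refine Summable.of_nonneg_of_le (fun p => ?_) (fun p => ?_) (Summable.mul_left (C ^ 2) hx)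
  · have := P.weight_pos r p
    positivity
  · have h1 := (P.weight_pos r p).le
    have h2 : ‖t p‖ ^ 2 ≤ C ^ 2 := pow_le_pow_left₀ (norm_nonneg _) (ht p) 2
    rw [norm_mul, mul_pow]
    calc P.weight r p * (‖t p‖ ^ 2 * ‖x p‖ ^ 2) = ‖t p‖ ^ 2 * (P.weight r p * ‖x p‖ ^ 2) := by ring
      _ ≤ _ := by gcongr

theorem mem_scaleSubmodule_columns (P : DiagonalParabolic A) {r : ℝ} (L : Finset ℕ)
    {M : ℕ → ℕ → ℂ} (hM : ∀ n ∈ L, M n ∈ P.scaleSubmodule r) (c : ℕ → ℂ) :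
    (fun p => ∑ n ∈ L, c n * M n p) ∈ P.scaleSubmodule r := by
  have h := Submodule.sum_mem (P.scaleSubmodule r) (t := L) (f := fun n => c n • M n)
    fun n hn => Submodule.smul_mem _ _ (hM n hn)
  convert h using 1
  funext p
  simp

theorem mem_scaleSubmodule_of_eventually_eq_zero (P : DiagonalParabolic A) {r : ℝ} {x : ℕ → ℂ}
    (h : ∀ᶠ p in atTop, x p = 0) : x ∈ P.scaleSubmodule r :=
  summable_of_eventually_eq_zero _ (by filter_upwards [h] with p hp; simp [hp])

theorem exists_norm_le_of_tendsto {t : ℕ → ℂ} {a : ℂ} (h : Tendsto t atTop (𝓝 a)) :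
    ∃ C, ∀ p, ‖t p‖ ≤ C := by
  obtain ⟨C, hC⟩ := h.norm.bddAbove_range
  exact ⟨C, fun p => hC ⟨p, rfl⟩⟩

/-- A diagonal operator plus columns in `L`, whose diagonal part vanishes exactly on `L`, is an
automorphism of `D_r(A)` as soon as the square block of the columns is injective. -/
theorem exists_equiv_diagAddColumns (P : DiagonalParabolic A) (r : ℝ) (L : Finset ℕ) (t : ℕ → ℂ)
    (M : ℕ → ℕ → ℂ) (ht : Tendsto t atTop (𝓝 1)) (htL : ∀ p ∈ L, t p = 0)
    (htH : ∀ p ∉ L, t p ≠ 0) (hM : ∀ n ∈ L, M n ∈ P.scaleSubmodule r)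
    (hinj : ∀ c : ℕ → ℂ, (∀ p ∈ L, ∑ n ∈ L, c n * M n p = 0) → ∀ n ∈ L, c n = 0) :
    ∃ e : P.Scale r ≃L[ℂ] P.Scale r, ∀ x, P.coords (e x) = diagAddColumns L t M (P.coords x) := by
  classical
  obtain ⟨C, hC⟩ := exists_norm_le_of_tendsto ht
  obtain ⟨C', hC'⟩ := exists_norm_le_of_tendsto (ht.inv₀ one_ne_zero)
  have hmem : ∀ x ∈ P.scaleSubmodule r, diagAddColumns L t M x ∈ P.scaleSubmodule r :=
    fun x hx => Submodule.add_mem _ (P.mem_scaleSubmodule_mul hC hx)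
      (P.mem_scaleSubmodule_columns L hM x)
  let f : P.Scale r →ₗ[ℂ] P.Scale r :=
    { toFun := fun x => P.ofCoords (diagAddColumns L t M (P.coords x)) 
        (P.mem_scaleSubmodule_iff.1 (hmem _ (P.mem_scaleSubmodule_iff.2 (P.summable_coords x))))
      map_add' := fun x y => by
        apply P.coords_injective
        simp
      map_smul' := fun c x => by
        apply P.coords_injective
        simp }
  have hf : ∀ x, P.coords (f x) = diagAddColumns L t M (P.coords x) :=
    fun x => P.coords_ofCoords _ _
  have hcont : Continuous f := P.continuous_of_coords f fun p => by
    simp only [hf, diagAddColumns_apply]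
    exact ((continuous_const (y := t p)).mul (P.continuous_coords r p)).add
      (continuous_finsetSum _ fun n _ => (P.continuous_coords r n).mul continuous_const)
  have hfinj : Function.Injective f := by
    rw [← LinearMap.ker_eq_bot, LinearMap.ker_eq_bot']
    intro x hx
    have h0 : ∀ p, t p * P.coords x p + ∑ n ∈ L, P.coords x n * M n p = 0 := fun p => by
      rw [← diagAddColumns_apply, ← hf, hx]
      simp
    have hlow : ∀ n ∈ L, P.coords x n = 0 := hinj _ fun p hp => by
      simpa [htL p hp] using h0 p
    apply P.coords_injective
    funext p
    by_cases hp : p ∈ L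
    · simpa using hlow p hp
    · have h1 := h0 p
      rw [Finset.sum_eq_zero fun n hn => by rw [hlow n hn, zero_mul], add_zero] at h1
      simpa [htH p hp] using h1
  have hfsurj : Function.Surjective f := by
    intro y
    -- the low coordinates are found by solving a square system
    let g : (L → ℂ) →ₗ[ℂ] (L → ℂ) :=
      { toFun := fun c p => ∑ n, c n * M n p
        map_add' := fun c d => by
          funext p
          simp [add_mul, Finset.sum_add_distrib]
        map_smul' := fun a c => by
          funext p
          simp [Finset.mul_sum, mul_assoc] }
    have hg : Function.Injective g := by
      rw [← LinearMap.ker_eq_bot, LinearMap.ker_eq_bot']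
      intro c hc
      have h1 := hinj (fun n => if h : n ∈ L then c ⟨n, h⟩ else 0) fun p hp => by
        rw [← Finset.sum_coe_sort]
        simpa [g] using congrFun hc ⟨p, hp⟩
      funext n
      simpa using h1 n n.2
    obtain ⟨c, hc⟩ := LinearMap.injective_iff_surjective.1 hg fun p => P.coords y p
    let c' : ℕ → ℂ := fun n => if h : n ∈ L then c ⟨n, h⟩ else 0
    have hc' : ∀ p ∈ L, ∑ n ∈ L, c' n * M n p = P.coords y p := by
      intro p hp
      rw [← Finset.sum_coe_sort]
      simpa [g, c'] using congrFun hc ⟨p, hp⟩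
    have hrest : (fun p => (t p)⁻¹ * (P.coords y p - ∑ n ∈ L, c' n * M n p)) ∈
        P.scaleSubmodule r :=
      P.mem_scaleSubmodule_mul hC'
        (Submodule.sub_mem _ y.2 (P.mem_scaleSubmodule_columns L hM c'))
    have hlow : c' ∈ P.scaleSubmodule r := by
      refine P.mem_scaleSubmodule_of_eventually_eq_zero ?_
      have : ∀ᶠ p in atTop, p ∉ L := by
        rw [← Nat.cofinite_eq_atTop]
        exact L.eventually_cofinite_notMem
      filter_upwards [this] with p hp
      simp [c', hp]
    -- `(t p)⁻¹ = 0` at the low indices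
    refine ⟨P.ofCoords _ (P.mem_scaleSubmodule_iff.1 (Submodule.add_mem _ hlow hrest)), ?_⟩
    apply P.coords_injective
    rw [hf, coords_ofCoords]
    funext p
    rw [diagAddColumns_apply]
    have hsum : ∑ n ∈ L, (c' + fun p => (t p)⁻¹ * (P.coords y p - ∑ n ∈ L, c' n * M n p)) n *
        M n p = ∑ n ∈ L, c' n * M n p :=
      Finset.sum_congr rfl fun n hn => by simp [htL n hn]
    rw [hsum]
    by_cases hp : p ∈ L
    · rw [hc' p hp, htL p hp]
      simp
    · have := htH p hp
      simp only [Pi.add_apply, c', hp, dite_false, zero_add]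
      field_simp
      ring
  refine ⟨ContinuousLinearEquiv.ofBijective ⟨f, hcont⟩ (LinearMap.ker_eq_bot.2 hfinj)
    (LinearMap.range_eq_top.2 hfsurj), fun x => ?_⟩
  rw [← hf]
  rfl

theorem targetEig_ne_eig (P : DiagonalParabolic A) {lam mu : ℝ}
    (hmu : ∀ i n, P.eig i - P.eig n ≠ mu) {n : ℕ} (hn : n ∈ P.low lam) (p : ℕ) :
    P.targetEig lam mu p ≠ P.eig n := by
  by_cases hp : p ∈ P.low lam
  · rw [P.targetEig_of_mem mu hp]
    exact fun h => hmu p n (by rw [← h]; ring)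
  · rw [P.targetEig_of_notMem mu hp]
    intro h
    refine hp ?_
    simp only [low, Set.mem_ofPred_eq] at hn ⊢
    rwa [h]

/-- The pair `(T, K)` is given by
`(T x)_p = t_p x_p + ∑_n κ_n x_n B_{j(n), p} / (τ_p - λ_n)` and `K x = ∑_n κ_n x_n ε_{j(n)}`, the
sums over the low frequencies, where `τ` is the spectrum of the target operator and
`t_p = 1 - ∑_{j(n) = j(p)} κ_n B_{j(n), n} / (τ_p - λ_n)`.  The fixed point property
`T B_j = B_j` is then automatic, and the intertwining property amounts to `t_p (λ_p - τ_p) = 0`,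
that is `t_p = 0` at low frequencies; this determines `κ`. -/
theorem exists_isParabolicFEquivalence_of_families [CompleteSpace H] (P : DiagonalParabolic A)
    {lam mu : ℝ} (hmu : ∀ i n, P.eig i - P.eig n ≠ mu) {m : ℕ} (B : Fin m → P.Scale (-1))
    (j : ℕ → Fin m)
    (hsimple : ∀ a ∈ P.low lam, ∀ b ∈ P.low lam, j a = j b → P.eig a = P.eig b → a = b)
    (hzero : ∀ i p, j p ≠ i → P.coords (B i) p = 0)
    (hne : ∀ n ∈ P.low lam, P.coords (B (j n)) n ≠ 0) :
    ∃ (T : P.GLH) (K : H →L[ℂ] EuclideanSpace ℂ (Fin m)),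
      P.IsParabolicFEquivalence lam mu B T K := by
  classical
  set L : Finset ℕ := (P.finite_low lam).toFinset with hL
  have memL : ∀ n, n ∈ L ↔ n ∈ P.low lam := fun n => (P.finite_low lam).mem_toFinset
  set I : Fin m → Finset ℕ := fun i => L.filter (fun n => j n = i) with hI
  have memI : ∀ i n, n ∈ I i ↔ n ∈ L ∧ j n = i := fun i n => Finset.mem_filter
  have hinjI : ∀ i, Set.InjOn P.eig (I i) := by
    intro i a ha b hb hab
    rw [Finset.mem_coe, memI] at ha hb
    exact hsimple a ((memL a).1 ha.1) b ((memL b).1 hb.1) (ha.2.trans hb.2.symm) hab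
  choose k hk hk0 using fun i => exists_partial_fraction (I i) P.eig (hinjI i) mu
  have hk0' : ∀ i, ∀ n ∈ I i, k i n ≠ 0 := fun i n hn => hk0 i n hn fun a _ h =>
    hmu a n (by linear_combination -h)
  set τ : ℕ → ℂ := P.targetEig lam mu with hτ
  have hτne : ∀ p, ∀ n ∈ L, τ p - P.eig n ≠ 0 := fun p n hn =>
    sub_ne_zero.2 (P.targetEig_ne_eig hmu ((memL n).1 hn) p)
  set κ : ℕ → ℂ := fun n => k (j n) n / P.coords (B (j n)) n with hκ
  have hκ0 : ∀ n ∈ L, κ n ≠ 0 := fun n hn =>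
    div_ne_zero (hk0' _ n ((memI _ _).2 ⟨hn, rfl⟩)) (hne n ((memL n).1 hn))
  set t : ℕ → ℂ := fun p => 1 - ∑ n ∈ I (j p), k (j p) n / (τ p - P.eig n) with ht
  set M : ℕ → ℕ → ℂ := fun n p => κ n * P.coords (B (j n)) p / (τ p - P.eig n) with hM
  have htprod : ∀ p, t p = ∏ n ∈ I (j p), (τ p - P.eig n + mu) / (τ p - P.eig n) := fun p =>
    hk (j p) (τ p) fun n hn => sub_ne_zero.1 (hτne p n ((memI _ _).1 hn).1)
  have htL : ∀ p ∈ L, t p = 0 := by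
    intro p hp
    rw [htprod]
    refine Finset.prod_eq_zero ((memI _ _).2 ⟨hp, rfl⟩) ?_
    rw [hτ, P.targetEig_of_mem mu ((memL p).1 hp)]
    simp
  have htH : ∀ p ∉ L, t p ≠ 0 := by
    intro p hp
    rw [htprod]
    refine Finset.prod_ne_zero_iff.2 fun n hn =>
      div_ne_zero ?_ (hτne p n ((memI _ _).1 hn).1)
    rw [hτ, P.targetEig_of_notMem mu (fun h => hp ((memL p).2 h))]
    exact fun h => hmu n p (by linear_combination -h)
  have hhigh : ∀ᶠ p in atTop, τ p = P.eig p := by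
    filter_upwards [P.eventually_notMem_low lam] with p hp
    exact P.targetEig_of_notMem mu hp
  have htlim : Tendsto t atTop (𝓝 1) := by
    have h1 : t = fun p => 1 - ∑ n ∈ L, if j n = j p then k (j n) n / (τ p - P.eig n) else 0 := by
      funext p
      simp only [ht, hI, Finset.sum_filter]
      congr 1
      refine Finset.sum_congr rfl fun n _ => ?_
      split_ifs with h
      · rw [h]
      · rfl
    have h2 : ∀ n, Tendsto (fun p => if j n = j p then k (j n) n / (τ p - P.eig n) else 0) atTop
        (𝓝 0) := by
      intro n
      have h3 : Tendsto (fun p => ‖τ p - P.eig n‖) atTop atTop := by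
        refine tendsto_atTop_mono' _ ?_
          (tendsto_atTop_add_const_right _ (-‖P.eig n‖) P.tendsto_norm_eig)
        filter_upwards [hhigh] with p hp
        rw [hp, ← sub_eq_add_neg]
        exact norm_sub_norm_le _ _
      refine squeeze_zero_norm (fun p => ?_) (h3.inv_tendsto_atTop.const_mul ‖k (j n) n‖ |>.trans
        (by rw [mul_zero]))
      split_ifs
      · rw [norm_div, div_eq_mul_inv]; rfl
      · rw [norm_zero]; exact mul_nonneg (norm_nonneg _) (inv_nonneg.2 (norm_nonneg _))
    rw [h1]
    simpa using (tendsto_finsetSum L fun n _ => h2 n).const_sub 1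
  have hcol : ∀ r : ℝ, r ≤ 0 → ∀ n ∈ L, M n ∈ P.scaleSubmodule r := by
    intro r hr n hn
    refine P.mem_scaleSubmodule_iff.2
      (P.summable_div_sub (κ n • B (j n)) (P.eig n) _ ?_ (by linarith))
    filter_upwards [hhigh] with p hp
    have h1 := hτne p n hn
    rw [hp] at h1
    simp only [hM, hp, map_smul, Pi.smul_apply, smul_eq_mul]
    field_simp
  have hinj : ∀ c : ℕ → ℂ, (∀ p ∈ L, ∑ n ∈ L, c n * M n p = 0) → ∀ n ∈ L, c n = 0 := by
    intro c hc n hn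
    have h1 := eq_zero_of_cauchy (I (j n)) P.eig τ (fun n => c n * κ n) (hinjI _) ?_ ?_ ?_ n
      ((memI _ _).2 ⟨hn, rfl⟩)
    · simpa [hκ0 n hn] using h1
    · intro a ha b hb hab
      have ha' := (memL a).1 ((memI _ _).1 (Finset.mem_coe.1 ha)).1
      have hb' := (memL b).1 ((memI _ _).1 (Finset.mem_coe.1 hb)).1
      rw [hτ, P.targetEig_of_mem mu ha', P.targetEig_of_mem mu hb'] at hab
      exact hinjI _ ha hb (by linear_combination hab)
    · intro a _ b hb
      exact sub_ne_zero.1 (hτne a b ((memI _ _).1 hb).1)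
    · intro p hp
      obtain ⟨hpL, hpj⟩ := (memI _ _).1 hp
      have hb : P.coords (B (j n)) p ≠ 0 := by
        rw [← hpj]; exact hne p ((memL p).1 hpL)
      have h2 := hc p hpL
      have h3 : ∑ n ∈ L, c n * M n p =
          P.coords (B (j n)) p * ∑ q ∈ I (j n), c q * κ q / (τ p - P.eig q) := by
        rw [hI, Finset.sum_filter, Finset.mul_sum]
        refine Finset.sum_congr rfl fun q _ => ?_
        split_ifs with h
        · simp only [hM, h]; ring
        · simp only [hM]
          rw [hzero (j q) p (by rw [hpj]; exact fun h' => h h'.symm)]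
          simp
      rw [h3] at h2
      exact (mul_eq_zero.1 h2).resolve_left hb
  obtain ⟨e, he⟩ := P.exists_equiv_diagAddColumns (-1) L t M htlim htL htH
    (hcol _ (by norm_num)) hinj
  obtain ⟨e₀, he₀⟩ := P.exists_equiv_diagAddColumns 0 L t M htlim htL htH (hcol _ le_rfl) hinj
  let onH : H ≃L[ℂ] H :=
    (P.toScaleZero.toContinuousLinearEquiv.trans e₀).trans
      P.toScaleZero.symm.toContinuousLinearEquiv
  have honH : ∀ x p, P.basis.repr (onH x) p = diagAddColumns L t M (P.basis.repr x) p := by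
    intro x p
    change P.basis.repr (P.toScaleZero.symm (e₀ (P.toScaleZero x))) p = _
    rw [repr_toScaleZero_symm, he₀]
    rfl
  let T : P.GLH := ⟨e, onH, fun x => by
    apply P.coords_injective
    funext p
    rw [he, coords_embH, honH, diagAddColumns_apply, diagAddColumns_apply]
    simp only [coords_embH]⟩
  let K : H →L[ℂ] EuclideanSpace ℂ (Fin m) :=
    ∑ n ∈ L, (κ n • P.reprCLM n).smulRight (EuclideanSpace.single (j n) (1 : ℂ))
  have hK : ∀ x i, K x i = ∑ n ∈ L, if j n = i then κ n * P.basis.repr x n else 0 := by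
    intro x i
    simp only [K, _root_.sum_apply, ContinuousLinearMap.smulRight_apply,
      _root_.smul_apply, reprCLM_apply]
    rw [WithLp.ofLp_sum, Finset.sum_apply]
    refine Finset.sum_congr rfl fun n _ => ?_
    by_cases h : j n = i
    · simp [h]
    · simp [h, Ne.symm h]
  have hBK : ∀ x p, P.coords (P.control B (K x)) p =
      ∑ n ∈ L, κ n * P.basis.repr x n * P.coords (B (j n)) p := by
    intro x p
    rw [coords_control]
    simp only [hK, Finset.sum_mul]
    rw [Finset.sum_comm]
    refine Finset.sum_congr rfl fun n _ => ?_
    simp [ite_mul]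
  have hfix : ∀ i, e (B i) = B i := by
    intro i
    apply P.coords_injective
    funext p
    rw [he, diagAddColumns_apply]
    by_cases hp : j p = i
    · have h1 : ∑ n ∈ L, P.coords (B i) n * M n p =
          P.coords (B i) p * ∑ n ∈ I (j p), k (j p) n / (τ p - P.eig n) := by
        rw [hI, Finset.sum_filter, Finset.mul_sum]
        refine Finset.sum_congr rfl fun n hn => ?_
        split_ifs with h
        · have h2 := hne n ((memL n).1 hn)
          simp only [hM, hκ, h, hp] at h2 ⊢
          field_simp
        · rw [hzero i n (by rw [← hp]; exact h)]
          simp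
      rw [h1]
      simp only [ht]
      ring
    · rw [hzero i p hp, mul_zero, zero_add]
      refine Finset.sum_eq_zero fun n _ => ?_
      by_cases h : j n = i
      · simp only [hM]
        rw [h, hzero i p hp]
        simp
      · rw [hzero i n h, zero_mul]
  refine ⟨T, K, ?_, hfix, ?_⟩
  · intro x
    change e (P.ext x + P.control B (K x)) = P.target lam mu (onH x)
    have hc : e (P.control B (K x)) = P.control B (K x) := by
      simp only [control, map_sum, map_smul, hfix]
    rw [map_add, hc]
    apply P.coords_injective
    funext p
    rw [map_add, Pi.add_apply, he, hBK, coords_target, honH, diagAddColumns_apply,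
      diagAddColumns_apply, add_assoc, ← Finset.sum_add_distrib, mul_add, Finset.mul_sum]
    simp only [coords_ext]
    congr 1
    · by_cases hp : p ∈ L
      · rw [htL p hp]; ring
      · rw [P.targetEig_of_notMem mu (fun h => hp ((memL p).2 h))]; ring
    · refine Finset.sum_congr rfl fun n hn => ?_
      have h1 := hτne p n hn
      simp only [hM]
      field_simp
      rw [hτ]
      ring
  · intro n hn
    ext i
    rw [hK]
    refine Finset.sum_eq_zero fun q hq => ?_
    have hqn : q ≠ n := by
      rintro rfl
      exact hn ((memL q).1 hq)
    simp [repr_basis, hqn]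

/-- For all real `μ` outside a countable set no difference of eigenvalues equals `μ`. -/
theorem ae_eig_sub_ne (P : DiagonalParabolic A) : ∀ᵐ mu : ℝ, ∀ i n, P.eig i - P.eig n ≠ mu := by
  rw [ae_all_iff]
  intro i
  rw [ae_all_iff]
  intro n
  refine measure_mono_null (t := {(P.eig i - P.eig n).re}) ?_ (measure_singleton _)
  intro mu hmu
  simp only [Set.mem_compl_iff, Set.mem_ofPred_eq, not_not] at hmu
  simp [hmu]

/-- Existence of an F-equivalence for an admissible control, if `μ` is not a difference of two
eigenvalues. -/
theorem exists_isParabolicFEquivalence [CompleteSpace H] (P : DiagonalParabolic A)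
    {lam mu : ℝ} (hmu : ∀ i n, P.eig i - P.eig n ≠ mu) {m : ℕ} {B : Fin m → P.Scale (-1)}
    (hB : P.FAdmissible lam B) :
    ∃ (T : P.GLH) (K : H →L[ℂ] EuclideanSpace ℂ (Fin (P.maxMult lam))),
      P.IsParabolicFEquivalence lam mu (fun j => B (Fin.castLE hB.le j)) T K := by
  classical
  rcases Nat.eq_zero_or_pos (P.maxMult lam) with h0 | hpos
  · -- no low frequencies: the target operator is `A` itself
    have hlow := P.low_eq_empty_of_maxMult_eq_zero h0
    have hempty : IsEmpty (Fin (P.maxMult lam)) := by rw [h0]; infer_instance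
    refine ⟨⟨.refl ℂ _, .refl ℂ _, fun _ => rfl⟩, 0, fun x => ?_, fun _ => rfl, fun _ _ => rfl⟩
    apply P.coords_injective
    funext n
    have hn : n ∉ P.low lam := by simp [hlow]
    simp [control, P.targetEig_of_notMem mu hn]
  · obtain ⟨S, -, hdisj, hcover, hsimple, hzero, hne⟩ := hB.exists_partition
    have hex : ∀ n, ∃ j, n ∈ S j := fun n => mem_iUnion.1 (by rw [hcover hpos]; trivial)
    choose j hj using hex
    have hju : ∀ n i, n ∈ S i → j n = i := by
      intro n i hi
      by_contra h
      exact Set.disjoint_left.1 (hdisj _ _ h) (hj n) hi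
    refine P.exists_isParabolicFEquivalence_of_families hmu _ j ?_ ?_ ?_
    · intro a ha b hb hab hE
      exact hsimple (j a) ⟨hj a, ha⟩ ⟨hab ▸ hj b, hb⟩ hE
    · intro i p hp
      exact hzero i p fun h => hp (hju p i h)
    · intro n hn
      exact hne (j n) n ⟨hj n, hn⟩

/-! ### Action of an F-equivalence on the scale -/

theorem weight_half_sq (P : DiagonalParabolic A) (r : ℝ) (n : ℕ) :
    P.weight (r / 2) n ^ 2 = P.weight r n := by
  rw [sq, ← weight_add, add_halves]

theorem weight_mul_weight_neg (P : DiagonalParabolic A) (r : ℝ) (n : ℕ) :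
    P.weight r n * P.weight (-r) n = 1 := by
  rw [← weight_add, add_neg_cancel, weight_zero]

open Classical in
/-- The symbol of `(1 + |A|²) ^ ρ` cut off to the high frequencies. -/
def highPow (P : DiagonalParabolic A) (lam ρ : ℝ) (n : ℕ) : ℂ :=
  if n ∈ P.low lam then 0 else (P.weight ρ n : ℂ)

theorem highPow_of_mem (P : DiagonalParabolic A) {lam : ℝ} (ρ : ℝ) {n : ℕ} (h : n ∈ P.low lam) :
    P.highPow lam ρ n = 0 := if_pos h

theorem highPow_of_notMem (P : DiagonalParabolic A) {lam : ℝ} (ρ : ℝ) {n : ℕ}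
    (h : n ∉ P.low lam) : P.highPow lam ρ n = P.weight ρ n := if_neg h

theorem norm_weight_ofReal (P : DiagonalParabolic A) (ρ : ℝ) (n : ℕ) :
    ‖(P.weight ρ n : ℂ)‖ = P.weight ρ n := by
  rw [Complex.norm_real, Real.norm_of_nonneg (P.weight_pos ρ n).le]

theorem highPow_bound (P : DiagonalParabolic A) (lam : ℝ) {ρ : ℝ} (hρ : ρ ≤ 1 / 2) :
    ∃ c : ℝ, ∀ n, ‖P.highPow lam ρ n‖ ^ 2 ≤ c * (1 + ‖P.eig n‖ ^ 2) := by
  refine ⟨1, fun n => ?_⟩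
  rw [one_mul, ← weight_one]
  by_cases h : n ∈ P.low lam
  · rw [P.highPow_of_mem ρ h]
    simpa using (P.weight_pos 1 n).le
  · rw [P.highPow_of_notMem ρ h, norm_weight_ofReal, ← P.weight_half_sq 1]
    exact pow_le_pow_left₀ (P.weight_pos ρ n).le (P.weight_mono hρ n) 2

/-- The projection onto the low frequencies. -/
def lowProj (P : DiagonalParabolic A) (lam : ℝ) : H →L[ℂ] H :=
  ∑ n ∈ (P.finite_low lam).toFinset, (P.reprCLM n).smulRight (P.basis n)

theorem lowProj_apply (P : DiagonalParabolic A) (lam : ℝ) (x : H) :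
    P.lowProj lam x =
      ∑ n ∈ (P.finite_low lam).toFinset, P.basis.repr x n • P.basis n := by
  simp only [lowProj, _root_.sum_apply, ContinuousLinearMap.smulRight_apply, reprCLM_apply]

theorem repr_lowProj (P : DiagonalParabolic A) (lam : ℝ) (x : H) (p : ℕ)
    [Decidable (p ∈ P.low lam)] :
    P.basis.repr (P.lowProj lam x) p = if p ∈ P.low lam then P.basis.repr x p else 0 := by
  rw [lowProj_apply, ← reprCLM_apply, map_sum]
  simp only [map_smul, reprCLM_apply, repr_basis, smul_eq_mul, mul_ite, mul_one, mul_zero]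
  simp

theorem lowProj_basis (P : DiagonalParabolic A) (lam : ℝ) (n : ℕ) [Decidable (n ∈ P.low lam)] :
    P.lowProj lam (P.basis n) = if n ∈ P.low lam then P.basis n else 0 := by
  classical
  refine P.repr_injective fun p => ?_
  rw [repr_lowProj]
  by_cases hn : n ∈ P.low lam <;> by_cases hp : p ∈ P.low lam
  · simp [hn, hp]
  · have : p ≠ n := fun h => hp (h ▸ hn)
    simp [hn, hp, repr_basis, this]
  · have : p ≠ n := fun h => hn (h ▸ hp)
    simp [hn, hp, repr_basis, this]
  · simp [hn, hp]

section Equivalence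

variable {P : DiagonalParabolic A} {lam mu : ℝ} {m : ℕ} {T : P.GLH}
  {K : H →L[ℂ] EuclideanSpace ℂ (Fin m)}

/-- At high frequencies `T` only couples basis vectors with the same eigenvalue. -/
theorem IsParabolicFEquivalence.eig_mul_repr {B : Fin m → P.Scale (-1)}
    (h : P.IsParabolicFEquivalence lam mu B T K) {p q : ℕ} (hp : p ∉ P.low lam)
    (hq : q ∉ P.low lam) :
    P.eig q * P.basis.repr (T.onH (P.basis q)) p =
      P.eig p * P.basis.repr (T.onH (P.basis q)) p := by
  have h1 := h.intertwine (P.basis q)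
  have h2 : P.ext (P.basis q) = P.eig q • P.embH (P.basis q) := by
    apply P.coords_injective
    funext n
    simp only [map_smul, Pi.smul_apply, coords_ext, coords_embH, repr_basis, smul_eq_mul]
    split_ifs with h
    · rw [h]
    · simp
  have h3 : P.control B (K (P.basis q)) = 0 := by
    rw [h.vanish q hq]
    simp [control]
  rw [h2, h3, add_zero, map_smul, T.onDual_embH] at h1
  have h4 := congrFun (congrArg P.coords h1) p
  rwa [map_smul, Pi.smul_apply, coords_embH, coords_target, P.targetEig_of_notMem mu hp,
    smul_eq_mul] at h4

/-- At high frequencies `T` commutes with powers of `1 + |A|²`. -/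
theorem IsParabolicFEquivalence.coords_onDual_highPow [CompleteSpace H] {B : Fin m → P.Scale (-1)}
    (h : P.IsParabolicFEquivalence lam mu B T K) {ρ : ℝ} (hρ : ρ ≤ 1 / 2) {p : ℕ}
    (hp : p ∉ P.low lam) (x : H) :
    P.coords (T.onDual (P.diag (P.highPow lam ρ) (P.highPow_bound lam hρ) x)) p =
      P.weight ρ p * P.basis.repr (T.onH (x - P.lowProj lam x)) p := by
  classical
  let D : H →L[ℂ] P.Scale (-1) :=
    ⟨P.diag (P.highPow lam ρ) (P.highPow_bound lam hρ), P.continuous_diag _ _⟩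
  have key : (P.coordCLM (-1) p).comp ((T.onDual : P.Scale (-1) →L[ℂ] P.Scale (-1)).comp D) =
      (P.weight ρ p : ℂ) • (P.reprCLM p).comp ((T.onH : H →L[ℂ] H).comp
        (ContinuousLinearMap.id ℂ H - P.lowProj lam)) := by
    refine P.clm_ext_basis fun n => ?_
    have hD : D (P.basis n) = P.highPow lam ρ n • P.embH (P.basis n) := by
      apply P.coords_injective
      funext q
      change P.highPow lam ρ q * _ = _
      simp only [map_smul, Pi.smul_apply, coords_embH, repr_basis, smul_eq_mul]
      split_ifs with h
      · rw [h]
      · simp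
    simp only [ContinuousLinearMap.comp_apply, ContinuousLinearEquiv.coe_coe, hD, map_smul,
      T.onDual_embH, coordCLM_apply, _root_.smul_apply, reprCLM_apply, coords_embH, smul_eq_mul,
      _root_.sub_apply, ContinuousLinearMap.id_apply, lowProj_basis]
    by_cases hn : n ∈ P.low lam
    · rw [P.highPow_of_mem ρ hn, if_pos hn, sub_self, map_zero, map_zero]
      simp
    · rw [P.highPow_of_notMem ρ hn, if_neg hn, sub_zero]
      have h1 := h.eig_mul_repr hp hn
      rw [← sub_eq_zero, ← sub_mul, mul_eq_zero, sub_eq_zero] at h1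
      rcases h1 with h1 | h1
      · simp only [weight, h1]
      · rw [h1, mul_zero, mul_zero]
  have h2 := congrArg (fun f : H →L[ℂ] ℂ => f x) key
  change P.coords (T.onDual (D x)) p = _
  simpa only [ContinuousLinearMap.comp_apply, ContinuousLinearEquiv.coe_coe, coordCLM_apply,
    _root_.smul_apply, reprCLM_apply, smul_eq_mul, _root_.sub_apply,
    ContinuousLinearMap.id_apply] using h2

end Equivalence

section Regularity

variable {P : DiagonalParabolic A} {lam mu s : ℝ} {m : ℕ} {T : P.GLH}
  {K : H →L[ℂ] EuclideanSpace ℂ (Fin m)} {hs : -1 ≤ -s} {B : Fin m → P.Scale (-s)}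

/-- The images under `T` of the low eigenvectors gain one derivative compared with the controls. -/
theorem IsParabolicFEquivalence.repr_onH_basis_mem
    (h : P.IsParabolicFEquivalence lam mu (fun j => P.incl hs (B j)) T K) {r : ℝ} (hr : r ≤ 1 - s)
    (n : ℕ) : (P.basis.repr (T.onH (P.basis n)) : ℕ → ℂ) ∈ P.scaleSubmodule r := by
  refine P.mem_scaleSubmodule_iff.2 (P.summable_div_sub
    (∑ j, K (P.basis n) j • B j) (P.eig n) _ ?_ (by linarith))
  filter_upwards [P.eventually_notMem_low lam] with p hp
  have h1 := h.intertwine (P.basis n)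
  have h2 : P.ext (P.basis n) = P.eig n • P.embH (P.basis n) := by
    apply P.coords_injective
    funext n
    simp only [map_smul, Pi.smul_apply, coords_ext, coords_embH, repr_basis, smul_eq_mul]
    split_ifs with h
    · rw [h]
    · simp
  have h3 : T.onDual (P.control (fun j => P.incl hs (B j)) (K (P.basis n))) =
      P.control (fun j => P.incl hs (B j)) (K (P.basis n)) := by
    simp only [control, map_sum, map_smul, h.fix]
  rw [map_add, h2, h3, map_smul, T.onDual_embH] at h1
  have h4 := congrFun (congrArg P.coords h1) p
  rw [map_add, Pi.add_apply, map_smul, Pi.smul_apply, coords_embH, coords_target,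
    P.targetEig_of_notMem mu hp, smul_eq_mul, coords_control] at h4
  simp only [coords_incl] at h4
  simp only [map_sum, Finset.sum_apply, map_smul, Pi.smul_apply, smul_eq_mul]
  linear_combination -h4

theorem IsParabolicFEquivalence.repr_onH_lowProj_mem
    (h : P.IsParabolicFEquivalence lam mu (fun j => P.incl hs (B j)) T K) {r : ℝ} (hr : r ≤ 1 - s)
    (x : H) : (P.basis.repr (T.onH (P.lowProj lam x)) : ℕ → ℂ) ∈ P.scaleSubmodule r := by
  have h1 : (P.basis.repr (T.onH (P.lowProj lam x)) : ℕ → ℂ) =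
      fun p => ∑ n ∈ (P.finite_low lam).toFinset,
        P.basis.repr x n * P.basis.repr (T.onH (P.basis n)) p := by
    funext p
    rw [lowProj_apply, ← reprCLM_apply, map_sum, map_sum]
    simp only [map_smul, reprCLM_apply, smul_eq_mul]
  rw [h1]
  exact P.mem_scaleSubmodule_columns _ (fun n _ => h.repr_onH_basis_mem hr n) _

theorem mem_scaleSubmodule_congr (P : DiagonalParabolic A) {r : ℝ} {x y : ℕ → ℂ}
    (hx : x ∈ P.scaleSubmodule r) (h : ∀ᶠ n in atTop, y n = x n) : y ∈ P.scaleSubmodule r := by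
  have h1 : y - x ∈ P.scaleSubmodule r :=
    P.mem_scaleSubmodule_of_eventually_eq_zero (by filter_upwards [h] with n hn; simp [hn])
  simpa using Submodule.add_mem _ h1 hx

theorem weight_mul_mem_scaleSubmodule (P : DiagonalParabolic A) {r ρ : ℝ} {x : ℕ → ℂ}
    (hx : x ∈ P.scaleSubmodule r) :
    (fun n => (P.weight (ρ / 2) n : ℂ) * x n) ∈ P.scaleSubmodule (r - ρ) := by
  refine P.mem_scaleSubmodule_iff.2 ((P.mem_scaleSubmodule_iff.1 hx).congr fun n => ?_)
  rw [norm_mul, mul_pow, norm_weight_ofReal, weight_half_sq, ← mul_assoc, ← weight_add,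
    sub_add_cancel]

/-- The element of `H` with a given square-summable coordinate sequence. -/
theorem exists_repr_eq (P : DiagonalParabolic A) {x : ℕ → ℂ} (hx : x ∈ P.scaleSubmodule 0) :
    ∃ y : H, ∀ n, P.basis.repr y n = x n :=
  ⟨P.toScaleZero.symm (P.ofCoords x (P.mem_scaleSubmodule_iff.1 hx)), fun n => by
    rw [repr_toScaleZero_symm, coords_ofCoords]⟩

theorem repr_mem (P : DiagonalParabolic A) (x : H) :
    (P.basis.repr x : ℕ → ℂ) ∈ P.scaleSubmodule 0 :=
  P.mem_scaleSubmodule_iff.2 (by simpa [weight_zero] using P.summable_repr x)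

/-- `T` maps `D_r(A)` to itself, for `-1 ≤ r ≤ 1 - s`. -/
theorem IsParabolicFEquivalence.coords_onDual_mem [CompleteSpace H]
    (h : P.IsParabolicFEquivalence lam mu (fun j => P.incl hs (B j)) T K) {r : ℝ}
    (hr0 : -1 ≤ r) (hr : r ≤ 1 - s) {x : P.Scale (-1)}
    (hx : P.coords x ∈ P.scaleSubmodule r) : P.coords (T.onDual x) ∈ P.scaleSubmodule r := by
  classical
  obtain ⟨y, hy⟩ := P.exists_repr_eq (by
    have := P.weight_mul_mem_scaleSubmodule (ρ := r) hx
    rwa [sub_self] at this)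
  -- `x` is the sum of its low part and of a negative power of `1 + |A|²` applied to `y`
  obtain ⟨z, hz⟩ := P.exists_repr_eq (x := fun n => if n ∈ P.low lam then P.coords x n else 0)
    (P.mem_scaleSubmodule_of_eventually_eq_zero (by
      filter_upwards [P.eventually_notMem_low lam] with n hn
      simp [hn]))
  have hρ : -r / 2 ≤ 1 / 2 := by linarith
  have hx' : x = P.embH (P.lowProj lam z) +
      P.diag (P.highPow lam (-r / 2)) (P.highPow_bound lam hρ) y := by
    apply P.coords_injective
    funext n
    rw [map_add, Pi.add_apply, coords_embH, coords_diag, repr_lowProj, hy, hz]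
    by_cases hn : n ∈ P.low lam
    · simp [hn, P.highPow_of_mem _ hn]
    · rw [if_neg hn, P.highPow_of_notMem _ hn, zero_add, ← mul_assoc, ← Complex.ofReal_mul,
        ← weight_add, neg_div, neg_add_cancel, weight_zero]
      simp
  rw [hx', map_add, map_add]
  refine Submodule.add_mem _ ?_ ?_
  · rw [T.onDual_embH]
    refine P.mem_scaleSubmodule_congr (h.repr_onH_lowProj_mem hr z) (.of_forall fun n => ?_)
    rw [coords_embH]
  · have h1 := P.weight_mul_mem_scaleSubmodule (ρ := -r)
      (P.repr_mem (T.onH (y - P.lowProj lam y)))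
    rw [sub_neg_eq_add, zero_add] at h1
    refine P.mem_scaleSubmodule_congr h1 ?_
    filter_upwards [P.eventually_notMem_low lam] with p hp
    exact h.coords_onDual_highPow hρ hp y

/-- `T⁻¹` maps `D_r(A)` to itself, for `r ≤ 1 - s`. -/
theorem IsParabolicFEquivalence.repr_mem_of_onH [CompleteSpace H]
    (h : P.IsParabolicFEquivalence lam mu (fun j => P.incl hs (B j)) T K) {r : ℝ}
    (hr1 : r ≤ 1) (hr : r ≤ 1 - s) {x : H}
    (hx : (P.basis.repr (T.onH x) : ℕ → ℂ) ∈ P.scaleSubmodule r) :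
    (P.basis.repr x : ℕ → ℂ) ∈ P.scaleSubmodule r := by
  classical
  set y := x - P.lowProj lam x with hy
  have hρ : r / 2 ≤ 1 / 2 := by linarith
  set z := P.diag (P.highPow lam (r / 2)) (P.highPow_bound lam hρ) x with hz
  have h1 : (P.basis.repr (T.onH y) : ℕ → ℂ) ∈ P.scaleSubmodule r := by
    have h2 := Submodule.sub_mem _ hx (h.repr_onH_lowProj_mem hr x)
    refine P.mem_scaleSubmodule_congr h2 (.of_forall fun n => ?_)
    rw [hy, ← reprCLM_apply, map_sub, map_sub]
    simp
  -- `T z` is the same power of `1 + |A|²` applied to `T y`, hence in `H`, and so is `z`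
  have h2 : P.coords (T.onDual z) ∈ P.scaleSubmodule 0 := by
    have h3 := P.weight_mul_mem_scaleSubmodule (ρ := r) h1
    rw [sub_self] at h3
    refine P.mem_scaleSubmodule_congr h3 ?_
    filter_upwards [P.eventually_notMem_low lam] with p hp
    exact h.coords_onDual_highPow hρ hp x
  obtain ⟨w, hw⟩ := P.exists_repr_eq h2
  have h4 : z = P.embH (T.onH.symm w) := by
    apply T.onDual.injective
    rw [T.onDual_embH, ContinuousLinearEquiv.apply_symm_apply]
    apply P.coords_injective
    funext n
    rw [coords_embH, hw]
  have h5 := P.weight_mul_mem_scaleSubmodule (ρ := -r) (P.repr_mem (T.onH.symm w))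
  rw [sub_neg_eq_add, zero_add] at h5
  refine P.mem_scaleSubmodule_congr h5 ?_
  filter_upwards [P.eventually_notMem_low lam] with p hp
  rw [← P.coords_embH (T.onH.symm w), ← h4, hz, coords_diag, P.highPow_of_notMem _ hp, ← mul_assoc,
    ← Complex.ofReal_mul, ← weight_add, neg_div, neg_add_cancel, weight_zero]
  simp

end Regularity

/-- The inclusion `D_r(A) ⊆ H`, `r ≥ 0`. -/
def toH (P : DiagonalParabolic A) {r : ℝ} (hr : 0 ≤ r) : P.Scale r →L[ℂ] H :=
  (P.toScaleZero.symm.toContinuousLinearEquiv : P.Scale 0 →L[ℂ] H).comp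
    ⟨P.incl hr, P.continuous_incl hr⟩

section toH

variable (P : DiagonalParabolic A) {r : ℝ} (hr : 0 ≤ r)

@[simp] theorem repr_toH (x : P.Scale r) (n : ℕ) :
    P.basis.repr (P.toH hr x) n = P.coords x n := by
  change P.basis.repr (P.toScaleZero.symm (P.incl hr x)) n = _
  rw [repr_toScaleZero_symm, coords_incl]

theorem seqNorm_zero_eq_norm_toH (x : P.Scale r) :
    P.seqNorm 0 (P.coords x) = ‖P.toH hr x‖ := by
  rw [seqNorm_zero_coords P hr]
  exact (P.toScaleZero.symm.norm_map _).symm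

theorem memScale_toH (x : P.Scale r) : P.MemScale r (P.toH hr x) := by
  unfold MemScale
  simpa using P.summable_coords x

theorem toScale_toH (x : P.Scale r) : P.toScale r (P.toH hr x) = x := by
  apply P.coords_injective
  rw [P.coords_toScale (P.memScale_toH hr x)]
  funext n
  simp

theorem toH_toScale {x : H} (hx : P.MemScale r x) : P.toH hr (P.toScale r x) = x := by
  refine P.repr_injective fun n => ?_
  rw [repr_toH, P.coords_toScale hx]

theorem toH_injective : Function.Injective (P.toH hr) :=
  Function.LeftInverse.injective (P.toScale_toH hr)

/-- A bounded operator on `H` that preserves `D_r(A)` is bounded there. -/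
theorem exists_clm_of_mapsTo [CompleteSpace H] (g : H →L[ℂ] H)
    (hg : ∀ x, P.MemScale r x → P.MemScale r (g x)) :
    ∃ S : P.Scale r →L[ℂ] P.Scale r, ∀ x, P.toH hr (S x) = g (P.toH hr x) := by
  have hto : ∀ x, P.toH hr (P.toScale r (g (P.toH hr x))) = g (P.toH hr x) :=
    fun x => P.toH_toScale hr (hg _ (P.memScale_toH hr x))
  let f : P.Scale r →ₗ[ℂ] P.Scale r :=
    { toFun := fun x => P.toScale r (g (P.toH hr x))
      map_add' := fun x y => by
        apply P.toH_injective hr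
        rw [hto, map_add (P.toH hr), map_add g, map_add (P.toH hr), hto, hto]
      map_smul' := fun c x => by
        apply P.toH_injective hr
        rw [hto, map_smul (P.toH hr), map_smul g, RingHom.id_apply, map_smul (P.toH hr), hto] }
  have hf : ∀ x, P.toH hr (f x) = g (P.toH hr x) := hto
  refine ⟨⟨f, P.continuous_of_coords f fun n => ?_⟩, hf⟩
  simp only [← repr_toH P hr, hf]
  exact (P.continuous_repr n).comp (g.continuous.comp (P.toH hr).continuous)

end toH

section Extension

variable [CompleteSpace H] {P : DiagonalParabolic A} {lam mu s : ℝ} {m : ℕ} {T : P.GLH}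
  {K : H →L[ℂ] EuclideanSpace ℂ (Fin m)} {hs : -1 ≤ -s} {B : Fin m → P.Scale (-s)}

/-- By the closed graph theorem, `T` restricts to a bounded operator on `D_r(A)`. -/
theorem IsParabolicFEquivalence.exists_clm_onDual
    (h : P.IsParabolicFEquivalence lam mu (fun j => P.incl hs (B j)) T K) {r : ℝ}
    (hr0 : -1 ≤ r) (hr : r ≤ 1 - s) :
    ∃ S : P.Scale r →L[ℂ] P.Scale r, ∀ x, P.incl hr0 (S x) = T.onDual (P.incl hr0 x) := by
  let f : P.Scale r →ₗ[ℂ] P.Scale r :=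
    { toFun := fun x => P.ofCoords (P.coords (T.onDual (P.incl hr0 x)))
        (P.mem_scaleSubmodule_iff.1 (h.coords_onDual_mem hr0 hr
          (P.mem_scaleSubmodule_iff.2 (P.summable_coords x))))
      map_add' := fun x y => by
        apply P.coords_injective
        rw [coords_ofCoords, map_add, map_add, map_add, map_add, coords_ofCoords, coords_ofCoords]
      map_smul' := fun c x => by
        apply P.coords_injective
        rw [coords_ofCoords, map_smul, map_smul, map_smul, map_smul, coords_ofCoords]
        rfl }
  have hf : ∀ x, P.coords (f x) = P.coords (T.onDual (P.incl hr0 x)) :=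
    fun x => P.coords_ofCoords _ _
  refine ⟨⟨f, P.continuous_of_coords f fun n => ?_⟩, fun x => ?_⟩
  · simp only [hf]
    exact (P.continuous_coords (-1) n).comp (T.onDual.continuous.comp (P.continuous_incl hr0))
  · apply P.coords_injective
    rw [coords_incl]
    exact hf x

theorem IsParabolicFEquivalence.memScale_onH
    (h : P.IsParabolicFEquivalence lam mu (fun j => P.incl hs (B j)) T K) {r : ℝ}
    (hr0 : 0 ≤ r) (hr1 : r ≤ 1) (hr : r ≤ 1 - s) (x : H) :
    P.MemScale r (T.onH x) ↔ P.MemScale r x := by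
  constructor
  · intro hx
    exact P.mem_scaleSubmodule_iff.1
      (h.repr_mem_of_onH hr1 hr (P.mem_scaleSubmodule_iff.2 hx))
  · intro hx
    have h1 := h.coords_onDual_mem (by linarith) hr (x := P.embH x) (P.mem_scaleSubmodule_congr
      (P.mem_scaleSubmodule_iff.2 hx) (.of_forall fun n => P.coords_embH x n))
    rw [T.onDual_embH] at h1
    exact P.mem_scaleSubmodule_iff.1 (P.mem_scaleSubmodule_congr h1
      (.of_forall fun n => (P.coords_embH _ n).symm))

end Extension

/-! ### The energy inequality for diagonal systems -/

/-- The squared norm of `D_r(A)` as an extended nonnegative number, on all sequences. -/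
def energy (P : DiagonalParabolic A) (r : ℝ) (x : ℕ → ℂ) : ℝ≥0∞ :=
  ∑' n, ENNReal.ofReal (P.weight r n) * ‖x n‖ₑ ^ 2

theorem ofReal_weight_mul (P : DiagonalParabolic A) (r : ℝ) (n : ℕ) (z : ℂ) :
    ENNReal.ofReal (P.weight r n) * ‖z‖ₑ ^ 2 = ENNReal.ofReal (P.weight r n * ‖z‖ ^ 2) := by
  rw [ENNReal.ofReal_mul (P.weight_pos r n).le, ENNReal.ofReal_pow (norm_nonneg _),
    ofReal_norm]

theorem energy_eq_ofReal (P : DiagonalParabolic A) {r : ℝ} {x : ℕ → ℂ}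
    (hx : Summable fun n => P.weight r n * ‖x n‖ ^ 2) :
    P.energy r x = ENNReal.ofReal (∑' n, P.weight r n * ‖x n‖ ^ 2) := by
  rw [ENNReal.ofReal_tsum_of_nonneg
    (fun n => mul_nonneg (P.weight_pos r n).le (by positivity)) hx]
  simp only [energy, ofReal_weight_mul]

theorem enorm_sq_scale (P : DiagonalParabolic A) {r : ℝ} (x : P.Scale r) :
    ‖x‖ₑ ^ 2 = P.energy r (P.coords x) := by
  rw [P.energy_eq_ofReal (P.summable_coords x), ← norm_sq_eq_tsum,
    ENNReal.ofReal_pow (norm_nonneg _), ofReal_norm]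

theorem enorm_sq_H (P : DiagonalParabolic A) (x : H) :
    ‖x‖ₑ ^ 2 = P.energy 0 (P.basis.repr x) := by
  have h := P.enorm_sq_scale (P.toScaleZero x)
  rw [coords_toScaleZero] at h
  rw [← h, ← ofReal_norm, ← ofReal_norm, P.toScaleZero.norm_map]

theorem energy_mono (P : DiagonalParabolic A) {r r' : ℝ} (h : r' ≤ r) (x : ℕ → ℂ) :
    P.energy r' x ≤ P.energy r x :=
  ENNReal.tsum_le_tsum fun n => by gcongr; exact P.weight_mono h n

theorem mem_scaleSubmodule_iff_energy (P : DiagonalParabolic A) {r : ℝ} {x : ℕ → ℂ} :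
    x ∈ P.scaleSubmodule r ↔ P.energy r x ≠ ∞ := by
  constructor
  · intro h
    rw [P.energy_eq_ofReal (P.mem_scaleSubmodule_iff.1 h)]
    exact ENNReal.ofReal_ne_top
  · intro h
    have h1 := ENNReal.summable_toReal h
    refine P.mem_scaleSubmodule_iff.2 (h1.congr fun n => ?_)
    rw [ofReal_weight_mul, ENNReal.toReal_ofReal
      (mul_nonneg (P.weight_pos r n).le (by positivity))]

theorem enorm_sq_toScale_le (P : DiagonalParabolic A) (r : ℝ) (x : H) :
    ‖P.toScale r x‖ₑ ^ 2 ≤ P.energy r (P.basis.repr x) := by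
  by_cases hx : P.MemScale r x
  · rw [enorm_sq_scale, P.coords_toScale hx]
  · have : P.toScale r x = 0 := dif_neg hx
    simp [this]

/-- Energy inequality for a family of scalar equations `y_n' = τ_n y_n + g_n` with
`-Re τ_n - lam ≥ c (1 + |λ_n|²)^{1/2}`, in the weight `exp (2 lam s)`. -/
theorem energy_le (P : DiagonalParabolic A) {lam c : ℝ} (hc : 0 < c) {τ : ℕ → ℂ}
    (hτ : ∀ n, (τ n).re ≤ -lam - c * P.weight (1 / 2) n) {t : ℝ} (ht : 0 ≤ t)
    {y g : ℕ → ℝ → ℂ} (hyc : ∀ n, ContinuousOn (y n) (Icc 0 t))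
    (hg : ∀ n, IntervalIntegrable (g n) volume 0 t)
    (hy : ∀ n, ∀ s ∈ Icc 0 t, y n s = y n 0 + ∫ r in (0 : ℝ)..s, (τ n * y n r + g n r)) :
    ENNReal.ofReal (Real.exp (2 * lam * t)) * P.energy 0 (fun n => y n t) +
      ENNReal.ofReal c * ∫⁻ s in Ioc 0 t, ENNReal.ofReal (Real.exp (2 * lam * s)) *
        P.energy (1 / 2) (fun n => y n s)
      ≤ P.energy 0 (fun n => y n 0) + ENNReal.ofReal c⁻¹ *
        ∫⁻ s in Ioc 0 t, ENNReal.ofReal (Real.exp (2 * lam * s)) *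
          P.energy (-(1 / 2)) (fun n => g n s) := by
  have hexp : Measurable fun s => ENNReal.ofReal (Real.exp (2 * lam * s)) := by fun_prop
  have hswap : ∀ (r : ℝ) (f : ℕ → ℝ → ℂ),
      (∀ n, AEMeasurable (f n) (volume.restrict (Ioc 0 t))) →
      ∫⁻ s in Ioc 0 t, ENNReal.ofReal (Real.exp (2 * lam * s)) * P.energy r (fun n => f n s) =
        ∑' n, ENNReal.ofReal (P.weight r n) *
          ∫⁻ s in Ioc 0 t, ENNReal.ofReal (Real.exp (2 * lam * s)) * ‖f n s‖ₑ ^ 2 := by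
    intro r f hf
    simp only [energy, ← ENNReal.tsum_mul_left]
    have hm : ∀ n, AEMeasurable (fun s => ENNReal.ofReal (Real.exp (2 * lam * s)) *
        (ENNReal.ofReal (P.weight r n) * ‖f n s‖ₑ ^ 2)) (volume.restrict (Ioc 0 t)) :=
      fun n => hexp.aemeasurable.mul (((hf n).enorm.pow_const 2).const_mul _)
    rw [lintegral_tsum hm]
    refine tsum_congr fun n => ?_
    rw [← lintegral_const_mul' _ _ ENNReal.ofReal_ne_top]
    exact lintegral_congr fun s => by ring
  have hym : ∀ n, AEMeasurable (y n) (volume.restrict (Ioc 0 t)) := fun n =>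
    ((hyc n).mono Ioc_subset_Icc_self).aemeasurable measurableSet_Ioc
  have hgm : ∀ n, AEMeasurable (g n) (volume.restrict (Ioc 0 t)) := fun n =>
    ((intervalIntegrable_iff_integrableOn_Ioc_of_le ht).1 (hg n)).aestronglyMeasurable.aemeasurable
  rw [hswap _ y hym, hswap _ g hgm]
  simp only [energy, ← ENNReal.tsum_mul_left, weight_zero, ENNReal.ofReal_one, one_mul]
  rw [← ENNReal.tsum_add, ← ENNReal.tsum_add]
  refine ENNReal.tsum_le_tsum fun n => ?_
  have hw := P.weight_pos (1 / 2) n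
  have h1 := scalar_energy (lam := lam) (mul_pos hc hw) (hτ n) ht (hyc n) (hg n) (hy n)
  have h2 : P.weight (-(1 / 2)) n = (P.weight (1 / 2) n)⁻¹ :=
    eq_inv_of_mul_eq_one_right (P.weight_mul_weight_neg _ _)
  rw [mul_inv, ENNReal.ofReal_mul hc.le, ENNReal.ofReal_mul (inv_nonneg.2 hc.le), ← h2] at h1
  simpa only [mul_assoc] using h1

/-! ### The linear inhomogeneous problem -/

/-- A function with continuous coordinates and a square-summable bound on them is continuous. -/
theorem continuousOn_of_repr (P : DiagonalParabolic A) {v : ℝ → H} {S : Set ℝ} {b : ℕ → ℝ}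
    (hb : Summable b) (hv : ∀ n, ContinuousOn (fun t => P.basis.repr (v t) n) S)
    (hvb : ∀ t ∈ S, ∀ n, ‖P.basis.repr (v t) n‖ ^ 2 ≤ b n) : ContinuousOn v S := by
  intro t ht
  have hnorm : ∀ s, ‖v s - v t‖ ^ 2 =
      ∑' n, ‖P.basis.repr (v s) n - P.basis.repr (v t) n‖ ^ 2 := by
    intro s
    have h1 := P.norm_sq_eq_tsum (P.toScaleZero (v s - v t))
    rw [P.toScaleZero.norm_map] at h1
    rw [h1]
    refine tsum_congr fun n => ?_
    rw [weight_zero, one_mul, coords_toScaleZero, map_sub]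
    rfl
  have hlim : Tendsto (fun s => ‖v s - v t‖ ^ 2) (𝓝[S] t) (𝓝 0) := by
    simp only [hnorm]
    have h0 : (0 : ℝ) = ∑' _ : ℕ, 0 := by simp
    rw [h0]
    refine tendsto_tsum_of_dominated_convergence (bound := fun n => 4 * b n) (hb.mul_left 4)
      (fun n => ?_) ?_
    · have h2 := (((hv n) t ht).tendsto.sub_const (P.basis.repr (v t) n)).norm.pow 2
      simpa using h2
    · filter_upwards [self_mem_nhdsWithin] with s hs n
      have h3 := norm_sub_le (P.basis.repr (v s) n) (P.basis.repr (v t) n)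
      have h4 := hvb s hs n
      have h5 := hvb t ht n
      rw [Real.norm_of_nonneg (by positivity)]
      calc _ ≤ (‖P.basis.repr (v s) n‖ + ‖P.basis.repr (v t) n‖) ^ 2 := by gcongr
        _ ≤ 4 * b n := by
          nlinarith [sq_nonneg (‖P.basis.repr (v s) n‖ - ‖P.basis.repr (v t) n‖)]
  rw [ContinuousWithinAt, tendsto_iff_norm_sub_tendsto_zero]
  have h6 := hlim.sqrt
  simpa [Real.sqrt_sq (norm_nonneg _)] using h6

/-- `v ∈ C([0,∞); H)` solves `v_n' = τ_n v_n + g_n` in integrated form for all `n`. -/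
structure IsLinearSolution (P : DiagonalParabolic A) (τ : ℕ → ℂ) (g : ℝ → P.Scale (-(1 / 2)))
    (v : ℝ → H) : Prop where
  continuousOn : ContinuousOn v (Ici 0)
  integrable : ∀ n t, 0 ≤ t → IntervalIntegrable (fun s => P.coords (g s) n) volume 0 t
  equation : ∀ n t, 0 ≤ t → P.basis.repr (v t) n = P.basis.repr (v 0) n +
    ∫ s in (0 : ℝ)..t, (τ n * P.basis.repr (v s) n + P.coords (g s) n)

section Linear

variable {P : DiagonalParabolic A} {τ : ℕ → ℂ} {g g' : ℝ → P.Scale (-(1 / 2))} {v v' : ℝ → H}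

theorem IsLinearSolution.continuousOn_repr (h : P.IsLinearSolution τ g v) (n : ℕ) (t : ℝ) :
    ContinuousOn (fun s => P.basis.repr (v s) n) (Icc 0 t) :=
  (P.continuous_repr n).comp_continuousOn (h.continuousOn.mono Icc_subset_Ici_self)

theorem repr_sub_apply (P : DiagonalParabolic A) (x y : H) (n : ℕ) :
    P.basis.repr (x - y) n = P.basis.repr x n - P.basis.repr y n := by
  rw [map_sub]
  rfl

theorem IsLinearSolution.sub (h : P.IsLinearSolution τ g v) (h' : P.IsLinearSolution τ g' v') :
    P.IsLinearSolution τ (fun s => g s - g' s) (fun s => v s - v' s) where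
  continuousOn := h.continuousOn.sub h'.continuousOn
  integrable n t ht := ((h.integrable n t ht).sub (h'.integrable n t ht)).congr fun s _ => by simp
  equation n t ht := by
    have hi : ∀ {g : ℝ → P.Scale (-(1 / 2))} {v : ℝ → H}, P.IsLinearSolution τ g v →
        IntervalIntegrable (fun r => τ n * P.basis.repr (v r) n + P.coords (g r) n)
          volume 0 t := fun h =>
      (ContinuousOn.intervalIntegrable (by
        rw [uIcc_of_le ht]
        exact continuousOn_const.mul (h.continuousOn_repr n t))).add (h.integrable n t ht)
    rw [repr_sub_apply, repr_sub_apply, h.equation n t ht, h'.equation n t ht, add_sub_add_comm,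
      ← intervalIntegral.integral_sub (hi h) (hi h')]
    congr 1
    refine intervalIntegral.integral_congr fun r _ => ?_
    simp only [repr_sub_apply]
    rw [map_sub, Pi.sub_apply]
    ring

/-- The energy inequality on a bounded interval. -/
theorem IsLinearSolution.energy_le (h : P.IsLinearSolution τ g v) {lam c : ℝ} (hc : 0 < c)
    (hτ : ∀ n, (τ n).re ≤ -lam - c * P.weight (1 / 2) n) {t : ℝ} (ht : 0 ≤ t) :
    ENNReal.ofReal (Real.exp (2 * lam * t)) * ‖v t‖ₑ ^ 2 +
      ENNReal.ofReal c * ∫⁻ s in Ioc 0 t, ENNReal.ofReal (Real.exp (2 * lam * s)) *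
        P.energy (1 / 2) (P.basis.repr (v s))
      ≤ ‖v 0‖ₑ ^ 2 + ENNReal.ofReal c⁻¹ *
        ∫⁻ s in Ioc 0 t, ENNReal.ofReal (Real.exp (2 * lam * s)) * ‖g s‖ₑ ^ 2 := by
  have key := P.energy_le hc hτ ht (y := fun n s => P.basis.repr (v s) n)
    (g := fun n s => P.coords (g s) n) (fun n => h.continuousOn_repr n t)
    (fun n => h.integrable n t ht) (fun n s hs => h.equation n s hs.1)
  simpa only [← enorm_sq_H, ← enorm_sq_scale] using key

/-- The energy inequality on the half-line. -/
theorem IsLinearSolution.energy_le_Ioi (h : P.IsLinearSolution τ g v) {c : ℝ} (hc : 0 < c)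
    (hτ : ∀ n, (τ n).re ≤ -0 - c * P.weight (1 / 2) n) :
    (∀ t, 0 ≤ t → ‖v t‖ₑ ^ 2 ≤
      ‖v 0‖ₑ ^ 2 + ENNReal.ofReal c⁻¹ * ∫⁻ s in Ioi 0, ‖g s‖ₑ ^ 2) ∧
    ENNReal.ofReal c * ∫⁻ s in Ioi 0, P.energy (1 / 2) (P.basis.repr (v s)) ≤
      ‖v 0‖ₑ ^ 2 + ENNReal.ofReal c⁻¹ * ∫⁻ s in Ioi 0, ‖g s‖ₑ ^ 2 := by
  have key : ∀ t, 0 ≤ t → ‖v t‖ₑ ^ 2 +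
      ENNReal.ofReal c * ∫⁻ s in Ioc 0 t, P.energy (1 / 2) (P.basis.repr (v s)) ≤
      ‖v 0‖ₑ ^ 2 + ENNReal.ofReal c⁻¹ * ∫⁻ s in Ioi 0, ‖g s‖ₑ ^ 2 := by
    intro t ht
    have h1 := h.energy_le hc hτ ht
    simp only [mul_zero, zero_mul, Real.exp_zero, ENNReal.ofReal_one, one_mul] at h1
    refine h1.trans ?_
    gcongr
    exact Ioc_subset_Ioi_self
  refine ⟨fun t ht => le_self_add.trans (key t ht), ?_⟩
  have hU : Ioi (0 : ℝ) = ⋃ k : ℕ, Ioc 0 (k : ℝ) := by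
    ext x
    simp only [mem_Ioi, mem_iUnion, mem_Ioc]
    exact ⟨fun hx => let ⟨k, hk⟩ := exists_nat_ge x; ⟨k, hx, hk⟩, fun ⟨_, hx, _⟩ => hx⟩
  have hdir : Directed (· ⊆ ·) fun k : ℕ => Ioc 0 (k : ℝ) :=
    (monotone_nat_of_le_succ fun k => Ioc_subset_Ioc_right (by push_cast; linarith)).directed_le
  conv_lhs => rw [hU]
  rw [setLIntegral_iUnion_of_directed _ hdir, ENNReal.mul_iSup]
  exact iSup_le fun k => le_add_self.trans (key k (Nat.cast_nonneg k))

/-- Solvability of the linear inhomogeneous problem for `g ∈ L²((0,∞); D_{-1/2}(A))`. -/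
theorem exists_isLinearSolution (P : DiagonalParabolic A) {τ : ℕ → ℂ} {c : ℝ} (hc : 0 < c)
    (hτ : ∀ n, (τ n).re ≤ -0 - c * P.weight (1 / 2) n) (v₀ : H) {g : ℝ → P.Scale (-(1 / 2))}
    (hg : MemLp g 2 (volume.restrict (Ioi (0 : ℝ)))) :
    ∃ v : ℝ → H, P.IsLinearSolution τ g v ∧ v 0 = v₀ := by
  have hint : ∀ n t, 0 ≤ t → IntervalIntegrable (fun s => P.coords (g s) n) volume 0 t := by
    intro n t ht
    rw [intervalIntegrable_iff_integrableOn_Ioc_of_le ht]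
    have h1 : IntegrableOn g (Ioc 0 t) :=
      (hg.mono_measure (Measure.restrict_mono Ioc_subset_Ioi_self le_rfl)).integrable (by norm_num)
    exact (P.coordCLM _ n).integrable_comp h1
  have hgfin : ∫⁻ s in Ioi 0, ‖g s‖ₑ ^ 2 ≠ ∞ := by
    have h1 := lintegral_rpow_enorm_lt_top_of_eLpNorm_lt_top (by norm_num) (by norm_num)
      hg.eLpNorm_lt_top
    exact (by simpa using h1 : ∫⁻ s in Ioi 0, ‖g s‖ₑ ^ 2 < ∞).ne
  set y : ℕ → ℝ → ℂ := fun n s => Complex.exp (τ n * s) *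
    (P.basis.repr v₀ n + ∫ r in (0 : ℝ)..s, Complex.exp (-τ n * r) * P.coords (g r) n) with hy
  have hyd : ∀ n t, 0 ≤ t → ContinuousOn (y n) (uIcc 0 t) ∧
      y n t = P.basis.repr v₀ n + ∫ s in (0 : ℝ)..t, (τ n * y n s + P.coords (g s) n) :=
    fun n t ht => duhamel_eq (τ n) (P.basis.repr v₀ n) (hint n t ht) fun s => rfl
  have hyc : ∀ n t, 0 ≤ t → ContinuousOn (y n) (Icc 0 t) := fun n t ht =>
    uIcc_of_le ht ▸ (hyd n t ht).1
  have hy0 : ∀ n, y n 0 = P.basis.repr v₀ n := fun n => by simp [hy]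
  -- a bound on the coordinates that is uniform in time
  set b : ℕ → ℝ≥0∞ := fun n => ‖P.basis.repr v₀ n‖ₑ ^ 2 +
    ENNReal.ofReal c⁻¹ * ∫⁻ s in Ioi 0,
      ENNReal.ofReal (P.weight (-(1 / 2)) n) * ‖P.coords (g s) n‖ₑ ^ 2 with hb
  have hbound : ∀ n t, 0 ≤ t → ‖y n t‖ₑ ^ 2 ≤ b n := by
    intro n t ht
    have hw := P.weight_pos (1 / 2) n
    have h1 := scalar_energy (mul_pos hc hw) (hτ n) ht (hyc n t ht) (hint n t ht)
      fun s hs => by rw [hy0]; exact (hyd n s hs.1).2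
    simp only [mul_zero, zero_mul, Real.exp_zero, ENNReal.ofReal_one, one_mul, hy0] at h1
    have h2 : P.weight (-(1 / 2)) n = (P.weight (1 / 2) n)⁻¹ :=
      eq_inv_of_mul_eq_one_right (P.weight_mul_weight_neg _ _)
    refine (le_self_add.trans h1).trans ?_
    rw [mul_inv, ENNReal.ofReal_mul (inv_nonneg.2 hc.le), ← h2, mul_assoc,
      ← lintegral_const_mul' _ _ ENNReal.ofReal_ne_top]
    simp only [hb]
    gcongr
    exact Ioc_subset_Ioi_self
  have hbsum : ∑' n, b n ≠ ∞ := by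
    rw [hb, ENNReal.tsum_add, ENNReal.tsum_mul_left, ← lintegral_tsum]
    · have h1 : ∀ s, ∑' n, ENNReal.ofReal (P.weight (-(1 / 2)) n) * ‖P.coords (g s) n‖ₑ ^ 2 =
          ‖g s‖ₑ ^ 2 := fun s => (P.enorm_sq_scale (g s)).symm
      have h2 : ∑' n, ‖P.basis.repr v₀ n‖ₑ ^ 2 = ‖v₀‖ₑ ^ 2 := by
        rw [enorm_sq_H P]
        simp [energy, weight_zero]
      simp only [h1, h2]
      exact ENNReal.add_ne_top.2 ⟨by simp, ENNReal.mul_ne_top ENNReal.ofReal_ne_top hgfin⟩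
    · intro n
      exact (((P.continuous_coords _ n).comp_aestronglyMeasurable
        hg.aestronglyMeasurable).enorm.pow_const 2).const_mul _
  have hmem : ∀ t, 0 ≤ t → (fun n => y n t) ∈ P.scaleSubmodule 0 := by
    intro t ht
    rw [mem_scaleSubmodule_iff_energy]
    refine ne_top_of_le_ne_top hbsum (ENNReal.tsum_le_tsum fun n => ?_)
    rw [weight_zero, ENNReal.ofReal_one, one_mul]
    exact hbound n t ht
  choose! v hv using fun (t : ℝ) (ht : 0 ≤ t) => P.exists_repr_eq (hmem t ht)
  have hvc : ContinuousOn v (Ici 0) := by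
    refine P.continuousOn_of_repr (ENNReal.summable_toReal hbsum) (fun n => ?_) fun t ht n => ?_
    · refine continuousOn_Ici_of_Icc fun t ht => (hyc n t ht).congr fun s hs => hv s hs.1 n
    · rw [hv t ht n]
      have h1 := hbound n t ht
      have h2 : b n ≠ ∞ := ENNReal.ne_top_of_tsum_ne_top hbsum n
      rw [← ofReal_norm, ← ENNReal.ofReal_pow (norm_nonneg _)] at h1
      exact (ENNReal.ofReal_le_iff_le_toReal h2).1 h1
  refine ⟨v, ⟨hvc, hint, fun n t ht => ?_⟩, P.repr_injective fun n => by
    rw [hv 0 le_rfl n, hy0]⟩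
  rw [hv t ht n, hv 0 le_rfl n, hy0, (hyd n t ht).2]
  congr 1
  refine intervalIntegral.integral_congr fun s hs => ?_
  rw [uIcc_of_le ht] at hs
  simp only [hv s hs.1 n]

end Linear

/-! ### Decay and uniqueness for the diagonal system -/

/-- `u ∈ C_b([0,∞); H) ∩ L²((0,∞); D_γ(A))` solves `∂_t u = R(u)`, `u(0) = u₀`, in integrated form
in `D(A)'`, for an arbitrary right-hand side `R`. -/
structure SolvesWith (P : DiagonalParabolic A) (γ : ℝ) (R : H → P.Scale (-1)) (u₀ : H)
    (u : ℝ → H) : Prop where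
  continuousOn : ContinuousOn u (Ici 0)
  bounded : ∃ M : ℝ, ∀ t, 0 ≤ t → ‖u t‖ ≤ M
  ae_mem : ∀ᵐ t ∂volume.restrict (Ioi (0 : ℝ)), P.MemScale γ (u t)
  memLp : MemLp (fun t => P.toScale γ (u t)) 2 (volume.restrict (Ioi (0 : ℝ)))
  initial : u 0 = u₀
  integrable : ∀ t, 0 ≤ t → IntervalIntegrable (fun τ => R (u τ)) volume 0 t
  equation : ∀ t, 0 ≤ t → P.embH (u t) = P.embH u₀ + ∫ τ in (0 : ℝ)..t, R (u τ)

/-- The right-hand side `(τ_n x_n)_n + G(x)` of a semilinear equation with diagonal linear part. -/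
def diagRhs (P : DiagonalParabolic A) {γ : ℝ} (τ : ℕ → ℂ)
    (hτ : ∃ c : ℝ, ∀ n, ‖τ n‖ ^ 2 ≤ c * (1 + ‖P.eig n‖ ^ 2))
    (G : P.Scale γ → P.Scale (-(1 / 2))) (x : H) : P.Scale (-1) :=
  P.diag τ hτ x + P.incl (by norm_num) (G (P.toScale γ x))

/-- On the ball of radius `ρ` of `H` the map `G` is bounded by `ε ‖x‖`, and its increments by
`κ (‖x‖ + ‖y‖) ‖x - y‖_H + ε ‖x - y‖`, where `‖·‖` is the norm of `D_γ(A)`. -/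
def SmallOnBall (P : DiagonalParabolic A) {γ : ℝ} (hγ : 0 ≤ γ) (κ ε ρ : ℝ)
    (G : P.Scale γ → P.Scale (-(1 / 2))) : Prop :=
  ∀ x y : P.Scale γ, ‖P.toH hγ x‖ ≤ ρ → ‖P.toH hγ y‖ ≤ ρ →
    ‖G x‖ ≤ ε * ‖x‖ ∧
    ‖G x - G y‖ ≤ κ * (‖x‖ + ‖y‖) * ‖P.toH hγ (x - y)‖ + ε * ‖x - y‖

section Diagonal

variable {P : DiagonalParabolic A} {γ : ℝ} {τ : ℕ → ℂ}
  {hτb : ∃ c : ℝ, ∀ n, ‖τ n‖ ^ 2 ≤ c * (1 + ‖P.eig n‖ ^ 2)}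
  {G : P.Scale γ → P.Scale (-(1 / 2))} {v₀ w₀ : H} {v w : ℝ → H}

theorem norm_toH_toScale_le (P : DiagonalParabolic A) (hγ : 0 ≤ γ) (x : H) :
    ‖P.toH hγ (P.toScale γ x)‖ ≤ ‖x‖ := by
  by_cases hx : P.MemScale γ x
  · rw [P.toH_toScale hγ hx]
  · have : P.toScale γ x = 0 := dif_neg hx
    simp [this]

theorem SolvesWith.isLinearSolution (h : P.SolvesWith γ (P.diagRhs τ hτb G) v₀ v) :
    P.IsLinearSolution τ (fun s => G (P.toScale γ (v s))) v where
  continuousOn := h.continuousOn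
  integrable n t ht := by
    have h1 : IntervalIntegrable (fun s => P.coordCLM (-1) n (P.diagRhs τ hτb G (v s)))
        volume 0 t :=
      ⟨(P.coordCLM (-1) n).integrable_comp (h.integrable t ht).1,
        (P.coordCLM (-1) n).integrable_comp (h.integrable t ht).2⟩
    have h2 : IntervalIntegrable (fun s => τ n * P.basis.repr (v s) n) volume 0 t := by
      apply ContinuousOn.intervalIntegrable
      rw [uIcc_of_le ht]
      exact continuousOn_const.mul
        ((P.continuous_repr n).comp_continuousOn (h.continuousOn.mono Icc_subset_Ici_self))
    refine (h1.sub h2).congr fun s _ => ?_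
    simp [diagRhs]
  equation n t ht := by
    have h1 := congrArg (P.coordCLM (-1) n) (h.equation t ht)
    rw [map_add, ← (P.coordCLM (-1) n).intervalIntegral_comp_comm (h.integrable t ht)] at h1
    simp only [coordCLM_apply, coords_embH, diagRhs, map_add, coords_diag, coords_incl] at h1
    rw [h1, h.initial]

theorem SolvesWith.lintegral_lt_top {R : H → P.Scale (-1)} (h : P.SolvesWith γ R v₀ v) :
    ∫⁻ s in Ioi (0 : ℝ), ‖P.toScale γ (v s)‖ₑ ^ 2 < ∞ := by
  have h1 := lintegral_rpow_enorm_lt_top_of_eLpNorm_lt_top (by norm_num) (by norm_num)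
    h.memLp.eLpNorm_lt_top
  simpa using h1

/-- Solutions of the diagonal system that stay in the ball of radius `ρ` decay exponentially. -/
theorem SolvesWith.norm_le_exp (h : P.SolvesWith γ (P.diagRhs τ hτb G) v₀ v) {lam c : ℝ}
    (hlam : 0 ≤ lam) (hc : 0 < c) (hτ : ∀ n, (τ n).re ≤ -lam - c * P.weight (1 / 2) n)
    (hγ : 0 ≤ γ) (hγ' : γ ≤ 1 / 2) {κ ε ρ : ℝ} (hεc : ε ≤ c)
    (hG : P.SmallOnBall hγ κ ε ρ G) {t : ℝ} (ht : 0 ≤ t) (hρ : ∀ s ∈ Icc 0 t, ‖v s‖ ≤ ρ) :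
    ‖v t‖ ≤ Real.exp (-lam * t) * ‖v₀‖ := by
  have key := h.isLinearSolution.energy_le hc hτ ht
  rw [h.initial] at key
  set X := ∫⁻ s in Ioc 0 t, ENNReal.ofReal (Real.exp (2 * lam * s)) *
    P.energy (1 / 2) (P.basis.repr (v s)) with hX
  set Y := ∫⁻ s in Ioc 0 t, ENNReal.ofReal (Real.exp (2 * lam * s)) *
    ‖G (P.toScale γ (v s))‖ₑ ^ 2 with hY
  have hpt : ∀ s ∈ Ioc 0 t, ‖G (P.toScale γ (v s))‖ₑ ^ 2 ≤
      ENNReal.ofReal (c * c) * ‖P.toScale γ (v s)‖ₑ ^ 2 := by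
    intro s hs
    have h1 := (P.norm_toH_toScale_le hγ (v s)).trans (hρ s (Ioc_subset_Icc_self hs))
    have h2 : ‖G (P.toScale γ (v s))‖ ≤ c * ‖P.toScale γ (v s)‖ :=
      (hG _ _ h1 h1).1.trans (by gcongr)
    rw [← ofReal_norm, ← ofReal_norm, ← ENNReal.ofReal_pow (norm_nonneg _),
      ← ENNReal.ofReal_pow (norm_nonneg _), ← ENNReal.ofReal_mul (by positivity)]
    refine ENNReal.ofReal_le_ofReal ?_
    calc _ ≤ (c * ‖P.toScale γ (v s)‖) ^ 2 := by gcongr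
      _ = _ := by ring
  have hYX : ENNReal.ofReal c⁻¹ * Y ≤ ENNReal.ofReal c * X := by
    have h1 : Y ≤ ENNReal.ofReal (c * c) * X := by
      rw [hX, ← lintegral_const_mul' _ _ ENNReal.ofReal_ne_top]
      refine setLIntegral_mono' measurableSet_Ioc fun s hs => ?_
      rw [mul_left_comm]
      gcongr
      refine (hpt s hs).trans ?_
      gcongr
      exact (P.enorm_sq_toScale_le γ _).trans (P.energy_mono hγ' _)
    calc ENNReal.ofReal c⁻¹ * Y ≤ ENNReal.ofReal c⁻¹ * (ENNReal.ofReal (c * c) * X) := by gcongr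
      _ = _ := by
        rw [← mul_assoc, ← ENNReal.ofReal_mul (by positivity)]
        congr 2
        field_simp
  have hYfin : Y ≠ ∞ := by
    refine ne_top_of_le_ne_top (b := ENNReal.ofReal (Real.exp (2 * lam * t)) *
      (ENNReal.ofReal (c * c) * ∫⁻ s in Ioi (0 : ℝ), ‖P.toScale γ (v s)‖ₑ ^ 2))
      (ENNReal.mul_ne_top ENNReal.ofReal_ne_top
        (ENNReal.mul_ne_top ENNReal.ofReal_ne_top h.lintegral_lt_top.ne)) ?_
    rw [hY, ← lintegral_const_mul' _ _ ENNReal.ofReal_ne_top,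
      ← lintegral_const_mul' _ _ ENNReal.ofReal_ne_top]
    refine (setLIntegral_mono' measurableSet_Ioc fun s hs => ?_).trans
      (lintegral_mono_set Ioc_subset_Ioi_self)
    gcongr
    · exact hs.2
    · exact hpt s hs
  have hXfin : ENNReal.ofReal c * X ≠ ∞ := by
    refine ne_top_of_le_ne_top ?_ (le_add_self.trans key)
    refine ENNReal.add_ne_top.2 ⟨by simp, ENNReal.mul_ne_top ENNReal.ofReal_ne_top hYfin⟩
  have hfinal : ENNReal.ofReal (Real.exp (2 * lam * t)) * ‖v t‖ₑ ^ 2 ≤ ‖v₀‖ₑ ^ 2 :=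
    (ENNReal.add_le_add_iff_right hXfin).1 (key.trans (by gcongr))
  rw [← ofReal_norm, ← ofReal_norm, ← ENNReal.ofReal_pow (norm_nonneg _),
    ← ENNReal.ofReal_pow (norm_nonneg _), ← ENNReal.ofReal_mul (by positivity),
    ENNReal.ofReal_le_ofReal_iff (by positivity)] at hfinal
  have h1 : (Real.exp (lam * t) * ‖v t‖) ^ 2 ≤ ‖v₀‖ ^ 2 := by
    rw [mul_pow, ← Real.exp_nat_mul]
    convert hfinal using 3
    push_cast
    ring
  have h2 := (pow_le_pow_iff_left₀ (by positivity) (norm_nonneg _) two_ne_zero).1 h1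
  rw [neg_mul, Real.exp_neg, inv_mul_eq_div, le_div_iff₀ (Real.exp_pos _), mul_comm]
  exact h2

/-- Two solutions of the diagonal system with the same initial value that both stay in the ball of
radius `ρ` coincide. -/
theorem SolvesWith.eqOn_of_small (hv : P.SolvesWith γ (P.diagRhs τ hτb G) v₀ v)
    (hw : P.SolvesWith γ (P.diagRhs τ hτb G) v₀ w) {c : ℝ}
    (hc : 0 < c) (hτ : ∀ n, (τ n).re ≤ -0 - c * P.weight (1 / 2) n)
    (hγ : 0 ≤ γ) (hγ' : γ ≤ 1 / 2) {κ ε ρ : ℝ} (hκ : 0 ≤ κ) (hε : 0 ≤ ε) (hεc : ε ≤ c / 2)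
    (hG : P.SmallOnBall hγ κ ε ρ G) {t : ℝ}
    (hvρ : ∀ s ∈ Icc 0 t, ‖v s‖ ≤ ρ) (hwρ : ∀ s ∈ Icc 0 t, ‖w s‖ ≤ ρ) :
    ∀ s ∈ Icc 0 t, v s = w s := by
  obtain ⟨Mv, hMv⟩ := hv.bounded
  obtain ⟨Mw, hMw⟩ := hw.bounded
  set N : ℝ → ℝ≥0∞ := fun s =>
    2 * (‖P.toScale γ (v s)‖ₑ ^ 2 + ‖P.toScale γ (w s)‖ₑ ^ 2) with hN
  have hsq : ∀ a b : ℝ≥0∞, (a + b) ^ 2 ≤ 2 * (a ^ 2 + b ^ 2) := by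
    intro a b
    have := ENNReal.rpow_add_le_mul_rpow_add_rpow a b (p := 2) (by norm_num)
    norm_num at this
    exact_mod_cast this
  have hNfin : ∫⁻ s in Ioi (0 : ℝ), N s ≠ ∞ := by
    have hm : AEMeasurable (fun s => ‖P.toScale γ (v s)‖ₑ ^ 2) (volume.restrict (Ioi (0 : ℝ))) :=
      hv.memLp.aestronglyMeasurable.enorm.pow_const 2
    rw [hN]
    simp only
    rw [lintegral_const_mul' _ _ (by simp), lintegral_add_left' hm]
    exact ENNReal.mul_ne_top (by simp) (ENNReal.add_ne_top.2
      ⟨hv.lintegral_lt_top.ne, hw.lintegral_lt_top.ne⟩)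
  have hNt : ∀ T, ∫⁻ s in Ioc 0 T, N s ≠ ∞ := fun T =>
    ne_top_of_le_ne_top hNfin (lintegral_mono_set Ioc_subset_Ioi_self)
  set a : ℝ≥0∞ := ENNReal.ofReal c⁻¹ * (2 * ENNReal.ofReal κ ^ 2) with ha
  have main := eq_zero_of_le_lintegral (φ := fun s => ‖v s - w s‖ₑ ^ 2)
    (h := fun s => a * N s) (T := t) (C := ENNReal.ofReal (Mv + Mw) ^ 2) (by simp) ?_ ?_ ?_
  · intro s hs
    have h1 := main s hs
    simpa [sub_eq_zero] using h1
  · intro s hs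
    gcongr
    rw [← ofReal_norm]
    exact ENNReal.ofReal_le_ofReal ((norm_sub_le _ _).trans (add_le_add (hMv s hs.1) (hMw s hs.1)))
  · rw [lintegral_const_mul' _ _ (by simp [ha, ENNReal.mul_eq_top])]
    exact ENNReal.mul_ne_top (by simp [ha, ENNReal.mul_eq_top]) (hNt t)
  · intro T hT
    have hTt : Icc 0 T ⊆ Icc 0 t := Icc_subset_Icc_right hT.2
    have key := (hv.isLinearSolution.sub hw.isLinearSolution).energy_le hc hτ hT.1
    simp only [hv.initial, hw.initial, sub_self, mul_zero, zero_mul, Real.exp_zero,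
      ENNReal.ofReal_one, one_mul] at key
    simp only [enorm_zero, ne_eq, OfNat.ofNat_ne_zero, not_false_eq_true, zero_pow, zero_add]
      at key
    set X := ∫⁻ s in Ioc 0 T, P.energy (1 / 2) (P.basis.repr (v s - w s)) with hX
    set Y := ∫⁻ s in Ioc 0 T, ‖G (P.toScale γ (v s)) - G (P.toScale γ (w s))‖ₑ ^ 2 with hY
    have hYfin : Y ≠ ∞ := by
      refine ne_top_of_le_ne_top (b := ENNReal.ofReal ε ^ 2 * ∫⁻ s in Ioc 0 T, N s)
        (ENNReal.mul_ne_top (by simp) (hNt T)) ?_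
      rw [hY, ← lintegral_const_mul' _ _ (by simp)]
      refine setLIntegral_mono' measurableSet_Ioc fun s hs => ?_
      have hs' := hTt (Ioc_subset_Icc_self hs)
      have h1 := (hG _ _ ((P.norm_toH_toScale_le hγ (v s)).trans (hvρ s hs'))
        ((P.norm_toH_toScale_le hγ (v s)).trans (hvρ s hs'))).1
      have h2 := (hG _ _ ((P.norm_toH_toScale_le hγ (w s)).trans (hwρ s hs'))
        ((P.norm_toH_toScale_le hγ (w s)).trans (hwρ s hs'))).1
      have h3 : ‖G (P.toScale γ (v s)) - G (P.toScale γ (w s))‖ₑ ≤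
          ENNReal.ofReal ε * (‖P.toScale γ (v s)‖ₑ + ‖P.toScale γ (w s)‖ₑ) := by
        rw [← ofReal_norm, ← ofReal_norm, ← ofReal_norm,
          ← ENNReal.ofReal_add (norm_nonneg _) (norm_nonneg _), ← ENNReal.ofReal_mul hε]
        refine ENNReal.ofReal_le_ofReal ((norm_sub_le _ _).trans ?_)
        linarith
      calc _ ≤ (ENNReal.ofReal ε * (‖P.toScale γ (v s)‖ₑ + ‖P.toScale γ (w s)‖ₑ)) ^ 2 := by gcongr
        _ = ENNReal.ofReal ε ^ 2 * (‖P.toScale γ (v s)‖ₑ + ‖P.toScale γ (w s)‖ₑ) ^ 2 := by ring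
        _ ≤ _ := by gcongr; exact hsq _ _
    have hYX : Y ≤ (∫⁻ s in Ioc 0 T, 2 * ENNReal.ofReal κ ^ 2 * (N s * ‖v s - w s‖ₑ ^ 2)) +
        ENNReal.ofReal (c * c) * X := by
      rw [hY, hX, ← lintegral_const_mul' _ _ ENNReal.ofReal_ne_top]
      refine le_trans ?_ (lintegral_add_left' ?_ _).le
      · refine lintegral_mono_ae ?_
        have hae : ∀ᵐ s ∂volume.restrict (Ioc 0 T), P.MemScale γ (v s) ∧ P.MemScale γ (w s) :=
          (ae_mono (Measure.restrict_mono Ioc_subset_Ioi_self le_rfl))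
            (hv.ae_mem.and hw.ae_mem)
        filter_upwards [hae, ae_restrict_mem measurableSet_Ioc] with s hmem hs
        have hs' := hTt (Ioc_subset_Icc_self hs)
        have h1 := (hG _ _ ((P.norm_toH_toScale_le hγ (v s)).trans (hvρ s hs'))
          ((P.norm_toH_toScale_le hγ (w s)).trans (hwρ s hs'))).2
        rw [map_sub, P.toH_toScale hγ hmem.1, P.toH_toScale hγ hmem.2] at h1
        have h2 : ‖P.toScale γ (v s) - P.toScale γ (w s)‖ₑ ^ 2 ≤
            P.energy (1 / 2) (P.basis.repr (v s - w s)) := by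
          rw [enorm_sq_scale, map_sub, P.coords_toScale hmem.1, P.coords_toScale hmem.2]
          refine le_trans (le_of_eq ?_) (P.energy_mono hγ' _)
          congr 1
          funext n
          exact (P.repr_sub_apply _ _ n).symm
        have h3 : ‖G (P.toScale γ (v s)) - G (P.toScale γ (w s))‖ₑ ≤
            ENNReal.ofReal κ * (‖P.toScale γ (v s)‖ₑ + ‖P.toScale γ (w s)‖ₑ) * ‖v s - w s‖ₑ +
            ENNReal.ofReal ε * ‖P.toScale γ (v s) - P.toScale γ (w s)‖ₑ := by
          simp only [← ofReal_norm]
          rw [← ENNReal.ofReal_add (norm_nonneg _) (norm_nonneg _), ← ENNReal.ofReal_mul hκ,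
            ← ENNReal.ofReal_mul (by positivity), ← ENNReal.ofReal_mul hε,
            ← ENNReal.ofReal_add (by positivity) (by positivity)]
          exact ENNReal.ofReal_le_ofReal h1
        calc _ ≤ (ENNReal.ofReal κ * (‖P.toScale γ (v s)‖ₑ + ‖P.toScale γ (w s)‖ₑ) *
                ‖v s - w s‖ₑ +
              ENNReal.ofReal ε * ‖P.toScale γ (v s) - P.toScale γ (w s)‖ₑ) ^ 2 := by gcongr
          _ ≤ 2 * ((ENNReal.ofReal κ * (‖P.toScale γ (v s)‖ₑ + ‖P.toScale γ (w s)‖ₑ) *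
                ‖v s - w s‖ₑ) ^ 2 +
              (ENNReal.ofReal ε * ‖P.toScale γ (v s) - P.toScale γ (w s)‖ₑ) ^ 2) := hsq _ _
          _ = 2 * ENNReal.ofReal κ ^ 2 * ((‖P.toScale γ (v s)‖ₑ + ‖P.toScale γ (w s)‖ₑ) ^ 2 *
                ‖v s - w s‖ₑ ^ 2) + 2 * ENNReal.ofReal ε ^ 2 *
                ‖P.toScale γ (v s) - P.toScale γ (w s)‖ₑ ^ 2 := by ring
          _ ≤ _ := by
            have h4 : 2 * ENNReal.ofReal ε ^ 2 ≤ ENNReal.ofReal (c * c) := by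
              have : (2 : ℝ≥0∞) = ENNReal.ofReal 2 := by simp
              rw [this, ← ENNReal.ofReal_pow hε, ← ENNReal.ofReal_mul (by norm_num)]
              refine ENNReal.ofReal_le_ofReal ?_
              nlinarith
            gcongr
            exact hsq _ _
      · have hm1 : AEMeasurable N (volume.restrict (Ioc 0 T)) := by
          refine AEMeasurable.mono_measure ?_ (Measure.restrict_mono Ioc_subset_Ioi_self le_rfl)
          exact ((hv.memLp.aestronglyMeasurable.enorm.pow_const 2).add
            (hw.memLp.aestronglyMeasurable.enorm.pow_const 2)).const_mul 2
        have hm2 : AEMeasurable (fun s => ‖v s - w s‖ₑ ^ 2) (volume.restrict (Ioc 0 T)) :=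
          (((hv.continuousOn.sub hw.continuousOn).mono
            (Ioc_subset_Icc_self.trans Icc_subset_Ici_self)).aestronglyMeasurable
              measurableSet_Ioc).enorm.pow_const 2
        exact (hm1.mul hm2).const_mul _
    have hXfin : ENNReal.ofReal c * X ≠ ∞ :=
      ne_top_of_le_ne_top (ENNReal.mul_ne_top ENNReal.ofReal_ne_top hYfin)
        (le_add_self.trans key)
    refine (ENNReal.add_le_add_iff_right hXfin).1 (key.trans ?_)
    calc ENNReal.ofReal c⁻¹ * Y ≤ ENNReal.ofReal c⁻¹ *
          ((∫⁻ s in Ioc 0 T, 2 * ENNReal.ofReal κ ^ 2 * (N s * ‖v s - w s‖ₑ ^ 2)) +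
            ENNReal.ofReal (c * c) * X) := by gcongr
      _ = _ := by
        rw [mul_add, ← lintegral_const_mul' _ _ ENNReal.ofReal_ne_top, ← mul_assoc _ _ X,
          ← ENNReal.ofReal_mul (by positivity), inv_mul_cancel_left₀ hc.ne']
        simp only [ha, mul_assoc]

end Diagonal

/-! ### Existence for the diagonal system -/

/-- The truncations `x ↦ ∑_{n < N} x_n e_n`, as maps from `H` to `D_r(A)`. -/
def truncation (P : DiagonalParabolic A) (r : ℝ) (N : ℕ) : H →L[ℂ] P.Scale r :=
  ∑ n ∈ Finset.range N, (P.reprCLM n).smulRight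
    (P.ofCoords (Pi.single n 1) (P.mem_scaleSubmodule_iff.1
      (P.mem_scaleSubmodule_of_eventually_eq_zero (by
        filter_upwards [eventually_gt_atTop n] with p hp
        simp [hp.ne']))))

theorem coords_truncation (P : DiagonalParabolic A) (r : ℝ) (N : ℕ) (x : H) (p : ℕ) :
    P.coords (P.truncation r N x) p = if p < N then P.basis.repr x p else 0 := by
  simp only [truncation, _root_.sum_apply, ContinuousLinearMap.smulRight_apply, reprCLM_apply]
  rw [map_sum, Finset.sum_apply]
  simp only [map_smul, Pi.smul_apply, coords_ofCoords, smul_eq_mul, Pi.single_apply, mul_ite,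
    mul_one, mul_zero]
  simp

/-- The truncations exhibit `toScale` as a pointwise limit of continuous maps, whence its
measurability although it is not continuous on `H`. -/
theorem tendsto_truncation (P : DiagonalParabolic A) {r : ℝ} {x : H} (hx : P.MemScale r x) :
    Tendsto (fun N => P.truncation r N x) atTop (𝓝 (P.toScale r x)) := by
  have hlim : Tendsto (fun N => ‖P.truncation r N x - P.toScale r x‖ ^ 2) atTop (𝓝 0) := by
    simp only [norm_sq_eq_tsum, map_sub, P.coords_toScale hx, Pi.sub_apply, coords_truncation]
    have h0 : (0 : ℝ) = ∑' _ : ℕ, 0 := by simp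
    rw [h0]
    refine tendsto_tsum_of_dominated_convergence
      (bound := fun n => P.weight r n * ‖P.basis.repr x n‖ ^ 2) hx (fun n => ?_)
      (.of_forall fun N n => ?_)
    · refine tendsto_const_nhds.congr' ?_
      filter_upwards [eventually_gt_atTop n] with N hN
      simp [hN]
    · have hw := (P.weight_pos r n).le
      rw [Real.norm_of_nonneg (by positivity)]
      split_ifs
      · simp only [sub_self, norm_zero, ne_eq, OfNat.ofNat_ne_zero, not_false_eq_true, zero_pow,
          mul_zero]
        positivity
      · simp
  rw [tendsto_iff_norm_sub_tendsto_zero]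
  simpa [Real.sqrt_sq (norm_nonneg _)] using hlim.sqrt

theorem aestronglyMeasurable_toScale (P : DiagonalParabolic A) {r : ℝ} {α : Type*}
    [MeasurableSpace α] {μ : Measure α} {v : α → H} (hv : AEStronglyMeasurable v μ)
    (hmem : ∀ᵐ t ∂μ, P.MemScale r (v t)) :
    AEStronglyMeasurable (fun t => P.toScale r (v t)) μ :=
  aestronglyMeasurable_of_tendsto_ae atTop
    (fun N => (P.truncation r N).continuous.comp_aestronglyMeasurable hv)
    (by filter_upwards [hmem] with t ht using P.tendsto_truncation ht)

section SmallOnBall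

variable {P : DiagonalParabolic A} {γ : ℝ} {hγ : 0 ≤ γ} {κ ε ρ : ℝ}
  {G : P.Scale γ → P.Scale (-(1 / 2))}

theorem SmallOnBall.continuousOn (hG : P.SmallOnBall hγ κ ε ρ G) :
    ContinuousOn G {x | ‖P.toH hγ x‖ ≤ ρ} := by
  intro x hx
  rw [ContinuousWithinAt, tendsto_iff_norm_sub_tendsto_zero]
  have h1 : Tendsto (fun y : P.Scale γ => κ * (‖y‖ + ‖x‖) * ‖P.toH hγ (y - x)‖ + ε * ‖y - x‖)
      (𝓝[{x | ‖P.toH hγ x‖ ≤ ρ}] x) (𝓝 0) := by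
    have hc : Continuous fun y : P.Scale γ =>
        κ * (‖y‖ + ‖x‖) * ‖P.toH hγ (y - x)‖ + ε * ‖y - x‖ := by fun_prop
    have h2 := (hc.tendsto x).mono_left
      (nhdsWithin_le_nhds (s := {x | ‖P.toH hγ x‖ ≤ ρ}))
    simpa using h2
  refine squeeze_zero' (.of_forall fun _ => norm_nonneg _) ?_ h1
  filter_upwards [self_mem_nhdsWithin] with y hy
  exact (hG y x hy hx).2

/-- The composition of `G` with a measurable function whose values lie in the ball on which `G` is
controlled is measurable. -/
theorem SmallOnBall.aestronglyMeasurable (hG : P.SmallOnBall hγ κ ε ρ G) (hρ : 0 < ρ)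
    {α : Type*} [MeasurableSpace α] {μ : Measure α} {f : α → P.Scale γ}
    (hf : AEStronglyMeasurable f μ) (hfρ : ∀ᵐ t ∂μ, ‖P.toH hγ (f t)‖ ≤ ρ) :
    AEStronglyMeasurable (fun t => G (f t)) μ := by
  -- a continuous retraction onto the ball
  let ψ : P.Scale γ → P.Scale γ := fun x => ((ρ / max ρ ‖P.toH hγ x‖ : ℝ) : ℂ) • x
  have hψc : Continuous ψ := by
    have h1 : Continuous fun x : P.Scale γ => ρ / max ρ ‖P.toH hγ x‖ :=
      continuous_const.div (by fun_prop) fun x => (lt_max_of_lt_left hρ).ne'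
    exact (Complex.continuous_ofReal.comp h1).smul continuous_id
  have hψρ : ∀ x, ‖P.toH hγ (ψ x)‖ ≤ ρ := by
    intro x
    have hpos : 0 < max ρ ‖P.toH hγ x‖ := lt_max_of_lt_left hρ
    rw [map_smul, norm_smul, Complex.norm_real, Real.norm_of_nonneg (by positivity),
      div_mul_eq_mul_div, div_le_iff₀ hpos]
    gcongr
    exact le_max_right _ _
  have hcont : Continuous fun x => G (ψ x) := hG.continuousOn.comp_continuous hψc hψρ
  refine (hcont.comp_aestronglyMeasurable hf).congr ?_
  filter_upwards [hfρ] with t ht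
  have : ψ (f t) = f t := by
    simp only [ψ]
    rw [max_eq_left ht, div_self hρ.ne', Complex.ofReal_one, one_smul]
  simp only [this]

end SmallOnBall

section Existence

variable {P : DiagonalParabolic A} {γ : ℝ} {τ : ℕ → ℂ} {g : ℝ → P.Scale (-(1 / 2))} {v : ℝ → H}

/-- Bounds in `C_b([0,∞); H)` and `L²((0,∞); D_γ(A))` for the linear inhomogeneous problem. -/
theorem IsLinearSolution.bounds (h : P.IsLinearSolution τ g v) {d : ℝ} (hd : 0 < d)
    (hτ : ∀ n, (τ n).re ≤ -0 - d ^ 2 * P.weight (1 / 2) n) (hγ' : γ ≤ 1 / 2) {N M : ℝ}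
    (hN : 0 ≤ N) (hM : 0 ≤ M)
    (hg : eLpNorm g 2 (volume.restrict (Ioi (0 : ℝ))) ≤ ENNReal.ofReal N)
    (hNM : ‖v 0‖ ^ 2 + (N / d) ^ 2 ≤ M ^ 2) :
    (∀ t, 0 ≤ t → ‖v t‖ ≤ M) ∧
    (∀ᵐ t ∂volume.restrict (Ioi (0 : ℝ)), P.MemScale γ (v t)) ∧
    MemLp (fun t => P.toScale γ (v t)) 2 (volume.restrict (Ioi (0 : ℝ))) ∧
    eLpNorm (fun t => P.toScale γ (v t)) 2 (volume.restrict (Ioi (0 : ℝ))) ≤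
      ENNReal.ofReal (M / d) := by
  have hc : 0 < d ^ 2 := by positivity
  obtain ⟨h1, h2⟩ := h.energy_le_Ioi hc hτ
  have h3 : ‖v 0‖ₑ ^ 2 + ENNReal.ofReal (d ^ 2)⁻¹ * ∫⁻ s in Ioi 0, ‖g s‖ₑ ^ 2 ≤
      ENNReal.ofReal (M ^ 2) := by
    rw [← sq_eLpNorm_two]
    calc _ ≤ ‖v 0‖ₑ ^ 2 + ENNReal.ofReal (d ^ 2)⁻¹ * ENNReal.ofReal N ^ 2 := by gcongr
      _ = ENNReal.ofReal (‖v 0‖ ^ 2 + (N / d) ^ 2) := by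
        rw [ENNReal.ofReal_add (by positivity) (by positivity),
          ENNReal.ofReal_pow (norm_nonneg _), ofReal_norm, ← ENNReal.ofReal_pow hN,
          ← ENNReal.ofReal_mul (by positivity)]
        congr 2
        field_simp
      _ ≤ _ := ENNReal.ofReal_le_ofReal hNM
  have h4 := h2.trans h3
  have hvm : AEStronglyMeasurable v (volume.restrict (Ioi (0 : ℝ))) :=
    (h.continuousOn.mono Ioi_subset_Ici_self).aestronglyMeasurable measurableSet_Ioi
  have hfin : ∫⁻ s in Ioi 0, P.energy (1 / 2) (P.basis.repr (v s)) ≠ ∞ := by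
    intro htop
    rw [htop, ENNReal.mul_top (by simpa using hd.ne')] at h4
    exact absurd h4 (by simp)
  have hmeas : AEMeasurable (fun s => P.energy (1 / 2) (P.basis.repr (v s)))
      (volume.restrict (Ioi (0 : ℝ))) := by
    unfold energy
    refine AEMeasurable.tsum fun n => AEMeasurable.const_mul ?_ _
    exact ((P.continuous_repr n).comp_aestronglyMeasurable hvm).enorm.pow_const 2
  have hmem : ∀ᵐ t ∂volume.restrict (Ioi (0 : ℝ)), P.MemScale γ (v t) := by
    filter_upwards [ae_lt_top' hmeas hfin] with t ht
    exact P.mem_scaleSubmodule_iff.1 (P.mem_scaleSubmodule_iff_energy.2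
      (ne_top_of_le_ne_top ht.ne (P.energy_mono hγ' _)))
  have hnorm : eLpNorm (fun t => P.toScale γ (v t)) 2 (volume.restrict (Ioi (0 : ℝ))) ≤
      ENNReal.ofReal (M / d) := by
    refine (ENNReal.pow_le_pow_left_iff two_ne_zero).1 ?_
    rw [sq_eLpNorm_two, ← ENNReal.ofReal_pow (by positivity)]
    have h5 : ∫⁻ s in Ioi 0, ‖P.toScale γ (v s)‖ₑ ^ 2 ≤
        ∫⁻ s in Ioi 0, P.energy (1 / 2) (P.basis.repr (v s)) :=
      lintegral_mono fun s => (P.enorm_sq_toScale_le γ _).trans (P.energy_mono hγ' _)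
    refine h5.trans ?_
    rw [div_pow, ENNReal.ofReal_div_of_pos hc,
      ENNReal.le_div_iff_mul_le (.inl (by simpa using hd.ne'))
        (.inl ENNReal.ofReal_ne_top), mul_comm]
    exact h4
  refine ⟨fun t ht => ?_, hmem, ⟨P.aestronglyMeasurable_toScale hvm hmem,
    hnorm.trans_lt ENNReal.ofReal_lt_top⟩, hnorm⟩
  have h5 := (h1 t ht).trans h3
  rw [← ofReal_norm, ← ENNReal.ofReal_pow (norm_nonneg _),
    ENNReal.ofReal_le_ofReal_iff (by positivity)] at h5
  exact (pow_le_pow_iff_left₀ (norm_nonneg _) hM two_ne_zero).1 h5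

/-- The linear solution driven by its own nonlinearity solves the semilinear system. -/
theorem IsLinearSolution.solvesWith [CompleteSpace H] {G : P.Scale γ → P.Scale (-(1 / 2))}
    {hτb : ∃ c : ℝ, ∀ n, ‖τ n‖ ^ 2 ≤ c * (1 + ‖P.eig n‖ ^ 2)}
    (h : P.IsLinearSolution τ (fun s => G (P.toScale γ (v s))) v)
    (hG : MemLp (fun s => G (P.toScale γ (v s))) 2 (volume.restrict (Ioi (0 : ℝ))))
    (hb : ∃ M : ℝ, ∀ t, 0 ≤ t → ‖v t‖ ≤ M)
    (hmem : ∀ᵐ t ∂volume.restrict (Ioi (0 : ℝ)), P.MemScale γ (v t))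
    (hLp : MemLp (fun t => P.toScale γ (v t)) 2 (volume.restrict (Ioi (0 : ℝ)))) :
    P.SolvesWith γ (P.diagRhs τ hτb G) (v 0) v := by
  have hint : ∀ t, 0 ≤ t → IntervalIntegrable (fun s => P.diagRhs τ hτb G (v s)) volume 0 t := by
    intro t ht
    have h1 : IntervalIntegrable (fun s => P.diag τ hτb (v s)) volume 0 t := by
      apply ContinuousOn.intervalIntegrable
      rw [uIcc_of_le ht]
      exact (P.continuous_diag τ hτb).comp_continuousOn (h.continuousOn.mono Icc_subset_Ici_self)
    refine h1.add ?_
    rw [intervalIntegrable_iff_integrableOn_Ioc_of_le ht]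
    have h2 : IntegrableOn (fun s => G (P.toScale γ (v s))) (Ioc 0 t) :=
      (hG.mono_measure (Measure.restrict_mono Ioc_subset_Ioi_self le_rfl)).integrable (by norm_num)
    exact ContinuousLinearMap.integrable_comp
      (⟨P.incl (by norm_num), P.continuous_incl (by norm_num)⟩ :
        P.Scale (-(1 / 2)) →L[ℂ] P.Scale (-1)) h2
  refine ⟨h.continuousOn, hb, hmem, hLp, rfl, hint, fun t ht => ?_⟩
  apply P.coords_injective
  funext n
  have h3 := (P.coordCLM (-1) n).intervalIntegral_comp_comm (hint t ht)
  rw [map_add, Pi.add_apply, coords_embH, coords_embH, h.equation n t ht,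
    ← P.coordCLM_apply (-1) n (∫ s in (0 : ℝ)..t, _), ← h3]
  congr 1

end Existence

section Existence

variable {P : DiagonalParabolic A} {γ : ℝ} {τ : ℕ → ℂ}

/-- The increment estimate for `G`, integrated in time along two functions `a`, `b` with values in
`D_γ(A)`. -/
theorem SmallOnBall.eLpNorm_sub_le {hγ : 0 ≤ γ} {κ ε ρ : ℝ} {G : P.Scale γ → P.Scale (-(1 / 2))}
    (hG : P.SmallOnBall hγ κ ε ρ G) (hκ : 0 ≤ κ) (hε : 0 ≤ ε) {μ : Measure ℝ}
    {a b : ℝ → P.Scale γ} {N D E : ℝ} (hN : 0 ≤ N) (hD : 0 ≤ D) (hE : 0 ≤ E)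
    (ha : MemLp a 2 μ) (hb : MemLp b 2 μ)
    (haρ : ∀ᵐ t ∂μ, ‖P.toH hγ (a t)‖ ≤ ρ) (hbρ : ∀ᵐ t ∂μ, ‖P.toH hγ (b t)‖ ≤ ρ)
    (haN : eLpNorm a 2 μ ≤ ENNReal.ofReal N) (hbN : eLpNorm b 2 μ ≤ ENNReal.ofReal N)
    (hDab : ∀ᵐ t ∂μ, ‖P.toH hγ (a t - b t)‖ ≤ D)
    (hEab : eLpNorm (fun t => a t - b t) 2 μ ≤ ENNReal.ofReal E) :
    eLpNorm (fun t => G (a t) - G (b t)) 2 μ ≤ ENNReal.ofReal (κ * D * (2 * N) + ε * E) := by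
  have hpt : ∀ᵐ t ∂μ, ‖G (a t) - G (b t)‖ ≤
      (κ * D) * ‖a t‖ + (κ * D) * ‖b t‖ + ε * ‖a t - b t‖ := by
    filter_upwards [haρ, hbρ, hDab] with t h1 h2 h3
    refine (hG _ _ h1 h2).2.trans ?_
    have h4 : κ * (‖a t‖ + ‖b t‖) * ‖P.toH hγ (a t - b t)‖ ≤ κ * (‖a t‖ + ‖b t‖) * D := by gcongr
    linarith
  have hmul : ∀ (C : ℝ) (f : ℝ → P.Scale γ), 0 ≤ C →
      eLpNorm (fun t => C * ‖f t‖) 2 μ ≤ ENNReal.ofReal C * eLpNorm f 2 μ := by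
    intro C f hC
    refine eLpNorm_le_mul_eLpNorm_of_ae_le_mul (.of_forall fun t => ?_) 2
    rw [Real.norm_of_nonneg (by positivity)]
  have hm : ∀ (C : ℝ) (f : ℝ → P.Scale γ), MemLp f 2 μ →
      AEStronglyMeasurable (fun t => C * ‖f t‖) μ :=
    fun C f hf => hf.aestronglyMeasurable.norm.const_mul C
  calc eLpNorm (fun t => G (a t) - G (b t)) 2 μ
      ≤ eLpNorm (fun t => (κ * D) * ‖a t‖ + (κ * D) * ‖b t‖ + ε * ‖a t - b t‖) 2 μ :=
        eLpNorm_mono_ae_real hpt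
    _ ≤ eLpNorm (fun t => (κ * D) * ‖a t‖ + (κ * D) * ‖b t‖) 2 μ +
        eLpNorm (fun t => ε * ‖a t - b t‖) 2 μ :=
        eLpNorm_add_le ((hm _ _ ha).add (hm _ _ hb)) (hm _ _ (ha.sub hb)) (by norm_num)
    _ ≤ eLpNorm (fun t => (κ * D) * ‖a t‖) 2 μ + eLpNorm (fun t => (κ * D) * ‖b t‖) 2 μ +
        eLpNorm (fun t => ε * ‖a t - b t‖) 2 μ := by
        gcongr
        exact eLpNorm_add_le (hm _ _ ha) (hm _ _ hb) (by norm_num)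
    _ ≤ ENNReal.ofReal (κ * D) * ENNReal.ofReal N + ENNReal.ofReal (κ * D) * ENNReal.ofReal N +
        ENNReal.ofReal ε * ENNReal.ofReal E := by
        gcongr
        · exact (hmul _ _ (by positivity)).trans (by gcongr)
        · exact (hmul _ _ (by positivity)).trans (by gcongr)
        · exact (hmul _ (fun t => a t - b t) hε).trans (by gcongr)
    _ = _ := by
        rw [← ENNReal.ofReal_mul (by positivity), ← ENNReal.ofReal_mul hε,
          ← ENNReal.ofReal_add (by positivity) (by positivity),
          ← ENNReal.ofReal_add (by positivity) (by positivity)]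
        congr 1
        ring

/-- Existence of small solutions: the nonlinearity `g = G(v)` along the solution `v` is found as
the fixed point of the contraction `g ↦ G(v_g)` of a ball of `L²((0,∞); D_{-1/2}(A))`, where `v_g`
is the solution of the linear problem with right-hand side `g`. -/
theorem exists_solvesWith [CompleteSpace H] {d : ℝ} (hd : 0 < d)
    (hτb : ∃ c : ℝ, ∀ n, ‖τ n‖ ^ 2 ≤ c * (1 + ‖P.eig n‖ ^ 2))
    (hτ : ∀ n, (τ n).re ≤ -0 - d ^ 2 * P.weight (1 / 2) n) (hγ : 0 ≤ γ) (hγ' : γ ≤ 1 / 2)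
    {κ ρ σ : ℝ} (hκ : 0 ≤ κ) (hσ : 0 < σ) (hσρ : 2 * σ ≤ ρ) (hσκ : 16 * κ * σ ≤ d ^ 2)
    {G : P.Scale γ → P.Scale (-(1 / 2))} (hG : P.SmallOnBall hγ κ (d ^ 2 / 4) ρ G) {v₀ : H}
    (hv₀ : ‖v₀‖ ≤ σ) : ∃ v : ℝ → H, P.SolvesWith γ (P.diagRhs τ hτb G) v₀ v := by
  classical
  set μ : Measure ℝ := volume.restrict (Ioi (0 : ℝ)) with hμ
  let Y := Lp (P.Scale (-(1 / 2))) 2 μ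
  choose V hV hV0 using fun g : Y =>
    P.exists_isLinearSolution (by positivity : 0 < d ^ 2) hτ v₀ (Lp.memLp g)
  set B : Set Y := Metric.closedBall 0 (d * σ) with hB
  have hbounds : ∀ g ∈ B, (∀ t, 0 ≤ t → ‖V g t‖ ≤ 2 * σ) ∧ (∀ᵐ t ∂μ, P.MemScale γ (V g t)) ∧
      MemLp (fun t => P.toScale γ (V g t)) 2 μ ∧
      eLpNorm (fun t => P.toScale γ (V g t)) 2 μ ≤ ENNReal.ofReal (2 * σ / d) := by
    intro g hg
    refine (hV g).bounds hd hτ hγ' (N := d * σ) (by positivity) (by positivity) ?_ ?_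
    · rw [hB, mem_closedBall_zero_iff, Lp.norm_def] at hg
      exact (ENNReal.le_ofReal_iff_toReal_le (Lp.eLpNorm_ne_top g) (by positivity)).2 hg
    · rw [hV0, mul_div_cancel_left₀ _ hd.ne']
      nlinarith [norm_nonneg v₀]
  have hsmall : ∀ g ∈ B, ∀ᵐ t ∂μ, ‖P.toH hγ (P.toScale γ (V g t))‖ ≤ ρ := by
    intro g hg
    filter_upwards [ae_restrict_mem measurableSet_Ioi] with t ht
    exact (P.norm_toH_toScale_le hγ _).trans (((hbounds g hg).1 t (le_of_lt ht)).trans hσρ)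
  have hGle : ∀ g ∈ B, eLpNorm (fun t => G (P.toScale γ (V g t))) 2 μ ≤
      ENNReal.ofReal (d * σ) := by
    intro g hg
    have h1 : ∀ᵐ t ∂μ, ‖G (P.toScale γ (V g t))‖ ≤ d ^ 2 / 4 * ‖P.toScale γ (V g t)‖ := by
      filter_upwards [hsmall g hg] with t ht using (hG _ _ ht ht).1
    refine (eLpNorm_le_mul_eLpNorm_of_ae_le_mul h1 2).trans ?_
    calc _ ≤ ENNReal.ofReal (d ^ 2 / 4) * ENNReal.ofReal (2 * σ / d) := by
          gcongr
          exact (hbounds g hg).2.2.2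
      _ ≤ _ := by
          rw [← ENNReal.ofReal_mul (by positivity)]
          refine ENNReal.ofReal_le_ofReal ?_
          have : d ^ 2 / 4 * (2 * σ / d) = d * σ / 2 := by field_simp; ring
          rw [this]
          have : 0 < d * σ := by positivity
          linarith
  have hGmem : ∀ g ∈ B, MemLp (fun t => G (P.toScale γ (V g t))) 2 μ := fun g hg =>
    ⟨hG.aestronglyMeasurable (by linarith) (hbounds g hg).2.2.1.aestronglyMeasurable
      (hsmall g hg), (hGle g hg).trans_lt ENNReal.ofReal_lt_top⟩
  let Γ : Y → Y := fun g =>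
    if h : MemLp (fun t => G (P.toScale γ (V g t))) 2 μ then h.toLp else 0
  have hΓ : ∀ g (hg : g ∈ B), Γ g = (hGmem g hg).toLp := fun g hg => dif_pos (hGmem g hg)
  have hmaps : MapsTo Γ B B := by
    intro g hg
    rw [hΓ g hg, hB, mem_closedBall_zero_iff, Lp.norm_toLp]
    exact ENNReal.toReal_le_of_le_ofReal (by positivity) (hGle g hg)
  have hlip : ∀ g ∈ B, ∀ g' ∈ B, ‖Γ g - Γ g'‖ ≤ 1 / 2 * ‖g - g'‖ := by
    intro g hg g' hg'
    rw [hΓ g hg, hΓ g' hg', ← MemLp.toLp_sub, Lp.norm_toLp]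
    refine ENNReal.toReal_le_of_le_ofReal (by positivity) ?_
    set D := ‖g - g'‖ / d with hD
    have hD0 : 0 ≤ D := by positivity
    obtain ⟨hd1, -, -, hd4⟩ := ((hV g).sub (hV g')).bounds hd hτ hγ' (N := ‖g - g'‖) (M := D)
      (norm_nonneg _) hD0 (by
        rw [Lp.norm_def, ENNReal.ofReal_toReal (Lp.eLpNorm_ne_top _)]
        exact (eLpNorm_congr_ae (Lp.coeFn_sub g g')).symm.le)
      (by simp [hV0, hD])
    have hsub : ∀ᵐ t ∂μ, P.toScale γ (V g t) - P.toScale γ (V g' t) =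
        P.toScale γ (V g t - V g' t) := by
      filter_upwards [(hbounds g hg).2.1, (hbounds g' hg').2.1] with t h1 h2
      apply P.toH_injective hγ
      have h3 : P.MemScale γ (V g t - V g' t) := by
        have h4 := P.memScale_toH hγ (P.toScale γ (V g t) - P.toScale γ (V g' t))
        rwa [map_sub, P.toH_toScale hγ h1, P.toH_toScale hγ h2] at h4
      rw [map_sub, P.toH_toScale hγ h1, P.toH_toScale hγ h2, P.toH_toScale hγ h3]
    refine (hG.eLpNorm_sub_le hκ (by positivity) (N := 2 * σ / d) (D := D) (E := D / d)
      (by positivity) hD0 (by positivity) (hbounds g hg).2.2.1 (hbounds g' hg').2.2.1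
      (hsmall g hg) (hsmall g' hg') (hbounds g hg).2.2.2 (hbounds g' hg').2.2.2 ?_ ?_).trans ?_
    · filter_upwards [hsub, ae_restrict_mem measurableSet_Ioi] with t h1 ht
      rw [h1]
      exact (P.norm_toH_toScale_le hγ _).trans (hd1 t (le_of_lt ht))
    · rw [eLpNorm_congr_ae hsub]
      exact hd4
    · refine ENNReal.ofReal_le_ofReal ?_
      have h1 : κ * D * (2 * (2 * σ / d)) + d ^ 2 / 4 * (D / d) =
          (16 * κ * σ / (4 * d ^ 2) + 1 / 4) * ‖g - g'‖ := by
        rw [hD]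
        field_simp
        ring
      rw [h1]
      gcongr
      have h2 : 16 * κ * σ / (4 * d ^ 2) ≤ 1 / 4 := by
        rw [div_le_iff₀ (by positivity)]
        linarith
      linarith
  have hcontr : ContractingWith (1 / 2 : ℝ≥0) (hmaps.restrict Γ B B) := by
    refine ⟨by norm_num, LipschitzWith.of_dist_le_mul fun g g' => ?_⟩
    rw [Subtype.dist_eq, Subtype.dist_eq, dist_eq_norm, dist_eq_norm]
    simpa using hlip g g.2 g' g'.2
  obtain ⟨g, hgB, hfix, -⟩ := hcontr.exists_fixedPoint'
    (Metric.isClosed_closedBall.isComplete) hmaps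
    (Metric.mem_closedBall_self (by positivity) : (0 : Y) ∈ B) (edist_ne_top _ _)
  have hgG : g =ᵐ[μ] fun t => G (P.toScale γ (V g t)) := by
    have h1 : Γ g = g := hfix
    rw [hΓ g hgB] at h1
    have h2 := (hGmem g hgB).coeFn_toLp
    rwa [h1] at h2
  obtain ⟨h1, h2, h3, -⟩ := hbounds g hgB
  have hlin : P.IsLinearSolution τ (fun s => G (P.toScale γ (V g s))) (V g) := by
    have hae : ∀ t, 0 ≤ t → ∀ᵐ s, s ∈ uIoc 0 t → g s = G (P.toScale γ (V g s)) := by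
      intro t ht
      rw [uIoc_of_le ht]
      filter_upwards [(ae_restrict_iff' measurableSet_Ioi).1 hgG] with s hs hs'
      exact hs hs'.1
    refine ⟨(hV g).continuousOn, fun n t ht => ?_, fun n t ht => ?_⟩
    · refine ((hV g).integrable n t ht).congr_ae ?_
      rw [Filter.EventuallyEq, ae_restrict_iff' measurableSet_uIoc]
      filter_upwards [hae t ht] with s hs hs'
      simp only [hs hs']
    · rw [(hV g).equation n t ht]
      congr 1
      refine intervalIntegral.integral_congr_ae ?_
      filter_upwards [hae t ht] with s hs hs'
      simp only [hs hs']
  exact ⟨V g, hV0 g ▸ hlin.solvesWith (hGmem g hgB) ⟨_, h1⟩ h2 h3⟩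

/-- Well-posedness and exponential decay for small data of a semilinear equation with diagonal
linear part. -/
theorem exists_unique_decay [CompleteSpace H] {lam c : ℝ} (hlam : 0 ≤ lam) (hc : 0 < c)
    (hτb : ∃ c : ℝ, ∀ n, ‖τ n‖ ^ 2 ≤ c * (1 + ‖P.eig n‖ ^ 2))
    (hτ : ∀ n, (τ n).re ≤ -lam - c * P.weight (1 / 2) n) (hγ : 0 ≤ γ) (hγ' : γ ≤ 1 / 2)
    {κ : ℝ} (hκ : 0 ≤ κ) {G : P.Scale γ → P.Scale (-(1 / 2))}
    (hG : ∀ ε > 0, ∃ ρ > 0, P.SmallOnBall hγ κ ε ρ G) :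
    ∃ δ : ℝ, 0 < δ ∧ ∀ v₀ : H, ‖v₀‖ ≤ δ →
      ∃ v : ℝ → H, P.SolvesWith γ (P.diagRhs τ hτb G) v₀ v ∧
        (∀ w : ℝ → H, P.SolvesWith γ (P.diagRhs τ hτb G) v₀ w → EqOn w v (Ici 0)) ∧
        ∀ t : ℝ, 0 ≤ t → ‖v t‖ ≤ Real.exp (-lam * t) * ‖v₀‖ := by
  have hτ0 : ∀ n, (τ n).re ≤ -0 - c * P.weight (1 / 2) n := fun n => (hτ n).trans (by linarith)
  obtain ⟨ρ, hρ, hGρ⟩ := hG (c / 4) (by positivity)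
  set d := Real.sqrt c with hd
  have hdc : d ^ 2 = c := Real.sq_sqrt hc.le
  set σ := min (ρ / 2) (c / (16 * (κ + 1))) with hσ
  have hσ0 : 0 < σ := by positivity
  have hσρ : 2 * σ ≤ ρ := by
    have := min_le_left (ρ / 2) (c / (16 * (κ + 1)))
    linarith
  have hσκ : 16 * κ * σ ≤ d ^ 2 := by
    have h1 := min_le_right (ρ / 2) (c / (16 * (κ + 1)))
    rw [← hσ, le_div_iff₀ (by positivity)] at h1
    rw [hdc]
    nlinarith
  -- small data give small solutions, which decay
  have hdecay : ∀ v₀ : H, ‖v₀‖ ≤ σ → ∀ v, P.SolvesWith γ (P.diagRhs τ hτb G) v₀ v →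
      (∀ t, 0 ≤ t → ‖v t‖ ≤ σ) ∧ ∀ t, 0 ≤ t → ‖v t‖ ≤ Real.exp (-lam * t) * ‖v₀‖ := by
    intro v₀ hv₀ v hv
    have hstep : ∀ t, 0 ≤ t → (∀ s ∈ Icc 0 t, ‖v s‖ ≤ ρ) →
        ‖v t‖ ≤ Real.exp (-lam * t) * ‖v₀‖ := fun t ht hs =>
      hv.norm_le_exp hlam hc hτ hγ hγ' (by linarith : c / 4 ≤ c) hGρ ht hs
    have hle : ∀ t, 0 ≤ t → Real.exp (-lam * t) * ‖v₀‖ ≤ σ := by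
      intro t ht
      have h1 : Real.exp (-lam * t) ≤ 1 := Real.exp_le_one_iff.2 (by nlinarith)
      calc _ ≤ 1 * ‖v₀‖ := by gcongr
        _ ≤ σ := by linarith
    have hσall : ∀ t, 0 ≤ t → ‖v t‖ ≤ σ :=
      le_of_continuation hv.continuousOn.norm (by linarith : σ < ρ) (by rw [hv.initial]; exact hv₀)
        fun t ht hs => (hstep t ht hs).trans (hle t ht)
    exact ⟨hσall, fun t ht => hstep t ht fun s hs => (hσall s hs.1).trans (by linarith)⟩
  refine ⟨σ, hσ0, fun v₀ hv₀ => ?_⟩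
  obtain ⟨v, hv⟩ := exists_solvesWith (by positivity : 0 < d) hτb (by rwa [hdc]) hγ hγ' hκ hσ0 hσρ
    hσκ (by rwa [hdc]) hv₀
  refine ⟨v, hv, fun w hw t ht => ?_, (hdecay v₀ hv₀ v hv).2⟩
  have ht' : 0 ≤ t := ht
  exact hw.eqOn_of_small hv hc hτ0 hγ hγ' hκ (by positivity) (by linarith) hGρ
    (fun s hs => ((hdecay v₀ hv₀ w hw).1 s hs.1).trans (by linarith))
    (fun s hs => ((hdecay v₀ hv₀ v hv).1 s hs.1).trans (by linarith)) t ⟨ht', le_rfl⟩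

end Existence

/-! ### Reduction of the closed-loop system to a diagonal one -/

theorem weight_half_le (P : DiagonalParabolic A) (n : ℕ) :
    P.weight (1 / 2) n ≤ 1 + ‖P.eig n‖ := by
  rw [weight, ← Real.sqrt_eq_rpow]
  exact Real.sqrt_le_iff.2 ⟨by positivity, by nlinarith [norm_nonneg (P.eig n)]⟩

/-- The spectrum of the target operator lies strictly to the left of `-lam`, with a gap that grows
like `(1 + |λ_n|²)^{1/2}` by sectoriality. -/
theorem exists_targetEig_re_le (P : DiagonalParabolic A) {lam mu : ℝ} (hmu : lam + P.cA < mu) :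
    ∃ c : ℝ, 0 < c ∧ ∀ n, (P.targetEig lam mu n).re ≤ -lam - c * P.weight (1 / 2) n := by
  set a : ℕ → ℝ := fun n => -lam - (P.targetEig lam mu n).re with ha
  have hpos : ∀ n, 0 < a n := by
    intro n
    by_cases hn : n ∈ P.low lam
    · have h1 := P.re_le_cA n
      simp only [ha, P.targetEig_of_mem mu hn, Complex.sub_re, Complex.ofReal_re]
      linarith
    · simp only [ha, P.targetEig_of_notMem mu hn]
      have h1 : ¬(-lam ≤ (P.eig n).re) := hn
      linarith
  obtain ⟨C, hC, hsec⟩ := P.sectorial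
  have hev : ∀ᶠ n in atTop, P.weight (1 / 2) n / a n ≤ 2 * (2 + C⁻¹) := by
    filter_upwards [P.eventually_notMem_low lam,
      P.tendsto_re.eventually (eventually_le_atBot (-1)),
      P.tendsto_re.eventually (eventually_le_atBot (-(2 * lam)))] with n h1 h2 h3
    rw [div_le_iff₀ (hpos n)]
    have h4 : |(P.eig n).im| ≤ C⁻¹ * |(P.eig n).re| := by
      rw [inv_mul_eq_div, le_div_iff₀ hC, mul_comm]
      exact hsec n
    have h5 : |(P.eig n).re| = -(P.eig n).re := abs_of_nonpos (by linarith)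
    have h6 := Complex.norm_le_abs_re_add_abs_im (P.eig n)
    have h7 : a n = -lam - (P.eig n).re := by simp only [ha, P.targetEig_of_notMem mu h1]
    have h8 := P.weight_half_le n
    have h9 : 0 < C⁻¹ := inv_pos.2 hC
    rw [h5] at h4 h6
    rw [h7]
    nlinarith
  obtain ⟨K, hK⟩ := (isBoundedUnder_of_eventually_le hev).bddAbove_range
  refine ⟨(max K 1)⁻¹, by positivity, fun n => ?_⟩
  have h1 : P.weight (1 / 2) n / a n ≤ max K 1 := (hK ⟨n, rfl⟩).trans (le_max_left _ _)
  rw [div_le_iff₀ (hpos n)] at h1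
  have h2 : (max K 1)⁻¹ * P.weight (1 / 2) n ≤ a n := by
    rw [inv_mul_le_iff₀ (by positivity)]
    exact h1
  simp only [ha] at h2
  linarith

/-- Conjugating the nonlinearity by bounded operators preserves its smallness. -/
theorem NonlinearityAssumption.exists_smallOnBall {P : DiagonalParabolic A} {γ : ℝ} (hγ : 0 ≤ γ)
    {F : P.Scale γ → P.Scale (-(1 / 2))} (hF : P.NonlinearityAssumption γ F)
    (S : P.Scale (-(1 / 2)) →L[ℂ] P.Scale (-(1 / 2))) (S' : P.Scale γ →L[ℂ] P.Scale γ)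
    (L : H →L[ℂ] H) (hL : ∀ x, P.toH hγ (S' x) = L (P.toH hγ x)) :
    ∃ κ : ℝ, 0 ≤ κ ∧ ∀ ε > 0, ∃ ρ > 0, P.SmallOnBall hγ κ ε ρ fun x => S (F (S' x)) := by
  obtain ⟨η, K, Φ, hη, hK, -, hΦ, hΦ0, hbound⟩ := hF
  refine ⟨‖S‖ * K * ‖S'‖ * ‖L‖, by positivity, fun ε hε => ?_⟩
  set ε' := ε / (‖S‖ * ‖S'‖ * (K + 1) + 1) with hε'
  have hε'0 : 0 < ε' := by positivity
  obtain ⟨r, hr, hrΦ⟩ : ∃ r > 0, ∀ x, 0 ≤ x → x < r → Φ x ≤ ε' := by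
    have h1 : ∀ᶠ x in 𝓝[Ici 0] (0 : ℝ), Φ x < ε' :=
      hΦ.eventually (gt_mem_nhds (by rw [hΦ0]; exact hε'0))
    obtain ⟨r, hr, h2⟩ := Metric.eventually_nhds_iff.1 (eventually_nhdsWithin_iff.1 h1)
    refine ⟨r, hr, fun x hx0 hx => (h2 ?_ hx0).le⟩
    rwa [Real.dist_eq, sub_zero, abs_of_nonneg hx0]
  have hε'1 : ε' * (‖S‖ * ‖S'‖ * (K + 1) + 1) = ε := div_mul_cancel₀ _ (by positivity)
  have hSS : 0 ≤ ‖S‖ * ‖S'‖ := by positivity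
  have hε'2 : ‖S‖ * ε' * ‖S'‖ ≤ ε := by
    nlinarith [mul_nonneg hε'0.le (mul_nonneg hSS hK.le)]
  have hε'3 : ‖S‖ * (K * ε' * ‖S'‖) ≤ ε := by
    nlinarith [mul_nonneg hε'0.le hSS]
  refine ⟨min η (r / 4) / (‖L‖ + 1), by positivity, fun x y hx hy => ?_⟩
  have hLx : ∀ z : P.Scale γ, ‖P.toH hγ z‖ ≤ min η (r / 4) / (‖L‖ + 1) →
      ‖P.toH hγ (S' z)‖ ≤ min η (r / 4) := by
    intro z hz
    rw [le_div_iff₀ (by positivity)] at hz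
    rw [hL]
    refine (L.le_opNorm _).trans ?_
    nlinarith [norm_nonneg (P.toH hγ z)]
  have hx' := hLx x hx
  have hy' := hLx y hy
  have hxr := hx'.trans (min_le_right _ _)
  have hyr := hy'.trans (min_le_right _ _)
  obtain ⟨h1, h2⟩ := hbound (S' x) (S' y)
    (by rw [P.seqNorm_zero_eq_norm_toH hγ]; exact hx'.trans (min_le_left _ _))
    (by rw [P.seqNorm_zero_eq_norm_toH hγ]; exact hy'.trans (min_le_left _ _))
  simp only [P.seqNorm_zero_eq_norm_toH hγ] at h1 h2
  constructor
  · calc ‖S (F (S' x))‖ ≤ ‖S‖ * ‖F (S' x)‖ := S.le_opNorm _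
      _ ≤ ‖S‖ * (ε' * (‖S'‖ * ‖x‖)) := by
        gcongr
        refine h1.trans ?_
        gcongr
        · exact hrΦ _ (norm_nonneg _) (by linarith)
        · exact S'.le_opNorm _
      _ = ‖S‖ * ε' * ‖S'‖ * ‖x‖ := by ring
      _ ≤ ε * ‖x‖ := by gcongr
  · have h3 : ‖P.toH hγ (S' x - S' y)‖ ≤ ‖L‖ * ‖P.toH hγ (x - y)‖ := by
      rw [← map_sub, hL]
      exact L.le_opNorm _
    have h4 : ‖S' x - S' y‖ ≤ ‖S'‖ * ‖x - y‖ := by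
      rw [← map_sub]
      exact S'.le_opNorm _
    have h5 : Φ (‖P.toH hγ (S' x)‖ + ‖P.toH hγ (S' y)‖) ≤ ε' :=
      hrΦ _ (by positivity) (by linarith)
    calc ‖S (F (S' x)) - S (F (S' y))‖ ≤ ‖S‖ * ‖F (S' x) - F (S' y)‖ := by
          rw [← map_sub]
          exact S.le_opNorm _
      _ ≤ ‖S‖ * (K * (‖S'‖ * ‖x‖ + ‖S'‖ * ‖y‖) * (‖L‖ * ‖P.toH hγ (x - y)‖) +
          K * ε' * (‖S'‖ * ‖x - y‖)) := by
        gcongr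
        refine h2.trans ?_
        gcongr
        · exact S'.le_opNorm _
        · exact S'.le_opNorm _
      _ = ‖S‖ * K * ‖S'‖ * ‖L‖ * (‖x‖ + ‖y‖) * ‖P.toH hγ (x - y)‖ +
          ‖S‖ * (K * ε' * ‖S'‖) * ‖x - y‖ := by ring
      _ ≤ _ := by gcongr

/-- Solutions are transported by an automorphism of `H` that extends to `D(A)'` and restricts to
`D_γ(A)`, provided it intertwines the right-hand sides. -/
theorem SolvesWith.map [CompleteSpace H] {P : DiagonalParabolic A} {γ : ℝ} {R R' : H → P.Scale (-1)}
    {u₀ : H} {u : ℝ → H} (h : P.SolvesWith γ R u₀ u) (Td : P.Scale (-1) →L[ℂ] P.Scale (-1))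
    (L : H →L[ℂ] H) (S : P.Scale γ →L[ℂ] P.Scale γ) (hTd : ∀ x, Td (P.embH x) = P.embH (L x))
    (hmem : ∀ x, P.MemScale γ x → P.MemScale γ (L x))
    (hS : ∀ x, P.toScale γ (L x) = S (P.toScale γ x)) (hR : ∀ x, Td (R x) = R' (L x)) :
    P.SolvesWith γ R' (L u₀) fun t => L (u t) where
  continuousOn := L.continuous.comp_continuousOn h.continuousOn
  bounded := by
    obtain ⟨M, hM⟩ := h.bounded
    refine ⟨‖L‖ * M, fun t ht => (L.le_opNorm _).trans ?_⟩
    exact mul_le_mul_of_nonneg_left (hM t ht) (norm_nonneg _)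
  ae_mem := h.ae_mem.mono fun t ht => hmem _ ht
  memLp := by
    simp only [hS]
    exact S.comp_memLp' h.memLp
  initial := by simp only [h.initial]
  integrable t ht := by
    have h1 := h.integrable t ht
    simp only [← hR]
    exact ⟨Td.integrable_comp h1.1, Td.integrable_comp h1.2⟩
  equation t ht := by
    simp only [← hR]
    rw [Td.intervalIntegral_comp_comm (h.integrable t ht), ← hTd, ← hTd, h.equation t ht, map_add]

theorem isSolution_iff_solvesWith {P : DiagonalParabolic A} {m : ℕ} {B : Fin m → P.Scale (-1)}
    {K : H →L[ℂ] EuclideanSpace ℂ (Fin m)} {γ : ℝ} {F : P.Scale γ → P.Scale (-(1 / 2))}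
    {u₀ : H} {u : ℝ → H} : P.IsSolution B K F u₀ u ↔ P.SolvesWith γ (P.rhs B K F) u₀ u :=
  ⟨fun h => ⟨h.1, h.2, h.3, h.4, h.5, h.6, h.7⟩, fun h => ⟨h.1, h.2, h.3, h.4, h.5, h.6, h.7⟩⟩

/-- An F-equivalence turns the closed-loop system into a diagonal one with spectrum to the left of
`-lam`, for which well-posedness and decay of small solutions are known. -/
theorem IsParabolicFEquivalence.exists_solution [CompleteSpace H] {P : DiagonalParabolic A}
    {lam mu s γ : ℝ} {m : ℕ} {T : P.GLH} {K : H →L[ℂ] EuclideanSpace ℂ (Fin m)} {hs : -1 ≤ -s}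
    {B : Fin m → P.Scale (-s)}
    (h : P.IsParabolicFEquivalence lam mu (fun j => P.incl hs (B j)) T K)
    (hlam : 0 ≤ lam) (hmu : lam + P.cA < mu) (hγ : 0 ≤ γ) (hγ' : γ ≤ 1 / 2) (hγs : γ ≤ 1 - s)
    {F : P.Scale γ → P.Scale (-(1 / 2))} (hF : P.NonlinearityAssumption γ F) :
    ∃ δ : ℝ, 0 < δ ∧ ∀ u₀ : H, ‖u₀‖ ≤ δ →
      ∃ u : ℝ → H, P.IsSolution (fun j => P.incl hs (B j)) K F u₀ u ∧
        (∀ v : ℝ → H, P.IsSolution (fun j => P.incl hs (B j)) K F u₀ v → EqOn v u (Ici 0)) ∧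
        ∀ t : ℝ, 0 ≤ t → ‖u t‖ ≤ ‖(T.onH : H →L[ℂ] H)‖ * ‖(T.onH.symm : H →L[ℂ] H)‖ *
          Real.exp (-lam * t) * ‖u₀‖ := by
  have hmem : ∀ x, P.MemScale γ (T.onH x) ↔ P.MemScale γ x :=
    h.memScale_onH hγ (by linarith) hγs
  have hmem' : ∀ x, P.MemScale γ (T.onH.symm x) ↔ P.MemScale γ x := fun x => by
    rw [← hmem, ContinuousLinearEquiv.apply_symm_apply]
  obtain ⟨S₁, hS₁⟩ := h.exists_clm_onDual (r := -(1 / 2)) (by norm_num) (by linarith)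
  obtain ⟨S, hS⟩ := P.exists_clm_of_mapsTo hγ (T.onH : H →L[ℂ] H) fun x => (hmem x).2
  obtain ⟨S', hS'⟩ := P.exists_clm_of_mapsTo hγ (T.onH.symm : H →L[ℂ] H) fun x => (hmem' x).2
  simp only [ContinuousLinearEquiv.coe_coe] at hS hS'
  have htoS : ∀ x, P.toScale γ (T.onH x) = S (P.toScale γ x) := by
    intro x
    by_cases hx : P.MemScale γ x
    · rw [← P.toScale_toH hγ (S _), hS, P.toH_toScale hγ hx]
    · rw [show P.toScale γ x = 0 from dif_neg hx, map_zero]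
      exact dif_neg (mt (hmem x).1 hx)
  have htoS' : ∀ x, P.toScale γ (T.onH.symm x) = S' (P.toScale γ x) := by
    intro x
    by_cases hx : P.MemScale γ x
    · rw [← P.toScale_toH hγ (S' _), hS', P.toH_toScale hγ hx]
    · rw [show P.toScale γ x = 0 from dif_neg hx, map_zero]
      exact dif_neg (mt (hmem' x).1 hx)
  set R := P.rhs (fun j => P.incl hs (B j)) K F with hR
  set R' := P.diagRhs (P.targetEig lam mu) (P.targetEig_bound lam mu)
    (fun x => S₁ (F (S' x))) with hR'
  have hRR : ∀ x, T.onDual (R x) = R' (T.onH x) := by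
    intro x
    rw [hR, hR', rhs, diagRhs, map_add, h.intertwine, hS₁, ← htoS',
      ContinuousLinearEquiv.symm_apply_apply]
    rfl
  have hRR' : ∀ x, T.onDual.symm (R' x) = R (T.onH.symm x) := by
    intro x
    rw [ContinuousLinearEquiv.symm_apply_eq, hRR, ContinuousLinearEquiv.apply_symm_apply]
  obtain ⟨c, hc, hτ⟩ := P.exists_targetEig_re_le hmu
  obtain ⟨κ, hκ, hG⟩ := hF.exists_smallOnBall hγ S₁ S' (T.onH.symm : H →L[ℂ] H) hS'
  obtain ⟨δ, hδ, hsol⟩ := exists_unique_decay hlam hc (P.targetEig_bound lam mu) hτ hγ hγ' hκ hG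
  refine ⟨δ / (‖(T.onH : H →L[ℂ] H)‖ + 1), by positivity, fun u₀ hu₀ => ?_⟩
  have hTu : ‖T.onH u₀‖ ≤ ‖(T.onH : H →L[ℂ] H)‖ * ‖u₀‖ := (T.onH : H →L[ℂ] H).le_opNorm u₀
  obtain ⟨v, hv, huniq, hdecay⟩ := hsol (T.onH u₀) (by
    rw [le_div_iff₀ (by positivity)] at hu₀
    nlinarith [norm_nonneg u₀])
  have hu := hv.map (R' := R) (T.onDual.symm : P.Scale (-1) →L[ℂ] P.Scale (-1))
    (T.onH.symm : H →L[ℂ] H) S'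
    (fun x => by
      simp only [ContinuousLinearEquiv.coe_coe]
      rw [ContinuousLinearEquiv.symm_apply_eq, T.onDual_embH,
        ContinuousLinearEquiv.apply_symm_apply]) (fun x => (hmem' x).2) htoS' hRR'
  simp only [ContinuousLinearEquiv.coe_coe, ContinuousLinearEquiv.symm_apply_apply] at hu
  refine ⟨fun t => T.onH.symm (v t), isSolution_iff_solvesWith.2 hu, fun w hw t ht => ?_,
    fun t ht => ?_⟩
  · have hw' := (isSolution_iff_solvesWith.1 hw).map (R' := R')
      (T.onDual : P.Scale (-1) →L[ℂ] P.Scale (-1)) (T.onH : H →L[ℂ] H) S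
      T.onDual_embH (fun x => (hmem x).2) htoS hRR
    simp only
    rw [← huniq _ hw' ht]
    exact (T.onH.symm_apply_apply _).symm
  · calc ‖T.onH.symm (v t)‖ ≤ ‖(T.onH.symm : H →L[ℂ] H)‖ * ‖v t‖ :=
          (T.onH.symm : H →L[ℂ] H).le_opNorm _
      _ ≤ ‖(T.onH.symm : H →L[ℂ] H)‖ *
          (Real.exp (-lam * t) * (‖(T.onH : H →L[ℂ] H)‖ * ‖u₀‖)) := by
        gcongr
        exact (hdecay t ht).trans (by gcongr)
      _ = _ := by ring

end DiagonalParabolic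

end

theorem theorem3p2 {H : Type*} [NormedAddCommGroup H] [InnerProductSpace ℂ H] [CompleteSpace H]
    {A : H →ₗ.[ℂ] H} (P : DiagonalParabolic A)
    (s : ℝ) (hs : s ∈ Set.Icc (0 : ℝ) 1) {m : ℕ} (B : Fin m → P.Scale (-s))
    (F : P.Scale (min (1 - s) (1 / 2)) → P.Scale (-(1 / 2)))
    (hF : P.NonlinearityAssumption (min (1 - s) (1 / 2)) F)
    (lam : ℝ) (hlam : 0 < lam)
    (hB : P.FAdmissible lam fun j => P.incl (neg_le_neg hs.2) (B j)) :
    let B' : Fin (P.maxMult lam) → P.Scale (-1) :=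
      fun j => P.incl (neg_le_neg hs.2) (B (Fin.castLE hB.le j))
    (∀ᵐ mu : ℝ ∂MeasureTheory.volume.restrict (Set.Ici (lam + P.cA)),
      ∃ (T : P.GLH) (K : H →L[ℂ] EuclideanSpace ℂ (Fin (P.maxMult lam))),
        P.IsParabolicFEquivalence lam mu B' T K) ∧
    ∀ mu : ℝ, lam + P.cA < mu →
      ∀ (T : P.GLH) (K : H →L[ℂ] EuclideanSpace ℂ (Fin (P.maxMult lam))),
        P.IsParabolicFEquivalence lam mu B' T K →
        ∃ δ : ℝ, 0 < δ ∧ ∀ u₀ : H, ‖u₀‖ ≤ δ →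
          ∃ u : ℝ → H, P.IsSolution B' K F u₀ u ∧
            (∀ v : ℝ → H, P.IsSolution B' K F u₀ v → Set.EqOn v u (Set.Ici 0)) ∧
            ∀ t : ℝ, 0 ≤ t →
              ‖u t‖ ≤ ‖(T.onH : H →L[ℂ] H)‖ * ‖(T.onH.symm : H →L[ℂ] H)‖ *
                Real.exp (-lam * t) * ‖u₀‖ := by
  intro B'
  refine ⟨ae_restrict_of_ae (P.ae_eig_sub_ne.mono fun mu hmu =>
    P.exists_isParabolicFEquivalence hmu hB), fun mu hmu T K h => ?_⟩
  obtain ⟨hs0, hs1⟩ := hs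
  exact h.exists_solution hlam.le hmu (le_min (by linarith) (by norm_num)) (min_le_right _ _)
    (min_le_left _ _) hF
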